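/- All sequences are real. For $0<r<\infty$ let $\|x\|_{\ell^r}=\big(\sum_{k}|x_k|^r\big)^{1/r}$, let $\|x\|_{\ell^\infty}=\sup_k|x_k|$ and $\|x\|_{\ell^0}=\operatorname{card}\{k: x_k\ne 0\}$; for $0\le r\le\infty$ let $\ell^r$ be the linear space of all sequences $x=(x_k)_{k=1}^\infty$ with $\|x\|_{\ell^r}<\infty$. Let $0\le p<q\le\infty$. For $x\in\ell^p+\ell^q$ and $t>0$ put $$\mathcal K(t,x)=\inf\{\|x_0\|_{\ell^p}+t\|x_1\|_{\ell^q}:\ x=x_0+x_1,\ x_0\in\ell^p,\ x_1\in\ell^q\},$$ and for $x,y\in\ell^p+\ell^q$, $x\neq0$, put $\|y\|_{\mathcal K\text{-}\mathrm{Orb}(x)}=\sup_{t>0}\mathcal K(t,y)/\mathcal K(t,x)\in[0,\infty]$. Let $\mathfrak L(\ell^p,\ell^q)$ be the set of all linear operators $T$ on $\ell^p+\ell^q$ such that $$\|T\|:=\max\Big(\sup_{0\ne u\in\ell^p}\frac{\|Tu\|_{\ell^p}}{\|u\|_{\ell^p}},\ \sup_{0\ne u\in\ell^q}\frac{\|Tu\|_{\ell^q}}{\|u\|_{\ell^q}}\Big)<\infty$$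 (where $\|v\|_{\ell^r}=\infty$ if $v\notin\ell^r$). The couple $(\ell^p,\ell^q)$ is called a Calderón–Mityagin couple if for all $x,y\in\ell^p+\ell^q$ with $x\ne0$ and $\|y\|_{\mathcal K\text{-}\mathrm{Orb}(x)}<\infty$ there is $T\in\mathfrak L(\ell^p,\ell^q)$ with $Tx=y$. It is called a uniform Calderón–Mityagin couple if there is a constant $C$, independent of $x$ and $y$, such that $T$ can moreover always be chosen with $\|T\|\le C\,\|y\|_{\mathcal K\text{-}\mathrm{Orb}(x)}$ when $p>0$, and with $\|T\|\le C\max\big(1,\|y\|_{\mathcal K\text{-}\mathrm{Orb}(x)}\big)$ when $p=0$. Then the following conditions are equivalent: (i) $(\ell^p,\ell^q)$ is a Calderón–Mityagin couple; (ii) $(\ell^p,\ell^q)$ is a uniform Calderón–Mityagin couple; (iii) $q\ge1$. -/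

import Mathlib

open scoped ENNReal NNReal

namespace SeqCouple

/-- The linear space `ℓ^r`, `0 ≤ r ≤ ∞`, as a subspace of the space of all real sequences.
For `r = 0` it consists of the sequences of finite support. -/
def ell (r : ℝ≥0∞) : Submodule ℝ (ℕ → ℝ) where
  carrier := {x | Memℓp x r}
  add_mem' hx hy := hx.add hy
  zero_mem' := zero_memℓp
  smul_mem' c _ hx := hx.const_smul c

open Classical in
/-- The functional `‖x‖_{ℓ^r}` (Mathlib's norm of `lp`), extended by `∞` to sequences outside
`ℓ^r`. It is the cardinality of the support for `r = 0`, `(∑ |x k| ^ r) ^ (1 / r)` for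
`0 < r < ∞`, and `sup |x k|` for `r = ∞`. -/
noncomputable def ellNorm (r : ℝ≥0∞) (x : ℕ → ℝ) : ℝ≥0∞ :=
  if h : Memℓp x r then ENNReal.ofReal ‖(⟨x, h⟩ : lp (fun _ : ℕ => ℝ) r)‖ else ∞

/-- The linear space `ℓ^p + ℓ^q`. -/
abbrev sumSpace (p q : ℝ≥0∞) : Submodule ℝ (ℕ → ℝ) := ell p ⊔ ell q

/-- The Peetre functional `K(t, x; ℓ^p, ℓ^q)`, `t > 0`. -/
noncomputable def K (p q : ℝ≥0∞) (t : ℝ≥0) (x : ℕ → ℝ) : ℝ≥0∞ :=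
  ⨅ (x₀ ∈ ell p) (x₁ ∈ ell q) (_ : x = x₀ + x₁), ellNorm p x₀ + t * ellNorm q x₁

/-- `‖T‖_{ℓ^r → ℓ^r} = sup {‖T x‖ / ‖x‖ : x ∈ ℓ^r, x ≠ 0}` for a linear operator `T` on
`ℓ^p + ℓ^q`; it is `∞` if `T` does not map `ℓ^r` into `ℓ^r`. -/
noncomputable def opNorm {p q : ℝ≥0∞} (r : ℝ≥0∞) (T : sumSpace p q →ₗ[ℝ] sumSpace p q) :
    ℝ≥0∞ :=
  ⨆ (x : sumSpace p q) (_ : (x : ℕ → ℝ) ∈ ell r) (_ : x ≠ 0),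
    ellNorm r (T x : ℕ → ℝ) / ellNorm r (x : ℕ → ℝ)

/-- `‖T‖ = max (‖T‖_{ℓ^p → ℓ^p}, ‖T‖_{ℓ^q → ℓ^q})`. The class `𝔏(ℓ^p, ℓ^q)` consists of the
linear operators on `ℓ^p + ℓ^q` for which this is finite. -/
noncomputable def coupleNorm {p q : ℝ≥0∞} (T : sumSpace p q →ₗ[ℝ] sumSpace p q) : ℝ≥0∞ :=
  max (opNorm p T) (opNorm q T)

/-- `‖y‖_{K-Orb(x)} = sup_{t > 0} K(t, y) / K(t, x)`. The `K`-orbit of `x ≠ 0` consists of the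
`y ∈ ℓ^p + ℓ^q` for which this is finite. -/
noncomputable def kOrbNorm (p q : ℝ≥0∞) (x y : ℕ → ℝ) : ℝ≥0∞ :=
  ⨆ (t : ℝ≥0) (_ : 0 < t), K p q t y / K p q t x

/-- `(ℓ^p, ℓ^q)` is a Calderón–Mityagin couple: `K-Orb(x) ⊆ Orb(x)` for all `x ≠ 0`. -/
def IsCalderonMityagin (p q : ℝ≥0∞) : Prop :=
  ∀ x y : sumSpace p q, x ≠ 0 → kOrbNorm p q x y < ∞ →
    ∃ T : sumSpace p q →ₗ[ℝ] sumSpace p q, coupleNorm T < ∞ ∧ T x = y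

/-- `(ℓ^p, ℓ^q)` is a uniform Calderón–Mityagin couple: in addition `T` can be chosen with
`‖T‖ ≤ C ‖y‖_{K-Orb(x)}`, where `C` does not depend on `x` and `y`.
If `p = 0`, the norm is `≤ C max (1, ‖y‖_{K-Orb(x)})`: the functional of `ℓ^0` is integer-valued
and not homogeneous, so that `‖T‖_{ℓ^0 → ℓ^0} ≥ 1` as soon as `T` does not vanish on `ℓ^0`. -/
def IsUniformCalderonMityagin (p q : ℝ≥0∞) : Prop :=
  ∃ C : ℝ≥0, ∀ x y : sumSpace p q, x ≠ 0 → kOrbNorm p q x y < ∞ →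
    ∃ T : sumSpace p q →ₗ[ℝ] sumSpace p q,
      coupleNorm T ≤ C * (if p = 0 then max 1 (kOrbNorm p q x y) else kOrbNorm p q x y) ∧
        T x = y

end SeqCouple

namespace SeqCouple

/-! Uniformity trivially implies the Calderón–Mityagin property; the content is that q ≥ 1 suffices
and that q < 1 fails.

Sufficiency. An operator is built from a nonnegative matrix that is bounded on both spaces and takes
|x| to a majorant of |y|; signs and a diagonal multiplier then give Tx = y
(`Majorizes.exists_linearMap`). Both sequences may be replaced by decreasing rearrangements s and u,
exact up to a factor 2. For p > 0, at t = (j+1)^(1/p-1/q), the K-functional is comparable to the ℓ^p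
norm of the first j+1 terms plus t times the ℓ^q norm of the tail from j. So, after scaling u, at
each j either the head of u is dominated by that of s, or the tail is. Where heads are dominated,
the powers u_j^p are distributed greedily among the s_k^p (`exists_assignment_of_sum_le`), which
gives a weighted composition bounded on every ℓ^r with r ≥ p. Where tails are dominated, the masses
u_j^q and s_k^q are coupled monotonically from infinity (`exists_tail_coupling`). The resulting
averaging matrix is bounded on ℓ^q by Jensen, which is where q ≥ 1 enters, and on smaller exponents
because its columns have few nonzero entries (`exists_matrix_of_tail_sums`). For p = 0 only tails
matter: as cardinalities are integers, the tail of u from Ln is controlled by the tail of s from n,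
with L of the order of M (`IsRearr.tail_le_tail`).

Necessity. Splitting each entry of a sequence into a block of the same ℓ^q norm does not decrease
its K-functional beyond a constant factor (`K_le_of_le_blockNorm`), so y lies in the K-orbit of its
split version x. If q < 1, splitting makes the ℓ^1 norm much smaller. An operator on the couple has
columns bounded in some ℓ^r with r < q, hence is bounded on ℓ^r and on ℓ^1. For rapidly growing
blocks, the earlier blocks of x are too small in ℓ^r, and the current and later ones too small in
ℓ^1, to produce the current block of y (`not_isCalderonMityagin_of_lt_one`). -/

/-! ### Quasi-norms of sequences with values in [0, ∞] -/

/-- The functional of `ℓ^r` on nonnegative extended sequences. -/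
noncomputable def seqNorm (r : ℝ≥0∞) (u : ℕ → ℝ≥0∞) : ℝ≥0∞ :=
  if r = 0 then ∑' k, (if u k = 0 then 0 else 1)
  else if r = ∞ then ⨆ k, u k
  else (∑' k, u k ^ r.toReal) ^ (1 / r.toReal)

theorem seqNorm_exp_zero (u : ℕ → ℝ≥0∞) :
    seqNorm 0 u = ∑' k, (if u k = 0 then 0 else 1) := by
  simp [seqNorm]

theorem seqNorm_exp_top (u : ℕ → ℝ≥0∞) : seqNorm ∞ u = ⨆ k, u k := by
  simp [seqNorm]

theorem seqNorm_of_pos {r : ℝ≥0∞} (hr : 0 < r.toReal) (u : ℕ → ℝ≥0∞) :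
    seqNorm r u = (∑' k, u k ^ r.toReal) ^ (1 / r.toReal) := by
  have h := ENNReal.toReal_pos_iff.1 hr
  simp [seqNorm, h.1.ne', h.2.ne]

theorem seqNorm_rpow {r : ℝ≥0∞} (hr : 0 < r.toReal) (u : ℕ → ℝ≥0∞) :
    seqNorm r u ^ r.toReal = ∑' k, u k ^ r.toReal := by
  rw [seqNorm_of_pos hr, ← ENNReal.rpow_mul, one_div_mul_cancel hr.ne', ENNReal.rpow_one]

theorem seqNorm_le_iff {r : ℝ≥0∞} (hr : 0 < r.toReal) {u : ℕ → ℝ≥0∞} {C : ℝ≥0∞} :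
    seqNorm r u ≤ C ↔ ∑' k, u k ^ r.toReal ≤ C ^ r.toReal := by
  rw [← seqNorm_rpow hr, ENNReal.rpow_le_rpow_iff hr]

theorem exponent_cases (r : ℝ≥0∞) : r = 0 ∨ r = ∞ ∨ 0 < r.toReal := by
  rcases eq_or_ne r 0 with h | h
  · exact Or.inl h
  rcases eq_or_ne r ∞ with h' | h'
  · exact Or.inr (Or.inl h')
  · exact Or.inr (Or.inr (ENNReal.toReal_pos h h'))

theorem seqNorm_mono (r : ℝ≥0∞) {u v : ℕ → ℝ≥0∞} (h : ∀ k, u k ≤ v k) :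
    seqNorm r u ≤ seqNorm r v := by
  rcases exponent_cases r with rfl | rfl | hr
  · rw [seqNorm_exp_zero, seqNorm_exp_zero]
    refine ENNReal.tsum_le_tsum fun k => ?_
    by_cases hv : v k = 0
    · have : u k = 0 := le_antisymm (hv ▸ h k) zero_le
      simp [hv, this]
    · simp only [hv, if_false]; split_ifs <;> simp
  · rw [seqNorm_exp_top, seqNorm_exp_top]
    exact iSup_mono h
  · rw [seqNorm_of_pos hr, seqNorm_of_pos hr]
    refine ENNReal.rpow_le_rpow (ENNReal.tsum_le_tsum fun k => ?_) (by positivity)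
    exact ENNReal.rpow_le_rpow (h k) hr.le

theorem seqNorm_zero (r : ℝ≥0∞) : seqNorm r (fun _ => 0) = 0 := by
  rcases exponent_cases r with rfl | rfl | hr
  · simp [seqNorm_exp_zero]
  · simp [seqNorm_exp_top]
  · rw [seqNorm_of_pos hr]
    simp [ENNReal.zero_rpow_of_pos hr, hr]

theorem le_seqNorm {r : ℝ≥0∞} (hr : r ≠ 0) (u : ℕ → ℝ≥0∞) (k : ℕ) : u k ≤ seqNorm r u := by
  rcases exponent_cases r with rfl | rfl | hr
  · exact absurd rfl hr
  · rw [seqNorm_exp_top]; exact le_iSup u k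
  · rw [← ENNReal.rpow_le_rpow_iff hr, seqNorm_rpow hr]
    exact ENNReal.le_tsum (f := fun k => u k ^ r.toReal) k

theorem seqNorm_const_mul {r : ℝ≥0∞} (hr : r ≠ 0) (c : ℝ≥0∞) (u : ℕ → ℝ≥0∞) :
    seqNorm r (fun k => c * u k) = c * seqNorm r u := by
  rcases exponent_cases r with rfl | rfl | hr
  · exact absurd rfl hr
  · rw [seqNorm_exp_top, seqNorm_exp_top, ENNReal.mul_iSup]
  · rw [seqNorm_of_pos hr, seqNorm_of_pos hr]
    simp_rw [ENNReal.mul_rpow_of_nonneg _ _ hr.le]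
    rw [ENNReal.tsum_mul_left, ENNReal.mul_rpow_of_nonneg _ _ (by positivity), ← ENNReal.rpow_mul,
      mul_one_div_cancel hr.ne', ENNReal.rpow_one]

theorem seqNorm_exp_zero_const_mul (c : ℝ≥0∞) (u : ℕ → ℝ≥0∞) :
    seqNorm 0 (fun k => c * u k) ≤ seqNorm 0 u := by
  rw [seqNorm_exp_zero, seqNorm_exp_zero]
  refine ENNReal.tsum_le_tsum fun k => ?_
  by_cases hv : u k = 0
  · simp [hv]
  · simp only [hv, if_false]; split_ifs <;> simp

/-- A constant in the quasi-triangle inequality of `ℓ^r`. -/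
noncomputable def quasiConst (r : ℝ≥0∞) : ℝ≥0∞ := 2 ^ (1 + 1 / r.toReal)

theorem two_le_quasiConst (r : ℝ≥0∞) : 2 ≤ quasiConst r := by
  have : (2 : ℝ≥0∞) ^ (1 : ℝ) ≤ 2 ^ (1 + 1 / r.toReal) :=
    ENNReal.rpow_le_rpow_of_exponent_le (by norm_num) (by
      have : 0 ≤ 1 / r.toReal := by positivity
      linarith)
  simpa [quasiConst] using this

theorem one_le_quasiConst (r : ℝ≥0∞) : 1 ≤ quasiConst r :=
  le_trans (by norm_num) (two_le_quasiConst r)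

theorem quasiConst_ne_top (r : ℝ≥0∞) : quasiConst r ≠ ∞ :=
  ENNReal.rpow_ne_top_of_nonneg (by positivity) (by norm_num)

theorem add_rpow_le {a b : ℝ≥0∞} {r : ℝ} (hr : 0 ≤ r) :
    (a + b) ^ r ≤ 2 ^ r * (a ^ r + b ^ r) := by
  have h : a + b ≤ 2 * max a b := by
    rw [two_mul]; exact add_le_add (le_max_left _ _) (le_max_right _ _)
  calc (a + b) ^ r ≤ (2 * max a b) ^ r := ENNReal.rpow_le_rpow h hr
    _ = 2 ^ r * max a b ^ r := ENNReal.mul_rpow_of_nonneg _ _ hr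
    _ ≤ 2 ^ r * (a ^ r + b ^ r) := by
      gcongr
      rcases max_choice a b with h | h <;> rw [h]
      · exact le_self_add
      · exact le_add_self

theorem quasiConst_rpow {r : ℝ≥0∞} (hr : 0 < r.toReal) :
    quasiConst r ^ r.toReal = 2 ^ r.toReal * 2 := by
  rw [quasiConst, ← ENNReal.rpow_mul, add_mul, one_mul, one_div_mul_cancel hr.ne',
    ENNReal.rpow_add _ _ (by norm_num) (by norm_num), ENNReal.rpow_one]

theorem seqNorm_add_le (r : ℝ≥0∞) (u v : ℕ → ℝ≥0∞) :
    seqNorm r (fun k => u k + v k) ≤ quasiConst r * (seqNorm r u + seqNorm r v) := by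
  rcases exponent_cases r with rfl | rfl | hr
  · refine le_trans ?_ (le_mul_of_one_le_left' (one_le_quasiConst 0))
    rw [seqNorm_exp_zero, seqNorm_exp_zero, seqNorm_exp_zero, ← ENNReal.tsum_add]
    refine ENNReal.tsum_le_tsum fun k => ?_
    by_cases hu : u k = 0 <;> by_cases hv : v k = 0 <;> simp [hu, hv]
  · refine le_trans ?_ (le_mul_of_one_le_left' (one_le_quasiConst ∞))
    rw [seqNorm_exp_top, seqNorm_exp_top, seqNorm_exp_top]
    exact iSup_le fun k => add_le_add (le_iSup u k) (le_iSup v k)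
  · rw [seqNorm_le_iff hr, ENNReal.mul_rpow_of_nonneg _ _ hr.le, quasiConst_rpow hr]
    calc ∑' k, (u k + v k) ^ r.toReal
        ≤ ∑' k, 2 ^ r.toReal * (u k ^ r.toReal + v k ^ r.toReal) :=
          ENNReal.tsum_le_tsum fun k => add_rpow_le hr.le
      _ = 2 ^ r.toReal * (seqNorm r u ^ r.toReal + seqNorm r v ^ r.toReal) := by
          rw [ENNReal.tsum_mul_left, ENNReal.tsum_add, seqNorm_rpow hr, seqNorm_rpow hr]
      _ ≤ 2 ^ r.toReal * ((seqNorm r u + seqNorm r v) ^ r.toReal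
            + (seqNorm r u + seqNorm r v) ^ r.toReal) := by
          gcongr
          · exact le_self_add
          · exact le_add_self
      _ = _ := by rw [← two_mul, mul_assoc]

/-- Each term satisfies f^s = f · f^(s-1) ≤ f · (∑ f)^(s-1); summation gives the claim. Infinite
terms need separate care in `key`. -/
theorem tsum_rpow_le_rpow_tsum {ι : Type*} (f : ι → ℝ≥0∞) {s : ℝ} (hs : 1 ≤ s) :
    ∑' k, f k ^ s ≤ (∑' k, f k) ^ s := by
  have key : ∀ k, f k ^ s ≤ f k * (∑' k, f k) ^ (s - 1) := fun k => by
    rcases eq_or_ne (f k) 0 with h0 | h0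
    · simp [h0, (by linarith : 0 < s)]
    rcases eq_or_ne (f k) ∞ with h1 | h1
    · have : ∑' k, f k = ∞ := top_unique (h1 ▸ ENNReal.le_tsum k)
      rcases hs.eq_or_lt with rfl | hs
      · simp
      · rw [this, h1, ENNReal.top_rpow_of_pos (by linarith), ENNReal.top_rpow_of_pos (by linarith)]
        simp
    calc f k ^ s = f k ^ (1 + (s - 1)) := by ring_nf
      _ = f k * f k ^ (s - 1) := by rw [ENNReal.rpow_add _ _ h0 h1, ENNReal.rpow_one]
      _ ≤ _ := by gcongr; exact ENNReal.le_tsum k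
  calc ∑' k, f k ^ s ≤ ∑' k, f k * (∑' k, f k) ^ (s - 1) := ENNReal.tsum_le_tsum key
    _ = (∑' k, f k) * (∑' k, f k) ^ (s - 1) := ENNReal.tsum_mul_right
    _ = (∑' k, f k) ^ (1 + (s - 1)) := by
      rw [ENNReal.rpow_add_of_nonneg _ _ zero_le_one (by linarith), ENNReal.rpow_one]
    _ = _ := by ring_nf

theorem seqNorm_anti {p q : ℝ≥0∞} (hp : p ≠ 0) (hpq : p ≤ q) (u : ℕ → ℝ≥0∞) :
    seqNorm q u ≤ seqNorm p u := by
  rcases exponent_cases q with rfl | rfl | hq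
  · exact absurd (le_antisymm hpq zero_le) hp
  · rw [seqNorm_exp_top]; exact iSup_le fun k => le_seqNorm hp u k
  have hqt := (ENNReal.toReal_pos_iff.1 hq).2
  have hp' : 0 < p.toReal := ENNReal.toReal_pos hp (hpq.trans_lt hqt).ne
  have hle : p.toReal ≤ q.toReal := ENNReal.toReal_mono hqt.ne hpq
  rw [seqNorm_le_iff hq]
  have h := tsum_rpow_le_rpow_tsum (fun k => u k ^ p.toReal) (s := q.toReal / p.toReal)
    ((one_le_div hp').2 hle)
  simp_rw [← ENNReal.rpow_mul, mul_div_cancel₀ _ hp'.ne'] at h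
  refine h.trans (le_of_eq ?_)
  rw [← seqNorm_rpow hp', ← ENNReal.rpow_mul, mul_div_cancel₀ _ hp'.ne']

/-! ### Identification with the functionals of the sequence spaces -/

theorem tsum_enorm_support (x : ℕ → ℝ) :
    (∑' k, if ‖x k‖ₑ = 0 then (0 : ℝ≥0∞) else 1) = ({i | x i ≠ 0} : Set ℕ).encard := by
  rw [← ENNReal.tsum_set_one, tsum_subtype {i | x i ≠ 0} (fun _ => (1 : ℝ≥0∞))]
  refine tsum_congr fun k => ?_
  by_cases h : x k = 0 <;> simp [h]

theorem mem_ell_iff {r : ℝ≥0∞} {x : ℕ → ℝ} :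
    x ∈ ell r ↔ seqNorm r (fun k => ‖x k‖ₑ) ≠ ∞ := by
  change Memℓp x r ↔ _
  rcases exponent_cases r with rfl | rfl | hr
  · rw [memℓp_zero_iff, seqNorm_exp_zero]
    rw [tsum_enorm_support]
    simp
  · rw [memℓp_infty_iff, seqNorm_exp_top]
    constructor
    · rintro ⟨B, hB⟩
      refine ne_top_of_le_ne_top (ENNReal.ofReal_ne_top (r := B)) (iSup_le fun k => ?_)
      rw [← ofReal_norm]
      exact ENNReal.ofReal_le_ofReal (hB ⟨k, rfl⟩)
    · intro h
      refine ⟨(⨆ k, ‖x k‖ₑ).toReal, ?_⟩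
      rintro _ ⟨k, rfl⟩
      have := ENNReal.toReal_mono h (le_iSup (fun k => ‖x k‖ₑ) k)
      simpa using this
  · rw [memℓp_gen_iff hr, seqNorm_of_pos hr, Ne, ENNReal.rpow_eq_top_iff_of_pos (by positivity)]
    have : ∀ k, ‖x k‖ₑ ^ r.toReal = ‖‖x k‖ ^ r.toReal‖ₑ := fun k => by
      rw [← ofReal_norm, ← ofReal_norm, ENNReal.ofReal_rpow_of_nonneg (norm_nonneg _) hr.le,
        Real.norm_of_nonneg (Real.rpow_nonneg (norm_nonneg _) _)]
    simp_rw [this]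
    constructor
    · intro h
      have h2 := h.tsum_ofReal_ne_top
      simpa only [Real.enorm_eq_ofReal (Real.rpow_nonneg (norm_nonneg _) _)] using h2
    · exact fun h => Summable.of_enorm h

theorem ellNorm_eq (r : ℝ≥0∞) (x : ℕ → ℝ) : ellNorm r x = seqNorm r (fun k => ‖x k‖ₑ) := by
  by_cases h : x ∈ ell r
  swap
  · have h' := mem_ell_iff.not.1 h
    rw [not_not] at h'
    rw [h']; exact dif_neg h
  have hne := mem_ell_iff.1 h
  refine (dif_pos h : ellNorm r x = ENNReal.ofReal ‖(⟨x, h⟩ : lp (fun _ : ℕ => ℝ) r)‖).trans ?_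
  rcases exponent_cases r with rfl | rfl | hr
  · rw [lp.norm_eq_card_dsupport, seqNorm_exp_zero]
    rw [tsum_enorm_support, ENNReal.ofReal_natCast,
      Set.Finite.encard_eq_coe_toFinset_card (memℓp_zero_iff.1 h)]
    simp
  · rw [lp.norm_eq_ciSup, seqNorm_exp_top]
    have hb : BddAbove (Set.range fun i => ‖x i‖) := memℓp_infty_iff.1 h
    apply le_antisymm
    · refine ENNReal.ofReal_le_of_le_toReal (ciSup_le fun k => ?_)
      rw [seqNorm_exp_top] at hne
      simpa using ENNReal.toReal_mono hne (le_iSup (fun k => ‖x k‖ₑ) k)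
    · refine iSup_le fun k => ?_
      rw [← ofReal_norm]
      exact ENNReal.ofReal_le_ofReal (le_ciSup hb k)
  · have hs := (memℓp_gen_iff hr).1 h
    rw [lp.norm_eq_tsum_rpow hr, seqNorm_of_pos hr,
      ← ENNReal.ofReal_rpow_of_nonneg (tsum_nonneg fun k => by positivity) (by positivity),
      ENNReal.ofReal_tsum_of_nonneg (fun k => by positivity) hs]
    congr 1
    refine tsum_congr fun k => ?_
    rw [← ofReal_norm, ENNReal.ofReal_rpow_of_nonneg (norm_nonneg _) hr.le]

/-! ### Bounded nonnegative matrices and majorization -/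

/-- The action of a nonnegative matrix on nonnegative sequences. -/
noncomputable def app (A : ℕ → ℕ → ℝ≥0∞) (u : ℕ → ℝ≥0∞) (j : ℕ) : ℝ≥0∞ := ∑' k, A j k * u k

/-- The matrix `A` is bounded by `C` on `ℓ^r`. -/
def IsBdd (r C : ℝ≥0∞) (A : ℕ → ℕ → ℝ≥0∞) : Prop :=
  ∀ u, seqNorm r (app A u) ≤ C * seqNorm r u

theorem IsBdd.mono {r C C' : ℝ≥0∞} {A : ℕ → ℕ → ℝ≥0∞} (h : IsBdd r C A) (hC : C ≤ C') :
    IsBdd r C' A := fun u => (h u).trans (by gcongr)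

theorem app_mono {A : ℕ → ℕ → ℝ≥0∞} {u v : ℕ → ℝ≥0∞} (h : ∀ k, u k ≤ v k) (j : ℕ) :
    app A u j ≤ app A v j := ENNReal.tsum_le_tsum fun k => mul_le_mul_right (h k) _

theorem app_add (A B : ℕ → ℕ → ℝ≥0∞) (u : ℕ → ℝ≥0∞) (j : ℕ) :
    app (fun j k => A j k + B j k) u j = app A u j + app B u j := by
  simp only [app, add_mul, ENNReal.tsum_add]

theorem app_app (A B : ℕ → ℕ → ℝ≥0∞) (u : ℕ → ℝ≥0∞) (j : ℕ) :
    app (fun j l => ∑' k, A j k * B k l) u j = app A (app B u) j := by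
  simp only [app, ← ENNReal.tsum_mul_right, ← ENNReal.tsum_mul_left, mul_assoc]
  exact ENNReal.tsum_comm

theorem app_const_mul (c : ℝ≥0∞) (A : ℕ → ℕ → ℝ≥0∞) (u : ℕ → ℝ≥0∞) (j : ℕ) :
    app (fun j k => c * A j k) u j = c * app A u j := by
  simp only [app, mul_assoc, ENNReal.tsum_mul_left]

theorem IsBdd.add {r C D : ℝ≥0∞} {A B : ℕ → ℕ → ℝ≥0∞} (hA : IsBdd r C A) (hB : IsBdd r D B) :
    IsBdd r (quasiConst r * (C + D)) (fun j k => A j k + B j k) := fun u => by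
  simp_rw [funext (app_add A B u)]
  refine (seqNorm_add_le r _ _).trans ?_
  rw [mul_assoc, add_mul]
  gcongr
  exacts [hA u, hB u]

theorem IsBdd.comp {r C D : ℝ≥0∞} {A B : ℕ → ℕ → ℝ≥0∞} (hA : IsBdd r C A) (hB : IsBdd r D B) :
    IsBdd r (C * D) (fun j l => ∑' k, A j k * B k l) := fun u => by
  rw [funext (app_app A B u)]
  refine (hA _).trans ?_
  rw [mul_assoc]
  gcongr
  exact hB u

/-- A factor below 1 does not shrink a cardinality, so for exponent 0 the bound scales only when 1 ≤
c. -/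
theorem IsBdd.const_mul {r C : ℝ≥0∞} {A : ℕ → ℕ → ℝ≥0∞} (hA : IsBdd r C A) {c : ℝ≥0∞}
    (hc : r ≠ 0 ∨ 1 ≤ c) : IsBdd r (c * C) (fun j k => c * A j k) := fun u => by
  rw [funext (app_const_mul c A u)]
  rcases eq_or_ne r 0 with rfl | hr
  · rw [mul_assoc]
    exact (seqNorm_exp_zero_const_mul c _).trans
      ((hA u).trans (le_mul_of_one_le_left' (hc.resolve_left (by simp))))
  · rw [seqNorm_const_mul hr, mul_assoc]
    gcongr
    exact hA u

/-- `y` is dominated by the image of `x` under a nonnegative matrix that is bounded by `C` on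
`ℓ^p` and on `ℓ^q`. -/
def Majorizes (p q C : ℝ≥0∞) (x y : ℕ → ℝ≥0∞) : Prop :=
  ∃ A, IsBdd p C A ∧ IsBdd q C A ∧ ∀ j, y j ≤ app A x j

theorem Majorizes.mono {p q C C' : ℝ≥0∞} {x y : ℕ → ℝ≥0∞} (h : Majorizes p q C x y)
    (hC : C ≤ C') : Majorizes p q C' x y := by
  obtain ⟨A, h1, h2, h3⟩ := h
  exact ⟨A, h1.mono hC, h2.mono hC, h3⟩

theorem Majorizes.trans {p q C D : ℝ≥0∞} {x y z : ℕ → ℝ≥0∞} (h : Majorizes p q C x y)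
    (h' : Majorizes p q D y z) : Majorizes p q (D * C) x z := by
  obtain ⟨A, h1, h2, h3⟩ := h
  obtain ⟨B, h4, h5, h6⟩ := h'
  refine ⟨_, h4.comp h1, h5.comp h2, fun j => ?_⟩
  rw [app_app]
  exact (h6 j).trans (app_mono h3 j)

theorem Majorizes.add {p q C D : ℝ≥0∞} {x y z w : ℕ → ℝ≥0∞} (h : Majorizes p q C x y)
    (h' : Majorizes p q D x z) (hw : ∀ j, w j ≤ y j + z j) :
    Majorizes p q (quasiConst p * quasiConst q * (C + D)) x w := by
  obtain ⟨A, h1, h2, h3⟩ := h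
  obtain ⟨B, h4, h5, h6⟩ := h'
  refine ⟨_, (h1.add h4).mono ?_, (h2.add h5).mono ?_, fun j => ?_⟩
  · gcongr
    exact le_mul_of_one_le_right' (one_le_quasiConst q)
  · gcongr
    exact le_mul_of_one_le_left' (one_le_quasiConst p)
  · rw [app_add]
    exact (hw j).trans (add_le_add (h3 j) (h6 j))

theorem Majorizes.const_mul {p q C : ℝ≥0∞} {x y : ℕ → ℝ≥0∞} (h : Majorizes p q C x y)
    {c : ℝ≥0∞} (hc : p ≠ 0 ∨ 1 ≤ c) (hq : q ≠ 0) :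
    Majorizes p q (c * C) x (fun j => c * y j) := by
  obtain ⟨A, h1, h2, h3⟩ := h
  refine ⟨_, h1.const_mul hc, h2.const_mul (Or.inl hq), fun j => ?_⟩
  rw [app_const_mul]
  exact mul_le_mul_right (h3 j) c

/-! ### Weighted composition operators -/

/-- The matrix of the weighted composition operator `u ↦ d * (u ∘ κ)`. -/
noncomputable def weightedComp (d : ℕ → ℝ≥0∞) (κ : ℕ → ℕ) (j k : ℕ) : ℝ≥0∞ :=
  if k = κ j then d j else 0

theorem app_weightedComp (d : ℕ → ℝ≥0∞) (κ : ℕ → ℕ) (u : ℕ → ℝ≥0∞) (j : ℕ) :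
    app (weightedComp d κ) u j = d j * u (κ j) := by
  rw [app, tsum_eq_single (κ j)]
  · simp [weightedComp]
  · intro k hk
    simp [weightedComp, hk]

theorem tsum_fiber (κ : ℕ → ℕ) (f : ℕ → ℝ≥0∞) :
    ∑' j, f j = ∑' k, ∑' j, if κ j = k then f j else 0 := by
  rw [ENNReal.tsum_comm]
  refine tsum_congr fun j => ?_
  rw [tsum_eq_single (κ j)]
  · simp
  · intro k hk
    simp [hk.symm]

/-- On a fibre of `κ` the sequence u ∘ κ is constant, so summing fibre by fibre leaves only the
number of nonzero weights in each fibre. -/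
theorem isBdd_weightedComp_zero {d : ℕ → ℝ≥0∞} {κ : ℕ → ℕ} {C : ℝ≥0∞}
    (h : ∀ k, (∑' j, if κ j = k then (if d j = 0 then 0 else 1) else 0) ≤ C) :
    IsBdd 0 C (weightedComp d κ) := fun u => by
  rw [funext (app_weightedComp d κ u), seqNorm_exp_zero, seqNorm_exp_zero, tsum_fiber κ,
    ← ENNReal.tsum_mul_left]
  refine ENNReal.tsum_le_tsum fun k => ?_
  by_cases hk : u k = 0
  · rw [if_pos hk, mul_zero]
    refine le_of_eq (ENNReal.tsum_eq_zero.2 fun j => ?_)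
    split_ifs with h1 h2 <;> simp_all
  · rw [if_neg hk, mul_one]
    refine le_trans (ENNReal.tsum_le_tsum fun j => ?_) (h k)
    by_cases h1 : κ j = k <;> by_cases h2 : d j = 0 <;> simp [h1, h2, hk]

theorem isBdd_weightedComp_top {d : ℕ → ℝ≥0∞} {κ : ℕ → ℕ} {C : ℝ≥0∞} (h : ∀ j, d j ≤ C) :
    IsBdd ∞ C (weightedComp d κ) := fun u => by
  rw [funext (app_weightedComp d κ u), seqNorm_exp_top, seqNorm_exp_top]
  exact iSup_le fun j => mul_le_mul' (h j) (le_iSup u _)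

theorem isBdd_weightedComp_of_pos {d : ℕ → ℝ≥0∞} {κ : ℕ → ℕ} {C r : ℝ≥0∞} (hr : 0 < r.toReal)
    (h : ∀ k, (∑' j, if κ j = k then d j ^ r.toReal else 0) ≤ C ^ r.toReal) :
    IsBdd r C (weightedComp d κ) := fun u => by
  rw [funext (app_weightedComp d κ u), seqNorm_le_iff hr, ENNReal.mul_rpow_of_nonneg _ _ hr.le,
    seqNorm_rpow hr, tsum_fiber κ, ← ENNReal.tsum_mul_left]
  refine ENNReal.tsum_le_tsum fun k => ?_
  refine le_trans (le_of_eq ?_) (mul_le_mul_left (h k) _)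
  rw [← ENNReal.tsum_mul_right]
  refine tsum_congr fun j => ?_
  by_cases h1 : κ j = k
  · simp [h1, ENNReal.mul_rpow_of_nonneg _ _ hr.le]
  · simp [h1]

/-- A weighted composition by an injection, with weights `≤ C`, is bounded by `C`. -/
theorem isBdd_weightedComp_of_injOn {d : ℕ → ℝ≥0∞} {κ : ℕ → ℕ} {C : ℝ≥0∞} (r : ℝ≥0∞)
    (hκ : Set.InjOn κ {j | d j ≠ 0}) (hd : ∀ j, d j ≤ C) (hC : 1 ≤ C) :
    IsBdd r C (weightedComp d κ) := by
  -- Each fibre of `κ` carries at most one nonzero weight; `g` is the indicator of nonzero values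
  -- for exponent 0 and a power for positive finite exponents.
  have key : ∀ (g : ℝ≥0∞ → ℝ≥0∞) (B : ℝ≥0∞), g 0 = 0 → (∀ j, g (d j) ≤ B) →
      ∀ k, (∑' j, if κ j = k then g (d j) else 0) ≤ B := by
    intro g B g0 hg k
    by_cases hk : ∃ j, κ j = k ∧ d j ≠ 0
    · obtain ⟨j, hj, hj'⟩ := hk
      rw [tsum_eq_single j]
      · rw [if_pos hj]; exact hg j
      · intro i hi
        by_cases h0 : d i = 0
        · simp [h0, g0]
        · rw [if_neg]
          intro h
          exact hi (hκ h0 hj' (h.trans hj.symm))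
    · push Not at hk
      refine le_trans (le_of_eq (ENNReal.tsum_eq_zero.2 fun j => ?_)) zero_le
      split_ifs with h
      · rw [hk j h, g0]
      · rfl
  rcases exponent_cases r with rfl | rfl | hr
  · refine isBdd_weightedComp_zero (key (fun a => if a = 0 then 0 else 1) C (by simp) fun j => ?_)
    split_ifs
    exacts [zero_le, hC]
  · exact isBdd_weightedComp_top hd
  · exact isBdd_weightedComp_of_pos hr (key (fun a => a ^ r.toReal) _
      (ENNReal.zero_rpow_of_pos hr) fun j => ENNReal.rpow_le_rpow (hd j) hr.le)

theorem seqNorm_single {r : ℝ≥0∞} (hr : r ≠ 0) (k : ℕ) :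
    seqNorm r (fun l => if l = k then 1 else 0) = 1 := by
  rcases exponent_cases r with rfl | rfl | hr
  · exact absurd rfl hr
  · rw [seqNorm_exp_top]
    refine le_antisymm (iSup_le fun l => ?_) (le_iSup_of_le k (by simp))
    split_ifs <;> simp
  · rw [seqNorm_of_pos hr, tsum_eq_single k]
    · simp
    · intro l hl
      simp [hl, hr]

theorem IsBdd.entry_le {r C : ℝ≥0∞} {A : ℕ → ℕ → ℝ≥0∞} (hA : IsBdd r C A) (hr : r ≠ 0)
    (j k : ℕ) : A j k ≤ C := by
  have h := (le_seqNorm hr _ j).trans (hA (fun l => if l = k then 1 else 0))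
  rw [seqNorm_single hr, mul_one] at h
  simpa [app] using h

/-! ### From matrices to linear operators -/

theorem mem_sumSpace_iff {p q : ℝ≥0∞} (hpq : p < q) {x : ℕ → ℝ} : x ∈ sumSpace p q ↔ x ∈ ell q := by
  have : ell p ≤ ell q := fun x hx => Memℓp.of_exponent_ge hx hpq.le
  rw [sumSpace, sup_eq_right.2 this]

/-- The linear operator with a real matrix that is dominated by a bounded nonnegative matrix. -/
theorem exists_linearMap_of_matrix {p q C : ℝ≥0∞} (hpq : p < q) (hC : C ≠ ∞)
    {A : ℕ → ℕ → ℝ≥0∞} (hp : IsBdd p C A) (hq : IsBdd q C A) (a : ℕ → ℕ → ℝ)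
    (ha : ∀ j k, ‖a j k‖ₑ ≤ A j k) :
    ∃ T : sumSpace p q →ₗ[ℝ] sumSpace p q, coupleNorm T ≤ C ∧
      ∀ z j, (T z : ℕ → ℝ) j = ∑' k, a j k * (z : ℕ → ℝ) k := by
  have hq0 : q ≠ 0 := (bot_le.trans_lt hpq).ne'
  have hfin : ∀ z : sumSpace p q, seqNorm q (fun k => ‖(z : ℕ → ℝ) k‖ₑ) ≠ ∞ := fun z =>
    mem_ell_iff.1 ((mem_sumSpace_iff hpq).1 z.2)
  have happ : ∀ (z : ℕ → ℝ) j, ∑' k, ‖a j k * z k‖ₑ ≤ app A (fun k => ‖z k‖ₑ) j := fun z j => by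
    refine ENNReal.tsum_le_tsum fun k => ?_
    rw [enorm_mul]
    gcongr
    exact ha j k
  have hsum : ∀ (z : sumSpace p q) j, Summable fun k => a j k * (z : ℕ → ℝ) k := fun z j => by
    refine Summable.of_enorm (ne_top_of_le_ne_top ?_ (happ z j))
    exact ne_top_of_le_ne_top (ENNReal.mul_ne_top hC (hfin z)) ((le_seqNorm hq0 _ j).trans (hq _))
  have hnorm : ∀ (r : ℝ≥0∞), IsBdd r C A → ∀ z : ℕ → ℝ,
      seqNorm r (fun j => ‖∑' k, a j k * z k‖ₑ) ≤ C * seqNorm r (fun k => ‖z k‖ₑ) :=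
    fun r hr z => (seqNorm_mono r fun j => enorm_tsum_le_tsum_enorm.trans (happ z j)).trans (hr _)
  let T : sumSpace p q →ₗ[ℝ] sumSpace p q :=
    { toFun := fun z => ⟨fun j => ∑' k, a j k * (z : ℕ → ℝ) k, (mem_sumSpace_iff hpq).2 <|
        mem_ell_iff.2 <| ne_top_of_le_ne_top (ENNReal.mul_ne_top hC (hfin z)) (hnorm q hq z)⟩
      map_add' := fun z w => by
        ext j
        simp only [Submodule.coe_add, Pi.add_apply, mul_add]
        exact (hsum z j).tsum_add (hsum w j)
      map_smul' := fun c z => by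
        ext j
        simp only [Submodule.coe_smul, Pi.smul_apply, smul_eq_mul, RingHom.id_apply,
          mul_left_comm _ c, tsum_mul_left] }
  have hT : ∀ r, IsBdd r C A → opNorm r T ≤ C := fun r hr => by
    refine iSup_le fun z => iSup_le fun _ => iSup_le fun _ => ENNReal.div_le_of_le_mul ?_
    rw [ellNorm_eq, ellNorm_eq]
    exact hnorm r hr z
  exact ⟨T, max_le (hT p hp) (hT q hq), fun z j => rfl⟩

/-- With b = A|x|, the matrix diag(y/b) · A · diag(sign x) is dominated entrywise by A because |y| ≤
b, and it sends x to (y/b) · b = y. -/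
theorem Majorizes.exists_linearMap {p q C : ℝ≥0∞} (hpq : p < q) (hC : C ≠ ∞)
    {x y : sumSpace p q}
    (h : Majorizes p q C (fun k => ‖(x : ℕ → ℝ) k‖ₑ) (fun k => ‖(y : ℕ → ℝ) k‖ₑ)) :
    ∃ T : sumSpace p q →ₗ[ℝ] sumSpace p q, coupleNorm T ≤ C ∧ T x = y := by
  obtain ⟨A, hp, hq, hA⟩ := h
  have hq0 : q ≠ 0 := (bot_le.trans_lt hpq).ne'
  set X : ℕ → ℝ := x.1 with hX
  set Y : ℕ → ℝ := y.1 with hY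
  set b : ℕ → ℝ≥0∞ := app A (fun k => ‖X k‖ₑ) with hb
  have hxfin : seqNorm q (fun k => ‖X k‖ₑ) ≠ ∞ := mem_ell_iff.1 ((mem_sumSpace_iff hpq).1 x.2)
  have hbfin : ∀ j, b j ≠ ∞ := fun j =>
    ne_top_of_le_ne_top (ENNReal.mul_ne_top hC hxfin) ((le_seqNorm hq0 _ j).trans (hq _))
  have hAfin : ∀ j k, A j k ≠ ∞ := fun j k => ne_top_of_le_ne_top hC (hq.entry_le hq0 j k)
  have hθ : ∀ j, ‖Y j / (b j).toReal‖ₑ ≤ 1 := fun j => by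
    rw [← ofReal_norm, ← ENNReal.ofReal_one]
    refine ENNReal.ofReal_le_ofReal ?_
    rw [norm_div, Real.norm_of_nonneg ENNReal.toReal_nonneg]
    refine div_le_one_of_le₀ ?_ ENNReal.toReal_nonneg
    simpa using ENNReal.toReal_mono (hbfin j) (hA j)
  obtain ⟨T, hT, hTz⟩ := exists_linearMap_of_matrix hpq hC hp hq
    (fun j k => Y j / (b j).toReal * SignType.sign (X k) * (A j k).toReal) fun j k => by
      rw [enorm_mul, enorm_mul, Real.enorm_of_nonneg (r := (A j k).toReal) ENNReal.toReal_nonneg,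
        ENNReal.ofReal_toReal (hAfin j k)]
      refine mul_le_of_le_one_left' (mul_le_one' (hθ j) ?_)
      rcases lt_trichotomy (X k) 0 with h | h | h <;> simp [h, sign_neg, sign_pos]
  refine ⟨T, hT, Subtype.ext (funext fun j => ?_)⟩
  rw [hTz]
  change ∑' k, Y j / (b j).toReal * SignType.sign (X k) * (A j k).toReal * X k = Y j
  have h1 : ∀ k, Y j / (b j).toReal * SignType.sign (X k) * (A j k).toReal * X k
      = Y j / (b j).toReal * (A j k * ‖X k‖ₑ).toReal := fun k => by
    rw [ENNReal.toReal_mul, toReal_enorm, Real.norm_eq_abs, ← sign_mul_self (X k)]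
    ring
  simp_rw [h1]
  have hterm : ∀ k, A j k * ‖X k‖ₑ ≠ ∞ := fun k => ENNReal.mul_ne_top (hAfin j k) enorm_ne_top
  rw [tsum_mul_left, ← ENNReal.tsum_toReal_eq hterm]
  change Y j / (b j).toReal * (b j).toReal = Y j
  -- Where b vanishes so does y, hence the convention y/0 = 0 gives the right value.
  refine div_mul_cancel_of_imp fun h0 => ?_
  have h2 : b j = 0 := (ENNReal.toReal_eq_zero_iff _).1 h0 |>.resolve_right (hbfin j)
  have h3 := hA j
  change ‖Y j‖ₑ ≤ b j at h3
  rw [h2] at h3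
  simpa using h3

/-! ### Approximate decreasing rearrangements -/

open Classical in
/-- The matrix of the extension by zero along `σ`. -/
noncomputable def extMatrix (σ : ℕ → ℕ) : ℕ → ℕ → ℝ≥0∞ :=
  weightedComp (fun k => if k ∈ Set.range σ then 1 else 0) (Function.invFun σ)

theorem app_extMatrix {σ : ℕ → ℕ} (hσ : Function.Injective σ) (u : ℕ → ℝ≥0∞) (i : ℕ) :
    app (extMatrix σ) u (σ i) = u i := by
  rw [extMatrix, app_weightedComp, Function.leftInverse_invFun hσ i]
  simp

theorem isBdd_extMatrix (σ : ℕ → ℕ) (r : ℝ≥0∞) : IsBdd r 1 (extMatrix σ) := by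
  classical
  refine isBdd_weightedComp_of_injOn r ?_ (fun j => ?_) le_rfl
  · intro a ha b hb hab
    have h : ∀ c, (if c ∈ Set.range σ then (1 : ℝ≥0∞) else 0) ≠ 0 →
        σ (Function.invFun σ c) = c := fun c hc => Function.invFun_eq (by
      by_contra h
      exact hc (if_neg h))
    rw [← h a ha, ← h b hb, hab]
  · split_ifs <;> simp

/-- `s` is, up to a factor `2`, a decreasing rearrangement of `x`, with enumeration `σ`. -/
structure IsRearr (x s : ℕ → ℝ≥0∞) (σ : ℕ → ℕ) : Prop where
  inj : Function.Injective σ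
  anti : Antitone s
  le_two_mul : ∀ n, s n ≤ 2 * x (σ n)
  cover : ∀ n k, (∀ i < n, σ i ≠ k) → x k ≤ s n

/-- The supremum over the complement of a finite set may not be attained, but some index reaches
half of it. Choosing such an index repeatedly gives `σ`, and s n is the supremum over what is left
after n choices. -/
theorem exists_isRearr {x : ℕ → ℝ≥0∞} (hx : ⨆ k, x k ≠ ∞) : ∃ s σ, IsRearr x s σ := by
  have hg : ∀ F : Finset ℕ, ∃ m, m ∉ F ∧ (⨆ k, ⨆ (_ : k ∉ F), x k) ≤ 2 * x m := fun F => by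
    set a := ⨆ k, ⨆ (_ : k ∉ F), x k with ha
    rcases eq_or_ne a 0 with h0 | h0
    · obtain ⟨m, hm⟩ := Infinite.exists_notMem_finset F
      exact ⟨m, hm, by rw [h0]; exact zero_le⟩
    · have hat : a ≠ ∞ := ne_top_of_le_ne_top hx (iSup_mono fun k => iSup_le fun _ => le_rfl)
      have hlt : a / 2 < ⨆ k, ⨆ (_ : k ∉ F), x k := ENNReal.half_lt_self h0 hat
      simp only [lt_iSup_iff] at hlt
      obtain ⟨m, hm, hlt⟩ := hlt
      refine ⟨m, hm, ?_⟩
      have := (ENNReal.div_le_iff_le_mul (by simp) (by simp)).1 hlt.le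
      rwa [mul_comm]
  choose g hg1 hg2 using hg
  let F : ℕ → Finset ℕ := fun n => Nat.rec ∅ (fun _ G => insert (g G) G) n
  have hF : ∀ n, F (n + 1) = insert (g (F n)) (F n) := fun n => rfl
  have hmono : Monotone F := monotone_nat_of_le_succ fun n => by
    rw [hF]; exact Finset.subset_insert _ _
  have hmem : ∀ n k, k ∈ F n → ∃ i < n, g (F i) = k := by
    intro n
    induction n with
    | zero => intro k hk; exact absurd hk (Finset.notMem_empty k)
    | succ n ih =>
      intro k hk
      rw [hF, Finset.mem_insert] at hk
      rcases hk with rfl | hk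
      · exact ⟨n, Nat.lt_succ_self n, rfl⟩
      · obtain ⟨i, hi, h⟩ := ih k hk
        exact ⟨i, hi.trans (Nat.lt_succ_self n), h⟩
  have hne : ∀ i j, i < j → g (F i) ≠ g (F j) := fun i j hij h => by
    have h1 : g (F i) ∈ F (i + 1) := by rw [hF]; exact Finset.mem_insert_self _ _
    exact hg1 (F j) (h ▸ hmono hij h1)
  refine ⟨fun n => ⨆ k, ⨆ (_ : k ∉ F n), x k, fun n => g (F n), ?_, ?_, fun n => hg2 (F n), ?_⟩
  · intro i j h
    by_contra hij
    rcases lt_or_gt_of_ne hij with hlt | hlt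
    exacts [hne i j hlt h, hne j i hlt h.symm]
  · intro m n hmn
    exact iSup_mono fun k => iSup_mono' fun hk => ⟨fun h => hk (hmono hmn h), le_rfl⟩
  · intro n k hk
    refine le_iSup₂_of_le k (fun h => ?_) le_rfl
    obtain ⟨i, hi, h⟩ := hmem n k h
    exact hk i hi h

namespace IsRearr

variable {x s : ℕ → ℝ≥0∞} {σ : ℕ → ℕ}

theorem le_apply (h : IsRearr x s σ) (n : ℕ) : x (σ n) ≤ s n :=
  h.cover n _ fun _ hi he => hi.ne (h.inj he)

theorem seqNorm_le (h : IsRearr x s σ) (r : ℝ≥0∞) :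
    seqNorm r s ≤ 2 * seqNorm r x := by
  have hb : IsBdd r 2 (weightedComp (fun _ => 2) σ) :=
    isBdd_weightedComp_of_injOn r h.inj.injOn (fun _ => le_rfl) (by norm_num)
  refine le_trans (seqNorm_mono r fun n => ?_) (hb x)
  rw [app_weightedComp]
  exact h.le_two_mul n

theorem majorizes (h : IsRearr x s σ) (p q : ℝ≥0∞) : Majorizes p q 2 x s :=
  ⟨weightedComp (fun _ => 2) σ,
    isBdd_weightedComp_of_injOn p h.inj.injOn (fun _ => le_rfl) (by norm_num),
    isBdd_weightedComp_of_injOn q h.inj.injOn (fun _ => le_rfl) (by norm_num),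
    fun n => by rw [app_weightedComp]; exact h.le_two_mul n⟩

/-- Chosen indices are recovered by extending s along `σ`. An index k that is never chosen satisfies
x k ≤ s n for every n, in particular for n = k, so the identity matrix covers it. -/
theorem majorizes_symm (h : IsRearr x s σ) (p q : ℝ≥0∞) :
    Majorizes p q (quasiConst p * quasiConst q * (1 + 1)) s x := by
  have h1 : Majorizes p q 1 s (app (extMatrix σ) s) :=
    ⟨extMatrix σ, isBdd_extMatrix σ p, isBdd_extMatrix σ q, fun _ => le_rfl⟩
  have hid : ∀ r, IsBdd r 1 (weightedComp (fun _ => 1) id) := fun r =>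
    isBdd_weightedComp_of_injOn r Function.injective_id.injOn (fun _ => le_rfl) le_rfl
  have h2 : Majorizes p q 1 s s :=
    ⟨_, hid p, hid q, fun j => by rw [app_weightedComp, one_mul]; rfl⟩
  refine h1.add h2 fun k => ?_
  by_cases hk : ∃ i, σ i = k
  · obtain ⟨i, rfl⟩ := hk
    rw [app_extMatrix h.inj]
    exact (h.le_apply i).trans le_self_add
  · push Not at hk
    exact (h.cover k k fun i _ => hk i).trans le_add_self

/-- The decomposition that cuts x down to its first n chosen indices is tested in the infimum. -/
theorem K_le {x : ℕ → ℝ} (h : IsRearr (fun k => ‖x k‖ₑ) s σ) {p q : ℝ≥0∞} (hx : x ∈ ell q)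
    (t : ℝ≥0) (n : ℕ) :
    K p q t x ≤ seqNorm p (fun i => if i < n then s i else 0)
      + t * (quasiConst q * (2 * seqNorm q (fun i => s (i + n)))) := by
  classical
  set H := seqNorm p (fun i => if i < n then s i else 0) with hH
  rcases eq_or_ne H ∞ with hHt | hHt
  · rw [hHt, top_add]; exact le_top
  set x₀ : ℕ → ℝ := fun k => if ∃ i < n, σ i = k then x k else 0 with hx₀
  set x₁ : ℕ → ℝ := fun k => if ∃ i < n, σ i = k then 0 else x k with hx₁
  have h0 : seqNorm p (fun k => ‖x₀ k‖ₑ) ≤ H := by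
    refine le_trans (seqNorm_mono p fun k => ?_) ((isBdd_extMatrix σ p _).trans (one_mul H).le)
    by_cases hk : ∃ i < n, σ i = k
    · obtain ⟨i, hi, rfl⟩ := hk
      rw [app_extMatrix h.inj, if_pos hi, hx₀]
      dsimp only
      rw [if_pos ⟨i, hi, rfl⟩]
      exact h.le_apply i
    · simp only [hx₀, if_neg hk, enorm_zero]; exact zero_le
  have h1 : seqNorm q (fun k => ‖x₁ k‖ₑ)
      ≤ quasiConst q * (2 * seqNorm q (fun i => s (i + n))) := by
    have hσ : Function.Injective fun i => σ (i + n) := fun a b hab => by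
      simpa using h.inj hab
    -- The second summand s (k + n) takes care of the indices that `σ` never reaches.
    refine le_trans (seqNorm_mono q (v := fun k =>
      app (extMatrix fun i => σ (i + n)) (fun i => s (i + n)) k + s (k + n)) fun k => ?_) ?_
    · by_cases hk : ∃ i < n, σ i = k
      · simp only [hx₁, if_pos hk, enorm_zero]; exact zero_le
      · simp only [hx₁, if_neg hk]
        push Not at hk
        by_cases hk' : ∃ i, σ (i + n) = k
        · obtain ⟨i, rfl⟩ := hk'
          rw [app_extMatrix (σ := fun i => σ (i + n)) hσ]
          exact (h.le_apply _).trans le_self_add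
        · push Not at hk'
          refine le_trans (h.cover (k + n) k fun i _ => ?_) le_add_self
          rcases lt_or_ge i n with hi | hi
          · exact hk i hi
          · obtain ⟨m, rfl⟩ := Nat.exists_eq_add_of_le' hi
            exact hk' m
    · refine (seqNorm_add_le q _ _).trans ?_
      rw [two_mul]
      gcongr
      exact (isBdd_extMatrix _ q _).trans (one_mul _).le
  have hm0 : x₀ ∈ ell p := mem_ell_iff.2 (ne_top_of_le_ne_top hHt h0)
  have hm1 : x₁ ∈ ell q := mem_ell_iff.2 <| ne_top_of_le_ne_top (mem_ell_iff.1 hx) <|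
    seqNorm_mono q fun k => by
      simp only [hx₁]
      split_ifs <;> simp
  refine (iInf₂_le_of_le x₀ hm0 (iInf₂_le_of_le x₁ hm1 (iInf_le _ ?_))).trans
    (add_le_add ((ellNorm_eq p x₀).le.trans h0)
      (mul_le_mul_right ((ellNorm_eq q x₁).le.trans h1) _))
  funext k
  simp only [hx₀, hx₁, Pi.add_apply]
  split_ifs <;> simp

end IsRearr

/-! ### Domination of heads: greedy assignment -/

open Classical in
/-- If the partial sums of `b` are at most half of those of `a` at the indices in `S`, then the
terms of `b` with index in `S` can be distributed among larger terms of `a` in such a way that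
each term of `a` receives terms with sum at most twice its size. -/
theorem exists_assignment_of_sum_le {a b : ℕ → ℝ} (ha : Antitone a) (hb : Antitone b)
    (ha0 : ∀ i, 0 ≤ a i) (hb0 : ∀ i, 0 ≤ b i) {S : Set ℕ}
    (hS : ∀ j ∈ S, 2 * ∑ i ∈ Finset.range (j + 1), b i ≤ ∑ i ∈ Finset.range (j + 1), a i) :
    ∃ κ : ℕ → ℕ, (∀ j ∈ S, 0 < b j → b j ≤ a (κ j)) ∧
      ∀ k (J : Finset ℕ), (∀ j ∈ J, j ∈ S ∧ 0 < b j ∧ κ j = k) → ∑ j ∈ J, b j ≤ 2 * a k := by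
  set A : ℕ → ℝ := fun n => ∑ i ∈ Finset.range n, a i with hA
  set B : ℕ → ℝ := fun n => ∑ i ∈ Finset.range n, if i ∈ S then b i else 0 with hB
  have hAs : ∀ n, A (n + 1) = A n + a n := fun n => Finset.sum_range_succ _ _
  have hBle : ∀ n, B n ≤ ∑ i ∈ Finset.range n, b i := fun n =>
    Finset.sum_le_sum fun i _ => by split_ifs; exacts [le_rfl, hb0 i]
  have hBm : Monotone B := monotone_nat_of_le_succ fun n => by
    simp only [hB, Finset.sum_range_succ]
    split_ifs
    · linarith [hb0 n]
    · linarith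
  have hex : ∀ j ∈ S, ∃ k, B (j + 1) ≤ A (k + 1) := fun j hj => ⟨j, by
    have h1 := hS j hj
    have h2 := hBle (j + 1)
    have h3 : 0 ≤ ∑ i ∈ Finset.range (j + 1), b i := Finset.sum_nonneg fun i _ => hb0 i
    linarith⟩
  -- Greedy filling: κ j is the first place where the partial sums of a catch up with those of b
  -- restricted to S, so A (κ j) < B (j + 1) ≤ A (κ j + 1) when b j > 0.
  let κ : ℕ → ℕ := fun j => if h : ∃ k, B (j + 1) ≤ A (k + 1) then Nat.find h else 0
  have hκ1 : ∀ j ∈ S, B (j + 1) ≤ A (κ j + 1) := fun j hj => by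
    simp only [κ, dif_pos (hex j hj)]
    exact Nat.find_spec (hex j hj)
  have hκ2 : ∀ j ∈ S, 0 < b j → A (κ j) < B (j + 1) := fun j hj hbj => by
    rcases Nat.eq_zero_or_pos (κ j) with h0 | h0
    · rw [h0]
      have : B (j + 1) = B j + b j := by simp only [hB, Finset.sum_range_succ, if_pos hj]
      have hBj : 0 ≤ B j := by simpa [hB] using hBm (Nat.zero_le j)
      simp only [hA, Finset.range_zero, Finset.sum_empty]
      linarith
    · have hlt : κ j - 1 < Nat.find (hex j hj) := by
        have : κ j = Nat.find (hex j hj) := dif_pos (hex j hj)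
        omega
      have := Nat.find_min (hex j hj) hlt
      rw [not_le, Nat.sub_add_cancel h0] at this
      exact this
  have hκ3 : ∀ j ∈ S, 0 < b j → b j ≤ a (κ j) := fun j hj hbj => by
    -- Otherwise the terms of a from κ j on are below b j, so A (j + 1) ≤ A (κ j) + (j + 1) b j,
    -- which is less than twice the partial sum of b. This is what the factor 2 in `hS` is for.
    by_contra! hlt
    have h1 := hκ2 j hj hbj
    have h2 : A (j + 1) ≤ A (κ j) + (j + 1) * b j := by
      rcases le_or_gt (κ j) (j + 1) with hle | hgt
      · have : A (j + 1) = A (κ j) + ∑ i ∈ Finset.Ico (κ j) (j + 1), a i :=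
          (Finset.sum_range_add_sum_Ico _ hle).symm
        rw [this]
        have h3 : ∑ i ∈ Finset.Ico (κ j) (j + 1), a i
            ≤ ∑ _i ∈ Finset.Ico (κ j) (j + 1), b j := Finset.sum_le_sum fun i hi =>
          (ha (Finset.mem_Ico.1 hi).1).trans hlt.le
        rw [Finset.sum_const, Nat.card_Ico, nsmul_eq_mul] at h3
        have h4 : ((j + 1 - κ j : ℕ) : ℝ) * b j ≤ (j + 1) * b j := by
          refine mul_le_mul_of_nonneg_right ?_ (hb0 j)
          exact_mod_cast Nat.sub_le _ _
        linarith
      · have h3 : A (j + 1) ≤ A (κ j) := Finset.sum_le_sum_of_subset_of_nonneg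
          (Finset.range_subset_range.2 hgt.le) fun i _ _ => ha0 i
        have : 0 ≤ (j + 1) * b j := by positivity
        linarith
    have h3 : (j + 1) * b j ≤ ∑ i ∈ Finset.range (j + 1), b i := by
      have : ∑ _i ∈ Finset.range (j + 1), b j ≤ ∑ i ∈ Finset.range (j + 1), b i :=
        Finset.sum_le_sum fun i hi => hb (Nat.lt_succ_iff.1 (Finset.mem_range.1 hi))
      simpa using this
    have h4 := hS j hj
    have h5 := hBle (j + 1)
    change 2 * _ ≤ A (j + 1) at h4
    linarith
  refine ⟨κ, hκ3, fun k J hJ => ?_⟩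
  rcases J.eq_empty_or_nonempty with rfl | hne
  · simpa using mul_nonneg zero_le_two (ha0 k)
  set j₀ := J.min' hne with hj₀
  set j₁ := J.max' hne with hj₁
  obtain ⟨h0S, h0b, h0κ⟩ := hJ j₀ (J.min'_mem hne)
  obtain ⟨h1S, h1b, h1κ⟩ := hJ j₁ (J.max'_mem hne)
  -- The first term is at most a k by `hκ3`; the others add up to at most B (j₁ + 1) - B (j₀ + 1) ≤
  -- A (k + 1) - A k = a k.
  rw [← Finset.add_sum_erase J b (J.min'_mem hne)]
  have hle : j₀ ≤ j₁ := J.min'_le _ (J.max'_mem hne)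
  have hsub : ∑ j ∈ J.erase j₀, b j ≤ ∑ j ∈ Finset.Ico (j₀ + 1) (j₁ + 1),
      if j ∈ S then b j else 0 := by
    have : ∑ j ∈ J.erase j₀, b j = ∑ j ∈ J.erase j₀, if j ∈ S then b j else 0 :=
      Finset.sum_congr rfl fun j hj => by rw [if_pos (hJ j (Finset.mem_of_mem_erase hj)).1]
    rw [this]
    refine Finset.sum_le_sum_of_subset_of_nonneg (fun j hj => ?_) fun j _ _ => by
      split_ifs; exacts [hb0 j, le_rfl]
    have h1 := J.min'_le j (Finset.mem_of_mem_erase hj)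
    have h2 := J.le_max' j (Finset.mem_of_mem_erase hj)
    have h3 := Finset.ne_of_mem_erase hj
    rw [Finset.mem_Ico]
    omega
  have hB1 : B (j₁ + 1) = B (j₀ + 1) + ∑ j ∈ Finset.Ico (j₀ + 1) (j₁ + 1),
      if j ∈ S then b j else 0 :=
    (Finset.sum_range_add_sum_Ico (fun j => if j ∈ S then b j else 0) (by omega)).symm
  have h1 := hκ1 j₁ h1S
  have h2 := hκ2 j₀ h0S h0b
  have h3 := hκ3 j₀ h0S h0b
  rw [h1κ, hAs] at h1
  rw [h0κ] at h2 h3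
  change b j₀ + _ ≤ _
  linarith

/-- Part of `y` that is controlled by the partial sums of `p`-th powers. -/
theorem exists_matrix_of_partial_sums {x y : ℕ → ℝ≥0} (hx : Antitone x) (hy : Antitone y)
    {p : ℝ} (hp : 0 < p) {S : Set ℕ}
    (hS : ∀ j ∈ S, 2 * ∑ i ∈ Finset.range (j + 1), y i ^ p
      ≤ ∑ i ∈ Finset.range (j + 1), x i ^ p) :
    ∃ A : ℕ → ℕ → ℝ≥0∞, (∀ r : ℝ≥0∞, r ≠ 0 → p ≤ r.toReal ∨ r = ∞ → IsBdd r (quasiConst r) A) ∧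
      ∀ j ∈ S, (y j : ℝ≥0∞) ≤ app A (fun k => x k) j := by
  classical
  obtain ⟨κ, h1, h2⟩ := exists_assignment_of_sum_le (a := fun i => ((x i ^ p : ℝ≥0) : ℝ))
    (b := fun i => ((y i ^ p : ℝ≥0) : ℝ))
    (fun i j hij => by exact_mod_cast NNReal.rpow_le_rpow (hx hij) hp.le)
    (fun i j hij => by exact_mod_cast NNReal.rpow_le_rpow (hy hij) hp.le)
    (fun i => NNReal.coe_nonneg _) (fun i => NNReal.coe_nonneg _) (S := S)
    (fun j hj => by exact_mod_cast hS j hj)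
  have hpos : ∀ j, 0 < y j → (0 : ℝ) < ((y j ^ p : ℝ≥0) : ℝ) := fun j hj => by
    exact_mod_cast NNReal.rpow_pos hj
  have h1' : ∀ j ∈ S, 0 < y j → y j ≤ x (κ j) := fun j hj hyj => by
    have := h1 j hj (hpos j hyj)
    exact (NNReal.rpow_le_rpow_iff hp).1 (by exact_mod_cast this)
  set d : ℕ → ℝ≥0 := fun j => if j ∈ S ∧ 0 < y j then y j / x (κ j) else 0 with hd
  have hd1 : ∀ j, d j ≤ 1 := fun j => by
    simp only [hd]
    split_ifs with h
    · exact div_le_one_of_le₀ (h1' j h.1 h.2) zero_le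
    · exact zero_le
  refine ⟨weightedComp (fun j => d j) κ, ?_, fun j hj => ?_⟩
  · rintro r hr0 hr
    rcases exponent_cases r with rfl | rfl | hr'
    · exact absurd rfl hr0
    · refine isBdd_weightedComp_top fun j => ?_
      exact (by exact_mod_cast hd1 j : (d j : ℝ≥0∞) ≤ 1).trans (one_le_quasiConst _)
    have hpr : p ≤ r.toReal := hr.resolve_right (ENNReal.toReal_pos_iff.1 hr').2.ne
    refine isBdd_weightedComp_of_pos hr' fun k => ?_
    have hb : (∑' j, if κ j = k then (d j : ℝ≥0∞) ^ r.toReal else 0) ≤ 2 := by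
      rw [ENNReal.tsum_eq_iSup_sum]
      refine iSup_le fun J => ?_
      set J' := J.filter fun j => κ j = k ∧ j ∈ S ∧ 0 < y j with hJ'
      have hzero : ∀ j ∈ J, (if κ j = k then (d j : ℝ≥0∞) ^ r.toReal else 0) ≠ 0 →
          κ j = k ∧ j ∈ S ∧ 0 < y j := fun j _ h => by
        by_cases hk : κ j = k
        · refine ⟨hk, ?_⟩
          by_contra hn
          simp [hk, hd, hn, hr'] at h
        · simp [hk] at h
      have e1 : ∑ j ∈ J, (if κ j = k then (d j : ℝ≥0∞) ^ r.toReal else 0)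
          = ∑ j ∈ J', (d j : ℝ≥0∞) ^ r.toReal := by
        rw [← Finset.sum_filter_of_ne hzero]
        exact Finset.sum_congr rfl fun j hj => if_pos (Finset.mem_filter.1 hj).2.1
      rw [e1]
      -- On a fibre the assignment bounds the sum of p-th powers of the weights; since the weights
      -- are at most 1, a larger exponent r keeps the bound.
      have e2 : ∑ j ∈ J', (d j) ^ p ≤ 2 := by
        have hs := h2 k J' fun j hj => by
          obtain ⟨_, hk, hjS, hyj⟩ := Finset.mem_filter.1 hj
          exact ⟨hjS, hpos j hyj, hk⟩
        have hs' : ∑ j ∈ J', y j ^ p ≤ 2 * x k ^ p := by exact_mod_cast hs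
        have e3 : ∑ j ∈ J', (d j) ^ p = (∑ j ∈ J', y j ^ p) / x k ^ p := by
          rw [Finset.sum_div]
          refine Finset.sum_congr rfl fun j hj => ?_
          obtain ⟨_, hk, hjS, hyj⟩ := Finset.mem_filter.1 hj
          simp only [hd, if_pos (And.intro hjS hyj), hk, NNReal.div_rpow]
        rw [e3]
        exact div_le_of_le_mul₀ zero_le zero_le hs'
      have e4 : ∑ j ∈ J', (d j) ^ r.toReal ≤ 2 := le_trans (Finset.sum_le_sum fun j _ =>
        NNReal.coe_le_coe.1 (by
          push_cast
          exact Real.rpow_le_rpow_of_exponent_ge' (d j).2 (by exact_mod_cast hd1 j) hp.le hpr)) e2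
      calc ∑ j ∈ J', (d j : ℝ≥0∞) ^ r.toReal = ((∑ j ∈ J', (d j) ^ r.toReal : ℝ≥0) : ℝ≥0∞) := by
            push_cast
            exact Finset.sum_congr rfl fun j _ => ENNReal.coe_rpow_of_nonneg _ hr'.le |>.symm
        _ ≤ 2 := by exact_mod_cast e4
    rw [quasiConst_rpow hr']
    refine hb.trans (le_mul_of_one_le_left' ?_)
    exact ENNReal.one_le_rpow (by norm_num) hr'
  · rw [app_weightedComp]
    rcases eq_or_ne (y j) 0 with h0 | h0
    · rw [h0]; exact zero_le
    · have hy0 : 0 < y j := pos_iff_ne_zero.2 h0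
      have hx0 : x (κ j) ≠ 0 := (hy0.trans_le (h1' j hj hy0)).ne'
      simp only [hd, if_pos (And.intro hj hy0)]
      rw [← ENNReal.coe_mul, div_mul_cancel₀ _ hx0]

/-! ### Domination of tails: monotone coupling -/

/-- The monotone coupling of two mass distributions `b` and `a` on `ℕ`, started at infinity. If the
tails of `b` are dominated by those of `a`, then the mass at `j` is taken from indices `k ≥ ρ j`. -/
theorem exists_tail_coupling {a b : ℕ → ℝ} (ha : Antitone a) (ha0 : ∀ i, 0 ≤ a i)
    (hb0 : ∀ i, 0 ≤ b i) (has : Summable a) (hbs : Summable b) {ρ : ℕ → ℕ} {L : ℕ}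
    (htail : ∀ j, 0 < b j → ∑' i, b (i + j) ≤ ∑' i, a (i + ρ j))
    (hL : ∀ j, 0 < b j → a (ρ j) ≤ L * b j) :
    ∃ m : ℕ → ℕ → ℝ, (∀ j k, 0 ≤ m j k) ∧ (∀ j, HasSum (m j) (b j)) ∧
      (∀ k (J : Finset ℕ), ∑ j ∈ J, m j k ≤ a k) ∧
      (∀ j k, m j k ≠ 0 → ρ j ≤ k ∧ 0 < a k ∧ 0 < b j) ∧
      ∀ k (J : Finset ℕ), (∀ j ∈ J, m j k ≠ 0) → J.card ≤ L + 2 := by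
  set X : ℕ → ℝ := fun n => ∑' i, a (i + n) with hX
  set Y : ℕ → ℝ := fun n => ∑' i, b (i + n) with hY
  have hstep : ∀ {c : ℕ → ℝ}, Summable c → ∀ n, ∑' i, c (i + n) = c n + ∑' i, c (i + (n + 1)) :=
    fun {c} hc n => by
      rw [((summable_nat_add_iff n).2 hc).tsum_eq_zero_add, zero_add]
      simp only [add_assoc, add_comm 1 n]
  have hXs : ∀ n, X n = a n + X (n + 1) := hstep has
  have hYs : ∀ n, Y n = b n + Y (n + 1) := hstep hbs
  have hXm : Antitone X := antitone_nat_of_succ_le fun n => by linarith [hXs n, ha0 n]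
  have hYm : Antitone Y := antitone_nat_of_succ_le fun n => by linarith [hYs n, hb0 n]
  have hY0 : ∀ n, 0 ≤ Y n := fun n => tsum_nonneg fun i => hb0 _
  have hX0 : ∀ n, 0 ≤ X n := fun n => tsum_nonneg fun i => ha0 _
  have hXlim : Filter.Tendsto X Filter.atTop (nhds 0) := tendsto_sum_nat_add a
  -- g k u is the length of the part of [X (k+1), X k] below u. Hence `m j k` below is the length of
  -- the overlap of [Y (j+1), Y j] with [X (k+1), X k].
  set g : ℕ → ℝ → ℝ := fun k u => min u (X k) - min u (X (k + 1)) with hg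
  have hgm : ∀ k u v, u ≤ v → g k u ≤ g k v := fun k u v huv => by
    have := hXm (Nat.le_succ k)
    simp only [hg, min_def]
    split_ifs <;> linarith
  have hg0 : ∀ k u, 0 ≤ g k u := fun k u => sub_nonneg.2 (min_le_min_left _ (hXm (Nat.le_succ k)))
  have hga : ∀ k u, g k u ≤ a k := fun k u => by
    have h1 := hXs k
    have h2 := ha0 k
    simp only [hg, min_def]
    split_ifs <;> linarith
  have hgsum : ∀ u, 0 ≤ u → HasSum (fun k => g k u) (min u (X 0)) := fun u hu => by
    rw [hasSum_iff_tendsto_nat_of_nonneg fun k => hg0 k u]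
    have h1 : ∀ n, ∑ k ∈ Finset.range n, g k u = min u (X 0) - min u (X n) := fun n =>
      Finset.sum_range_sub' (fun k => min u (X k)) n
    simp_rw [h1]
    have h2 : Filter.Tendsto (fun n => min u (X n)) Filter.atTop (nhds (min u 0)) :=
      tendsto_const_nhds.min hXlim
    rw [min_eq_right hu] at h2
    simpa using h2.const_sub (min u (X 0))
  set m : ℕ → ℕ → ℝ := fun j k => g k (Y j) - g k (Y (j + 1)) with hm
  have hm0 : ∀ j k, 0 ≤ m j k := fun j k => sub_nonneg.2 (hgm k _ _ (hYm (Nat.le_succ j)))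
  have hmb : ∀ j k, m j k ≠ 0 → 0 < b j := fun j k h => by
    by_contra hb
    have : b j = 0 := le_antisymm (not_lt.1 hb) (hb0 j)
    have h2 := hYs j
    rw [this, zero_add] at h2
    exact h (by simp [hm, h2])
  have hint : ∀ j k, m j k ≠ 0 → X (k + 1) < Y j ∧ Y (j + 1) < X k := fun j k h => by
    have h1 := hXm (Nat.le_succ k)
    have h2 := hYm (Nat.le_succ j)
    constructor
    · by_contra! hle
      apply h
      simp only [hm, hg]
      rw [min_eq_left (hle.trans h1), min_eq_left hle, min_eq_left (h2.trans (hle.trans h1)),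
        min_eq_left (h2.trans hle)]
      ring
    · by_contra! hle
      apply h
      simp only [hm, hg]
      rw [min_eq_right (hle.trans h2), min_eq_right hle, min_eq_right (h1.trans (hle.trans h2)),
        min_eq_right (h1.trans hle)]
      ring
  have hma : ∀ k (J : Finset ℕ), ∑ j ∈ J, m j k ≤ a k := fun k J => by
    obtain ⟨n, hn⟩ := J.exists_nat_subset_range
    calc ∑ j ∈ J, m j k ≤ ∑ j ∈ Finset.range n, m j k :=
          Finset.sum_le_sum_of_subset_of_nonneg hn fun j _ _ => hm0 j k
      _ = g k (Y 0) - g k (Y n) := Finset.sum_range_sub' (fun j => g k (Y j)) n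
      _ ≤ a k := by linarith [hga k (Y 0), hg0 k (Y n)]
  have hmpos : ∀ j k, m j k ≠ 0 → ρ j ≤ k ∧ 0 < a k ∧ 0 < b j := fun j k h => by
    have hb := hmb j k h
    refine ⟨?_, ?_, hb⟩
    · have h1 := (hint j k h).1.trans_le (htail j hb)
      by_contra! hlt
      exact absurd (hXm (Nat.succ_le_of_lt hlt)) (not_le.2 h1)
    · have h1 := hma k {j}
      rw [Finset.sum_singleton] at h1
      exact ((hm0 j k).lt_of_ne h.symm).trans_le h1
  refine ⟨m, hm0, fun j => ?_, hma, hmpos, fun k J hJ => ?_⟩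
  · rcases (hb0 j).eq_or_lt with hb | hb
    · have : m j = fun _ => 0 := by
        funext k
        by_contra h
        exact (hmb j k h).ne hb
      rw [this, ← hb]
      exact hasSum_zero
    · have h1 : Y j ≤ X 0 := (htail j hb).trans (hXm (Nat.zero_le _))
      have h2 : Y (j + 1) ≤ X 0 := (hYm (Nat.le_succ j)).trans h1
      have h3 := (hgsum _ (hY0 j)).sub (hgsum _ (hY0 (j + 1)))
      rw [min_eq_left h1, min_eq_left h2, hYs j, add_sub_cancel_right] at h3
      rw [hm]
      simpa only [hYs j] using h3
  · rcases J.eq_empty_or_nonempty with rfl | hne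
    · simp
    set j₀ := J.min' hne with hj₀
    set j₁ := J.max' hne with hj₁
    have i0 := (hint j₀ k (hJ j₀ (J.min'_mem hne))).2
    have i1 := (hint j₁ k (hJ j₁ (J.max'_mem hne))).1
    -- All intervals strictly between the first and the last one that meet [X (k+1), X k] lie inside
    -- it. Each contributes its full length b j, where L · b j ≥ a k, so there are at most L of
    -- them; the two extremes account for the + 2.
    set J' := (J.erase j₀).erase j₁ with hJ'
    have hJm : ∀ j ∈ J', m j k = b j := fun j hj => by
      have hjJ : j ∈ J := Finset.mem_of_mem_erase (Finset.mem_of_mem_erase hj)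
      have h0 : j₀ < j := lt_of_le_of_ne (J.min'_le j hjJ)
        (Finset.ne_of_mem_erase (Finset.mem_of_mem_erase hj)).symm
      have h1 : j < j₁ := lt_of_le_of_ne (J.le_max' j hjJ) (Finset.ne_of_mem_erase hj)
      have e1 : Y j ≤ X k := (hYm (Nat.succ_le_of_lt h0)).trans i0.le
      have e2 : X (k + 1) ≤ Y (j + 1) := i1.le.trans (hYm (Nat.succ_le_of_lt h1))
      have e3 := hYm (Nat.le_succ j)
      simp only [hm, hg]
      rw [min_eq_left e1, min_eq_left (e3.trans e1), min_eq_right (e2.trans e3), min_eq_right e2,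
        hYs j]
      ring
    have hcard : J.card ≤ J'.card + 2 := by
      have h1 := Finset.pred_card_le_card_erase (s := J) (a := j₀)
      have h2 := Finset.pred_card_le_card_erase (s := J.erase j₀) (a := j₁)
      rw [← hJ'] at h2
      omega
    have hak := (hmpos j₀ k (hJ j₀ (J.min'_mem hne))).2.1
    have hsum : (J'.card : ℝ) * a k ≤ L * a k := by
      calc (J'.card : ℝ) * a k = ∑ _j ∈ J', a k := by simp
        _ ≤ ∑ j ∈ J', L * m j k := Finset.sum_le_sum fun j hj => by
            have hjJ : j ∈ J := Finset.mem_of_mem_erase (Finset.mem_of_mem_erase hj)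
            obtain ⟨h1, _, h3⟩ := hmpos j k (hJ j hjJ)
            rw [hJm j hj]
            exact (ha h1).trans (hL j h3)
        _ = L * ∑ j ∈ J', m j k := by rw [Finset.mul_sum]
        _ ≤ L * a k := by gcongr; exact hma k J'
    have := le_of_mul_le_mul_right hsum hak
    have h3 : J'.card ≤ L := by exact_mod_cast this
    omega

/-- Jensen's inequality for weights of total mass at most 1: the weighted Hölder inequality leaves a
factor (∑ w)^(1-1/r) ≤ 1. -/
theorem rpow_tsum_mul_le_of_tsum_le_one {ι : Type*} (w f : ι → ℝ≥0∞) (hw : ∑' k, w k ≤ 1) {r : ℝ}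
    (hr : 1 ≤ r) : (∑' k, w k * f k) ^ r ≤ ∑' k, w k * f k ^ r := by
  have hr0 : 0 < r := by linarith
  have h : ∑' k, w k * f k ≤ (∑' k, w k * f k ^ r) ^ r⁻¹ := by
    rw [ENNReal.tsum_eq_iSup_sum]
    refine iSup_le fun s => ?_
    refine (ENNReal.inner_le_weight_mul_Lp_of_nonneg s hr w f).trans ?_
    have h1 : (∑ i ∈ s, w i) ^ (1 - r⁻¹) ≤ 1 :=
      ENNReal.rpow_le_one ((ENNReal.sum_le_tsum s).trans hw)
        (sub_nonneg.2 (inv_le_one_of_one_le₀ hr))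
    refine (mul_le_mul_left h1 _).trans ?_
    rw [one_mul]
    exact ENNReal.rpow_le_rpow (ENNReal.sum_le_tsum s) (by positivity)
  calc (∑' k, w k * f k) ^ r ≤ ((∑' k, w k * f k ^ r) ^ r⁻¹) ^ r := ENNReal.rpow_le_rpow h hr0.le
    _ = _ := by rw [← ENNReal.rpow_mul, inv_mul_cancel₀ hr0.ne', ENNReal.rpow_one]

theorem rpow_tsum_le_tsum_rpow {ι : Type*} (f : ι → ℝ≥0∞) {r : ℝ} (hr : 0 < r) (hr1 : r ≤ 1) :
    (∑' k, f k) ^ r ≤ ∑' k, f k ^ r := by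
  have h := tsum_rpow_le_rpow_tsum (fun k => f k ^ r) ((one_le_inv₀ hr).2 hr1)
  simp_rw [← ENNReal.rpow_mul, mul_inv_cancel₀ hr.ne', ENNReal.rpow_one] at h
  calc (∑' k, f k) ^ r ≤ ((∑' k, f k ^ r) ^ r⁻¹) ^ r := ENNReal.rpow_le_rpow h hr.le
    _ = _ := by rw [← ENNReal.rpow_mul, inv_mul_cancel₀ hr.ne', ENNReal.rpow_one]

/-- A double sum over the support of a matrix whose columns have at most `N` nonzero entries. -/
theorem tsum_tsum_support_le {m : ℕ → ℕ → ℝ≥0} {N : ℕ}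
    (hm : ∀ k (J : Finset ℕ), (∀ j ∈ J, m j k ≠ 0) → J.card ≤ N) (f : ℕ → ℝ≥0∞) :
    ∑' j, ∑' k, (if m j k = 0 then 0 else f k) ≤ N * ∑' k, f k := by
  rw [ENNReal.tsum_comm, ← ENNReal.tsum_mul_left]
  refine ENNReal.tsum_le_tsum fun k => ?_
  rw [ENNReal.tsum_eq_iSup_sum]
  refine iSup_le fun J => ?_
  have h1 : ∑ j ∈ J, (if m j k = 0 then 0 else f k) = (J.filter fun j => m j k ≠ 0).card * f k := by
    simp_rw [← ite_not (m _ k = 0)]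
    rw [← Finset.sum_filter, Finset.sum_const, nsmul_eq_mul]
  rw [h1]
  gcongr
  exact_mod_cast hm k _ fun j hj => (Finset.mem_filter.1 hj).2

/-- Part of `y` that is controlled by the tails of the sums of `q`-th powers. -/
theorem exists_matrix_of_tail_sums {x y : ℕ → ℝ≥0} (hx : Antitone x) {q : ℝ≥0∞}
    (hq : 1 ≤ q.toReal) (hxs : Summable fun i => x i ^ q.toReal)
    (hys : Summable fun i => y i ^ q.toReal) {ρ : ℕ → ℕ} {L : ℕ} {D : Set ℕ}
    (hD : ∀ j ∈ D, ∑' i, y (i + j) ^ q.toReal ≤ ∑' i, x (i + ρ j) ^ q.toReal)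
    (hL : ∀ j ∈ D, x (ρ j) ^ q.toReal ≤ L * y j ^ q.toReal) :
    ∃ A : ℕ → ℕ → ℝ≥0∞, IsBdd q 1 A ∧ IsBdd 0 (L + 2) A ∧
      ((∀ j ∈ D, x (ρ j) ≤ y j) → ∀ r : ℝ≥0∞, 0 < r.toReal → r.toReal ≤ q.toReal →
        IsBdd r ((L + 2) ^ (1 / r.toReal)) A) ∧
      ∀ j ∈ D, (y j : ℝ≥0∞) ≤ app A (fun k => x k) j := by
  classical
  set e := q.toReal with he
  have he0 : 0 < e := by linarith
  set b : ℕ → ℝ≥0 := fun j => if j ∈ D then y j ^ e else 0 with hb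
  have hbD : ∀ j, 0 < b j → j ∈ D ∧ y j ≠ 0 := fun j hj => by
    by_cases h : j ∈ D
    · refine ⟨h, fun h0 => ?_⟩
      simp [hb, h, h0, he0.ne'] at hj
    · simp [hb, h] at hj
  have hby : ∀ j, b j ≤ y j ^ e := fun j => by
    simp only [hb]
    split_ifs
    exacts [le_rfl, zero_le]
  -- Mass is placed only on D, the set where tails are compared; tails of b are no larger than those
  -- of y^e.
  have hbs : Summable b := NNReal.summable_of_le hby hys
  have hxm : Antitone fun i => x i ^ e := fun i j hij => NNReal.rpow_le_rpow (hx hij) he0.le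
  obtain ⟨m', h0, hrow, hcol, hpos, hcard⟩ := exists_tail_coupling
    (a := fun i => ((x i ^ e : ℝ≥0) : ℝ)) (b := fun i => (b i : ℝ)) (ρ := ρ) (L := L)
    (fun i j hij => by exact_mod_cast hxm hij) (fun i => NNReal.coe_nonneg _)
    (fun i => NNReal.coe_nonneg _) (by exact_mod_cast hxs) (by exact_mod_cast hbs)
    (fun j hj => by
      have h1 := hD j (hbD j (by exact_mod_cast hj)).1
      have h2 : ∑' i, b (i + j) ≤ ∑' i, y (i + j) ^ e :=
        ((NNReal.summable_nat_add_iff j).2 hbs).tsum_le_tsum (fun i => hby _)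
          ((NNReal.summable_nat_add_iff j).2 hys)
      exact_mod_cast h2.trans h1)
    (fun j hj => by
      have h1 := (hbD j (by exact_mod_cast hj)).1
      have h2 := hL j h1
      simp only [hb, if_pos h1]
      exact_mod_cast h2)
  lift m' to ℕ → ℕ → ℝ≥0 using h0 with m
  have hrow' : ∀ j, ∑' k, (m j k : ℝ≥0∞) = b j := fun j => by
    have := NNReal.hasSum_coe.1 (hrow j)
    rw [← this.tsum_eq, ENNReal.coe_tsum this.summable]
  have hcol' : ∀ k, ∑' j, (m j k : ℝ≥0∞) ≤ (x k ^ e : ℝ≥0) := fun k => by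
    rw [ENNReal.tsum_eq_iSup_sum]
    exact iSup_le fun J => by exact_mod_cast hcol k J
  have hm1 : ∀ j k, m j k ≤ x k ^ e := fun j k => by
    have := hcol k {j}
    rw [Finset.sum_singleton] at this
    exact_mod_cast this
  have hpos' : ∀ j k, m j k ≠ 0 → ρ j ≤ k ∧ x k ≠ 0 ∧ y j ≠ 0 ∧ j ∈ D := fun j k h => by
    obtain ⟨h1, h2, h3⟩ := hpos j k (by exact_mod_cast h)
    obtain ⟨h4, h5⟩ := hbD j (by exact_mod_cast h3)
    refine ⟨h1, fun h6 => ?_, h5, h4⟩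
    simp [h6, he0.ne'] at h2
  have hcard' : ∀ k (J : Finset ℕ), (∀ j ∈ J, m j k ≠ 0) → J.card ≤ L + 2 := fun k J hJ =>
    hcard k J fun j hj => by exact_mod_cast hJ j hj
  -- Each row of w has mass at most 1, exactly 1 for j in D with y j ≠ 0. The factor v j k = y j / x
  -- k makes A x average the constant y j over k.
  set w : ℕ → ℕ → ℝ≥0 := fun j k => m j k / y j ^ e with hw
  set v : ℕ → ℕ → ℝ≥0 := fun j k => y j / x k with hv
  have hw1 : ∀ j, ∑' k, (w j k : ℝ≥0∞) ≤ 1 := fun j => by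
    rcases eq_or_ne (y j) 0 with hy | hy
    · simp [hw, hy, he0.ne']
    · have h1 : y j ^ e ≠ 0 := by simp [hy]
      simp only [hw, div_eq_mul_inv, ENNReal.coe_mul, ENNReal.coe_inv h1]
      rw [ENNReal.tsum_mul_right, hrow', ← div_eq_mul_inv]
      refine ENNReal.div_le_of_le_mul ?_
      rw [one_mul]
      exact_mod_cast hby j
  set A : ℕ → ℕ → ℝ≥0∞ := fun j k => w j k * v j k with hA
  have happ : ∀ u j, app A u j = ∑' k, w j k * (v j k * u k) := fun u j => by
    simp only [app, hA, mul_assoc]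
  have hjensen : ∀ u j {r : ℝ}, 1 ≤ r →
      app A u j ^ r ≤ ∑' k, ((w j k * v j k ^ r : ℝ≥0) : ℝ≥0∞) * u k ^ r := fun u j r hr => by
    rw [happ]
    refine (rpow_tsum_mul_le_of_tsum_le_one _ _ (hw1 j) hr).trans (le_of_eq ?_)
    refine tsum_congr fun k => ?_
    rw [ENNReal.mul_rpow_of_nonneg _ _ (by linarith), ENNReal.coe_mul,
      ENNReal.coe_rpow_of_nonneg _ (by linarith), mul_assoc]
  -- For r = e the last factor disappears and the column sums of m normalize the coefficients. For r
  -- ≤ e the coefficient is at most 1 as soon as x k ≤ y j.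
  have hcoef : ∀ j k, m j k ≠ 0 → ∀ r : ℝ,
      w j k * v j k ^ r = m j k / x k ^ e * (x k / y j) ^ (e - r) := fun j k h r => by
    obtain ⟨_, hxk, hyj, _⟩ := hpos' j k h
    simp only [hw, hv]
    rw [NNReal.div_rpow, NNReal.div_rpow, NNReal.rpow_sub hxk, NNReal.rpow_sub hyj]
    have h1 : x k ^ e ≠ 0 := by simp [hxk]
    have h2 : y j ^ e ≠ 0 := by simp [hyj]
    have h3 : x k ^ r ≠ 0 := by simp [hxk]
    have h4 : y j ^ r ≠ 0 := by simp [hyj]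
    field_simp
  have hzero : ∀ j k, m j k = 0 → w j k = 0 := fun j k h => by simp [hw, h]
  refine ⟨A, fun u => ?_, fun u => ?_, fun hxy r hr hrq u => ?_, fun j hj => ?_⟩
  · rw [one_mul, seqNorm_le_iff he0, seqNorm_rpow he0]
    calc ∑' j, app A u j ^ e
        ≤ ∑' j, ∑' k, (m j k : ℝ≥0∞) * ((x k ^ e : ℝ≥0) : ℝ≥0∞)⁻¹ * u k ^ e := by
          refine ENNReal.tsum_le_tsum fun j => (hjensen u j hq).trans ?_
          refine ENNReal.tsum_le_tsum fun k => ?_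
          by_cases h : m j k = 0
          · simp [hzero j k h]
          · have hxk : x k ^ e ≠ 0 := by simp [(hpos' j k h).2.1]
            rw [hcoef j k h e, sub_self, NNReal.rpow_zero, mul_one, ENNReal.coe_div hxk,
              div_eq_mul_inv]
      _ = ∑' k, (∑' j, (m j k : ℝ≥0∞)) * (((x k ^ e : ℝ≥0) : ℝ≥0∞)⁻¹ * u k ^ e) := by
          rw [ENNReal.tsum_comm]
          simp only [mul_assoc, ENNReal.tsum_mul_right]
      _ ≤ ∑' k, ((x k ^ e : ℝ≥0) : ℝ≥0∞) * (((x k ^ e : ℝ≥0) : ℝ≥0∞)⁻¹ * u k ^ e) := by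
          gcongr with k
          exact hcol' k
      _ ≤ ∑' k, u k ^ e := by
          refine ENNReal.tsum_le_tsum fun k => ?_
          rw [← mul_assoc]
          exact mul_le_of_le_one_left' (ENNReal.mul_inv_le_one _)
  · rw [seqNorm_exp_zero, seqNorm_exp_zero]
    refine le_trans (ENNReal.tsum_le_tsum fun j => ?_)
      ((tsum_tsum_support_le hcard' fun k => if u k = 0 then 0 else 1).trans
        (le_of_eq (by push_cast; rfl)))
    by_cases h : app A u j = 0
    · simp [h]
    · rw [if_neg h]
      have : ∃ k, A j k * u k ≠ 0 := by
        by_contra! hall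
        exact h (ENNReal.tsum_eq_zero.2 hall)
      obtain ⟨k, hk⟩ := this
      have hu : u k ≠ 0 := right_ne_zero_of_mul hk
      have hm : m j k ≠ 0 := fun h0 => hk (by simp [hA, hzero j k h0])
      refine le_trans ?_ (ENNReal.le_tsum k)
      simp [hu, hm]
  · rw [seqNorm_le_iff hr, ENNReal.mul_rpow_of_nonneg _ _ hr.le, seqNorm_rpow hr,
      ← ENNReal.rpow_mul, one_div_mul_cancel hr.ne', ENNReal.rpow_one]
    refine le_trans (ENNReal.tsum_le_tsum fun j => ?_)
      ((tsum_tsum_support_le hcard' fun k => u k ^ r.toReal).trans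
        (le_of_eq (by push_cast; rfl)))
    have hle : ∀ {s : ℝ}, s ≤ e → ∀ k, m j k ≠ 0 → w j k * v j k ^ s ≤ 1 := fun {s} hs k h => by
      rw [hcoef j k h]
      obtain ⟨h1, h2, h3, h4⟩ := hpos' j k h
      refine mul_le_one' (div_le_one_of_le₀ (hm1 j k) zero_le) ?_
      refine NNReal.rpow_le_one (div_le_one_of_le₀ ?_ zero_le) (by linarith)
      exact (hx h1).trans (hxy j h4)
    -- Jensen for r ≥ 1, subadditivity of the power for r ≤ 1. The latter bounds the entries of A
    -- themselves, by the coefficient estimate at exponent 1 ≤ e.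
    rcases le_total 1 r.toReal with hr1 | hr1
    · refine (hjensen u j hr1).trans (ENNReal.tsum_le_tsum fun k => ?_)
      by_cases h : m j k = 0
      · simp [h, hzero j k h]
      · rw [if_neg h]
        exact mul_le_of_le_one_left' (by exact_mod_cast hle hrq k h)
    · refine (rpow_tsum_le_tsum_rpow _ hr hr1).trans (ENNReal.tsum_le_tsum fun k => ?_)
      by_cases h : m j k = 0
      · simp [h, hA, hzero j k h, hr]
      · rw [if_neg h]
        refine ENNReal.rpow_le_rpow (mul_le_of_le_one_left' ?_) hr.le
        have := hle hq k h
        rw [NNReal.rpow_one] at this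
        simp only [hA]
        exact_mod_cast this
  · rcases eq_or_ne (y j) 0 with hy | hy
    · rw [hy]; exact zero_le
    have hyd : y j ^ e ≠ 0 := by simp [hy]
    have h1 : ∀ k, A j k * x k = (m j k : ℝ≥0∞) * ((y j / y j ^ e : ℝ≥0) : ℝ≥0∞) := fun k => by
      by_cases h : m j k = 0
      · simp [hA, h, hzero j k h]
      · have hxk := (hpos' j k h).2.1
        simp only [hA, hw, hv]
        rw [← ENNReal.coe_mul, ← ENNReal.coe_mul, ← ENNReal.coe_mul]
        congr 1
        field_simp
    rw [app]
    simp_rw [h1]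
    rw [ENNReal.tsum_mul_right, hrow', ← ENNReal.coe_mul]
    simp only [hb, if_pos hj]
    rw [mul_div_cancel₀ _ hyd]

/-! ### Heads and tails against the K-functional, p > 0 -/

theorem seqNorm_truncate_rpow {p : ℝ≥0∞} (hp : 0 < p.toReal) (u : ℕ → ℝ≥0∞) (n : ℕ) :
    seqNorm p (fun i => if i < n then u i else 0) ^ p.toReal
      = ∑ i ∈ Finset.range n, u i ^ p.toReal := by
  rw [seqNorm_rpow hp, tsum_eq_sum (s := Finset.range n)]
  · exact Finset.sum_congr rfl fun i hi => by rw [if_pos (Finset.mem_range.1 hi)]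
  · intro i hi
    rw [if_neg fun h => hi (Finset.mem_range.2 h), ENNReal.zero_rpow_of_pos hp]

/-- Hölder's inequality on n points. For q = ∞ the convention that `toReal` sends ∞ to 0 and 1 / 0 =
0 makes the exponent 1/p, as it should be. -/
theorem seqNorm_truncate_le {p q : ℝ≥0∞} (hp : 0 < p.toReal) (hpq : p < q) (u : ℕ → ℝ≥0∞)
    (n : ℕ) :
    seqNorm p (fun i => if i < n then u i else 0)
      ≤ (n : ℝ≥0∞) ^ (1 / p.toReal - 1 / q.toReal) * seqNorm q u := by
  have hq0 : q ≠ 0 := (bot_le.trans_lt hpq).ne'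
  rcases exponent_cases q with rfl | rfl | hq
  · exact absurd rfl hq0
  · rw [← ENNReal.rpow_le_rpow_iff hp, seqNorm_truncate_rpow hp,
      ENNReal.mul_rpow_of_nonneg _ _ hp.le, ← ENNReal.rpow_mul]
    simp only [ENNReal.toReal_top, div_zero, sub_zero, one_div_mul_cancel hp.ne', ENNReal.rpow_one]
    calc ∑ i ∈ Finset.range n, u i ^ p.toReal
        ≤ ∑ _i ∈ Finset.range n, seqNorm ∞ u ^ p.toReal := Finset.sum_le_sum fun i _ =>
          ENNReal.rpow_le_rpow (le_seqNorm hq0 u i) hp.le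
      _ = n * seqNorm ∞ u ^ p.toReal := by simp
  · have hqt := (ENNReal.toReal_pos_iff.1 hq).2.ne
    have hlt : p.toReal < q.toReal := ENNReal.toReal_strict_mono hqt hpq
    have h1 := ENNReal.inner_le_weight_mul_Lp_of_nonneg (Finset.range n)
      ((one_le_div hp).2 hlt.le) (fun _ => 1) (fun i => u i ^ p.toReal)
    simp only [one_mul, ← ENNReal.rpow_mul, mul_div_cancel₀ _ hp.ne', inv_div, Finset.sum_const,
      Finset.card_range, nsmul_eq_mul, mul_one] at h1
    rw [← ENNReal.rpow_le_rpow_iff hp, seqNorm_truncate_rpow hp,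
      ENNReal.mul_rpow_of_nonneg _ _ hp.le, ← ENNReal.rpow_mul]
    refine h1.trans ?_
    have e1 : (1 / p.toReal - 1 / q.toReal) * p.toReal = 1 - p.toReal / q.toReal := by
      field_simp
    rw [e1, seqNorm_of_pos hq, ← ENNReal.rpow_mul, one_div_mul_eq_div]
    gcongr
    exact ENNReal.sum_le_tsum _

theorem natCast_rpow_mul_le_seqNorm_truncate {p : ℝ≥0∞} (hp : 0 < p.toReal) {s : ℕ → ℝ≥0∞}
    (hs : Antitone s) (j : ℕ) :
    ((j + 1 : ℕ) : ℝ≥0∞) ^ (1 / p.toReal) * s j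
      ≤ seqNorm p (fun i => if i < j + 1 then s i else 0) := by
  rw [← ENNReal.rpow_le_rpow_iff hp, seqNorm_truncate_rpow hp,
      ENNReal.mul_rpow_of_nonneg _ _ hp.le, ← ENNReal.rpow_mul, one_div_mul_cancel hp.ne',
      ENNReal.rpow_one]
  have h : ∑ _i ∈ Finset.range (j + 1), s j ^ p.toReal
      ≤ ∑ i ∈ Finset.range (j + 1), s i ^ p.toReal := Finset.sum_le_sum fun i hi =>
    ENNReal.rpow_le_rpow (hs (Nat.lt_succ_iff.1 (Finset.mem_range.1 hi))) hp.le
  simpa using h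

theorem le_mul_K {p q : ℝ≥0∞} {t : ℝ≥0} {x : ℕ → ℝ} {a c : ℝ≥0∞} (hc0 : c ≠ 0) (hc : c ≠ ∞)
    (h : ∀ x₀ x₁ : ℕ → ℝ, x = x₀ + x₁ →
      a ≤ c * (seqNorm p (fun k => ‖x₀ k‖ₑ) + t * seqNorm q (fun k => ‖x₁ k‖ₑ))) :
    a ≤ c * K p q t x := by
  rw [← ENNReal.div_le_iff' hc0 hc]
  refine le_iInf₂ fun x₀ _ => le_iInf₂ fun x₁ _ => le_iInf fun hx => ?_
  rw [ENNReal.div_le_iff' hc0 hc, ellNorm_eq, ellNorm_eq]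
  exact h x₀ x₁ hx

namespace IsRearr

variable {y : ℕ → ℝ} {s : ℕ → ℝ≥0∞} {σ : ℕ → ℕ}

theorem seqNorm_comp_le (h : IsRearr (fun k => ‖y k‖ₑ) s σ) (r : ℝ≥0∞) (u : ℕ → ℝ≥0∞) :
    seqNorm r (fun i => u (σ i)) ≤ seqNorm r u := by
  have hb : IsBdd r 1 (weightedComp (fun _ => 1) σ) :=
    isBdd_weightedComp_of_injOn r h.inj.injOn (fun _ => le_rfl) le_rfl
  have := hb u
  rw [funext (app_weightedComp _ _ u)] at this
  simpa using this

/-- Along `σ` the head is at most 2(|y₀| + |y₁|); Hölder on n points converts the ℓ^q part into ℓ^p.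
-/
theorem head_le (h : IsRearr (fun k => ‖y k‖ₑ) s σ) {p q : ℝ≥0∞} (hp : 0 < p.toReal)
    (hpq : p < q) (n : ℕ) {y₀ y₁ : ℕ → ℝ} (hy : y = y₀ + y₁) :
    seqNorm p (fun i => if i < n then s i else 0) ≤ quasiConst p * 2 *
      (seqNorm p (fun k => ‖y₀ k‖ₑ)
        + (n : ℝ≥0∞) ^ (1 / p.toReal - 1 / q.toReal) * seqNorm q (fun k => ‖y₁ k‖ₑ)) := by
  have hp0 : p ≠ 0 := (ENNReal.toReal_pos_iff.1 hp).1.ne'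
  have h1 : ∀ i, (if i < n then s i else 0) ≤
      2 * ‖y₀ (σ i)‖ₑ + 2 * (if i < n then ‖y₁ (σ i)‖ₑ else 0) := fun i => by
    by_cases hi : i < n
    · rw [if_pos hi, if_pos hi, ← mul_add]
      refine (h.le_two_mul i).trans (mul_le_mul_right ?_ _)
      rw [hy]
      exact enorm_add_le _ _
    · rw [if_neg hi]; exact zero_le
  refine (seqNorm_mono p h1).trans ((seqNorm_add_le p _ _).trans ?_)
  rw [seqNorm_const_mul hp0, seqNorm_const_mul hp0, ← mul_add, ← mul_assoc]
  gcongr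
  · exact h.seqNorm_comp_le p fun k => ‖y₀ k‖ₑ
  · refine (seqNorm_truncate_le hp hpq _ n).trans ?_
    gcongr
    exact h.seqNorm_comp_le q fun k => ‖y₁ k‖ₑ

/-- Where |y₁| dominates, s is controlled by y₁. Where |y₀| dominates, s^q = s^(q-p) s^p is at most
s_j^(q-p) times a multiple of |y₀|^p, and s_j is controlled by the head because (j+1)^(1/p) s_j is
at most the norm of the first j+1 terms. -/
theorem tail_le (h : IsRearr (fun k => ‖y k‖ₑ) s σ) {p q : ℝ≥0∞} (hp : 0 < p.toReal)
    (hpq : p < q) (hqt : q ≠ ∞) (j : ℕ) {y₀ y₁ : ℕ → ℝ} (hy : y = y₀ + y₁) :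
    ((j + 1 : ℕ) : ℝ≥0∞) ^ (1 / p.toReal - 1 / q.toReal) * seqNorm q (fun i => s (i + j))
      ≤ quasiConst q * 4 * (quasiConst p * 2) *
      (seqNorm p (fun k => ‖y₀ k‖ₑ) + ((j + 1 : ℕ) : ℝ≥0∞) ^ (1 / p.toReal - 1 / q.toReal) *
        seqNorm q (fun k => ‖y₁ k‖ₑ)) := by
  have hlt : p.toReal < q.toReal := ENNReal.toReal_strict_mono hqt hpq
  have hq : 0 < q.toReal := hp.trans hlt
  set a := p.toReal with ha
  set b := q.toReal with hb
  set t := ((j + 1 : ℕ) : ℝ≥0∞) ^ (1 / a - 1 / b) with ht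
  set c := quasiConst p * 2 with hc
  set R := seqNorm p (fun k => ‖y₀ k‖ₑ) + t * seqNorm q (fun k => ‖y₁ k‖ₑ) with hR
  have hhead := (natCast_rpow_mul_le_seqNorm_truncate hp h.anti j).trans
    (h.head_le hp hpq (j + 1) hy)
  have hc1 : 1 ≤ c := one_le_mul (one_le_quasiConst p) (by norm_num)
  have hpt : ∀ i, s (i + j) ^ b ≤
      4 ^ b * ‖y₁ (σ (i + j))‖ₑ ^ b + s j ^ (b - a) * (4 ^ a * ‖y₀ (σ (i + j))‖ₑ ^ a) := fun i => by
    have h1 : s (i + j) ≤ 2 * (‖y₀ (σ (i + j))‖ₑ + ‖y₁ (σ (i + j))‖ₑ) := by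
      refine (h.le_two_mul _).trans (mul_le_mul_right ?_ _)
      rw [hy]
      exact enorm_add_le _ _
    have h4 : (4 : ℝ≥0∞) = 2 * 2 := by norm_num
    rcases le_total (‖y₀ (σ (i + j))‖ₑ) (‖y₁ (σ (i + j))‖ₑ) with hle | hle
    · refine le_trans ?_ le_self_add
      rw [← ENNReal.mul_rpow_of_nonneg _ _ hq.le]
      refine ENNReal.rpow_le_rpow (h1.trans ?_) hq.le
      rw [h4, mul_assoc, two_mul (‖y₁ (σ (i + j))‖ₑ)]
      gcongr
    · refine le_trans ?_ le_add_self
      have e : s (i + j) ^ b = s (i + j) ^ (b - a) * s (i + j) ^ a := by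
        rw [← ENNReal.rpow_add_of_nonneg _ _ (by linarith) hp.le, sub_add_cancel]
      rw [e, ← ENNReal.mul_rpow_of_nonneg _ _ hp.le]
      refine mul_le_mul' (ENNReal.rpow_le_rpow (h.anti (by omega)) (by linarith))
        (ENNReal.rpow_le_rpow (h1.trans ?_) hp.le)
      rw [h4, mul_assoc, two_mul (‖y₀ (σ (i + j))‖ₑ)]
      gcongr
  have hshift : ∀ (r : ℝ≥0∞) (z : ℕ → ℝ), 0 < r.toReal →
      ∑' i, ‖z (σ (i + j))‖ₑ ^ r.toReal ≤ seqNorm r (fun k => ‖z k‖ₑ) ^ r.toReal := fun r z hr => by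
    rw [seqNorm_rpow hr]
    have hinj : Function.Injective fun i => σ (i + j) := fun _ _ hab => by simpa using h.inj hab
    exact ENNReal.tsum_comp_le_tsum_of_injective hinj fun k => ‖z k‖ₑ ^ r.toReal
  -- The exponents match since (1/a - 1/b) b = (b - a)/a; this is what singles out t.
  have htb : t ^ b * s j ^ (b - a) = (((j + 1 : ℕ) : ℝ≥0∞) ^ (1 / a) * s j) ^ (b - a) := by
    rw [ENNReal.mul_rpow_of_nonneg _ _ (by linarith), ht, ← ENNReal.rpow_mul, ← ENNReal.rpow_mul]
    congr 2
    field_simp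
  rw [← ENNReal.rpow_le_rpow_iff hq, ENNReal.mul_rpow_of_nonneg _ _ hq.le, seqNorm_rpow hq]
  calc t ^ b * ∑' i, s (i + j) ^ b
      ≤ t ^ b * ∑' i, (4 ^ b * ‖y₁ (σ (i + j))‖ₑ ^ b
          + s j ^ (b - a) * (4 ^ a * ‖y₀ (σ (i + j))‖ₑ ^ a)) := by
        gcongr with i
        exact hpt i
    _ = t ^ b * (4 ^ b * ∑' i, ‖y₁ (σ (i + j))‖ₑ ^ b)
          + t ^ b * s j ^ (b - a) * (4 ^ a * ∑' i, ‖y₀ (σ (i + j))‖ₑ ^ a) := by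
        rw [ENNReal.tsum_add, ENNReal.tsum_mul_left, ENNReal.tsum_mul_left, ENNReal.tsum_mul_left]
        ring
    _ ≤ t ^ b * (4 ^ b * seqNorm q (fun k => ‖y₁ k‖ₑ) ^ b)
          + (c * R) ^ (b - a) * (4 ^ a * seqNorm p (fun k => ‖y₀ k‖ₑ) ^ a) := by
        rw [htb]
        gcongr
        · exact hshift q y₁ hq
        · exact hshift p y₀ hp
    _ ≤ 4 ^ b * R ^ b + (c * R) ^ (b - a) * (4 ^ a * R ^ a) := by
        refine add_le_add ?_ (by gcongr; exact le_self_add)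
        rw [mul_left_comm, ← ENNReal.mul_rpow_of_nonneg _ _ hq.le]
        gcongr
        exact le_add_self
    _ ≤ (4 * c * R) ^ b + (4 * c * R) ^ b := by
        refine add_le_add ?_ ?_
        · rw [← ENNReal.mul_rpow_of_nonneg _ _ hq.le]
          gcongr
          exact le_mul_of_one_le_right' hc1
        · rw [← ENNReal.mul_rpow_of_nonneg _ _ hp.le]
          have e : (4 * c * R) ^ b = (4 * c * R) ^ (b - a) * (4 * c * R) ^ a := by
            rw [← ENNReal.rpow_add_of_nonneg _ _ (by linarith) hp.le, sub_add_cancel]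
          rw [e]
          gcongr
          · exact le_mul_of_one_le_left' (by norm_num)
          · exact le_mul_of_one_le_right' hc1
    _ ≤ (quasiConst q * 4 * c * R) ^ b := by
        rw [← two_mul, mul_assoc (quasiConst q), mul_assoc (quasiConst q),
          ENNReal.mul_rpow_of_nonneg (quasiConst q) _ hq.le, quasiConst_rpow hq]
        gcongr
        exact le_mul_of_one_le_left' (ENNReal.one_le_rpow (by norm_num) hq)

end IsRearr

theorem seqNorm_coe_rpow {q : ℝ≥0∞} (hq : 0 < q.toReal) {x : ℕ → ℝ≥0}
    (hx : Summable fun i => x i ^ q.toReal) :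
    seqNorm q (fun i => x i) ^ q.toReal = ((∑' i, x i ^ q.toReal : ℝ≥0) : ℝ≥0∞) := by
  rw [seqNorm_rpow hq, ENNReal.coe_tsum hx]
  exact tsum_congr fun i => (ENNReal.coe_rpow_of_nonneg _ hq.le).symm

theorem summable_rpow_of_seqNorm_ne_top {q : ℝ≥0∞} (hq : 0 < q.toReal) {x : ℕ → ℝ≥0}
    (hx : seqNorm q (fun i => x i) ≠ ∞) : Summable fun i => x i ^ q.toReal := by
  rw [← ENNReal.tsum_coe_ne_top_iff_summable]
  have h : ∑' i, ((x i ^ q.toReal : ℝ≥0) : ℝ≥0∞) = seqNorm q (fun i => x i) ^ q.toReal := by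
    rw [seqNorm_rpow hq]
    exact tsum_congr fun i => ENNReal.coe_rpow_of_nonneg _ hq.le
  rw [h]
  exact ENNReal.rpow_ne_top_of_nonneg hq.le hx

theorem tsum_shift_le_of_seqNorm_le {q : ℝ≥0∞} (hq : 0 < q.toReal) {x y : ℕ → ℝ≥0}
    (hx : Summable fun i => x i ^ q.toReal) (hy : Summable fun i => y i ^ q.toReal) {m n : ℕ}
    (h : seqNorm q (fun i => y (i + m)) ≤ seqNorm q (fun i => x (i + n))) :
    ∑' i, y (i + m) ^ q.toReal ≤ ∑' i, x (i + n) ^ q.toReal := by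
  have h1 := ENNReal.rpow_le_rpow h hq.le
  rw [seqNorm_coe_rpow hq (x := fun i => y (i + m))
      ((NNReal.summable_nat_add_iff (f := fun i => y i ^ q.toReal) m).2 hy),
    seqNorm_coe_rpow hq (x := fun i => x (i + n))
      ((NNReal.summable_nat_add_iff (f := fun i => x i ^ q.toReal) n).2 hx)] at h1
  exact_mod_cast h1

/-! ### Sufficiency for p > 0 -/

theorem isBdd_identity (r : ℝ≥0∞) : IsBdd r 1 (weightedComp (fun _ => 1) id) :=
  isBdd_weightedComp_of_injOn r Function.injective_id.injOn (fun _ => le_rfl) le_rfl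

/-- Indices with dominated heads are served by the greedy assignment; the factor 2^(1/p) becomes its
factor 2 on p-th powers. The remaining indices use the tail coupling with ρ = id and L = 1 if x_j ≤
y_j, and the identity otherwise. -/
theorem majorizes_of_head_or_tail {p q : ℝ≥0∞} (hp : 0 < p.toReal) (hpq : p < q) (hq : 1 ≤ q) :
    ∃ C : ℝ≥0∞, C ≠ ∞ ∧ ∀ x y : ℕ → ℝ≥0, Antitone x → Antitone y →
      seqNorm q (fun i => x i) ≠ ∞ → seqNorm q (fun i => y i) ≠ ∞ →
      (∀ j, 2 ^ (1 / p.toReal) * seqNorm p (fun i => if i < j + 1 then (y i : ℝ≥0∞) else 0)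
          ≤ seqNorm p (fun i => if i < j + 1 then (x i : ℝ≥0∞) else 0) ∨
        q ≠ ∞ ∧ seqNorm q (fun i => y (i + j)) ≤ seqNorm q (fun i => x (i + j))) →
      Majorizes p q C (fun i => x i) (fun i => y i) := by
  classical
  have hp0 : p ≠ 0 := (ENNReal.toReal_pos_iff.1 hp).1.ne'
  have hq0 : q ≠ 0 := (bot_le.trans_lt hpq).ne'
  set c₁ := quasiConst p * quasiConst q with hc₁
  set c₂ : ℝ≥0∞ := ((1 : ℕ) + 2) ^ (1 / p.toReal) with hc₂
  have hc₁t : c₁ ≠ ∞ := ENNReal.mul_ne_top (quasiConst_ne_top p) (quasiConst_ne_top q)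
  have hc₂t : c₂ ≠ ∞ := ENNReal.rpow_ne_top_of_nonneg (by positivity) (by simp)
  have hc₂1 : 1 ≤ c₂ := ENNReal.one_le_rpow (by norm_num) (by positivity)
  refine ⟨c₁ * (c₁ + c₁ * (c₂ + 1)), by finiteness, fun x y hx hy hxq hyq h => ?_⟩
  set S : Set ℕ := {j | 2 ^ (1 / p.toReal) *
    seqNorm p (fun i => if i < j + 1 then (y i : ℝ≥0∞) else 0)
      ≤ seqNorm p (fun i => if i < j + 1 then (x i : ℝ≥0∞) else 0)} with hS
  have hSsum : ∀ j ∈ S, 2 * ∑ i ∈ Finset.range (j + 1), y i ^ p.toReal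
      ≤ ∑ i ∈ Finset.range (j + 1), x i ^ p.toReal := fun j hj => by
    have h1 := ENNReal.rpow_le_rpow hj hp.le
    rw [ENNReal.mul_rpow_of_nonneg _ _ hp.le, ← ENNReal.rpow_mul, one_div_mul_cancel hp.ne',
      ENNReal.rpow_one, seqNorm_truncate_rpow hp, seqNorm_truncate_rpow hp] at h1
    simp_rw [← ENNReal.coe_rpow_of_nonneg _ hp.le] at h1
    exact_mod_cast h1
  obtain ⟨A, hA, hAy⟩ := exists_matrix_of_partial_sums hx hy hp hSsum
  have m1 : Majorizes p q c₁ (fun i => x i) (fun j => if j ∈ S then (y j : ℝ≥0∞) else 0) := by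
    refine ⟨A, (hA p hp0 (Or.inl le_rfl)).mono (le_mul_of_one_le_right' (one_le_quasiConst q)),
      (hA q hq0 ?_).mono (le_mul_of_one_le_left' (one_le_quasiConst p)), fun j => ?_⟩
    · rcases eq_or_ne q ∞ with hqt | hqt
      · exact Or.inr hqt
      · exact Or.inl (ENNReal.toReal_mono hqt hpq.le)
    · dsimp only
      split_ifs with hj
      · exact hAy j hj
      · exact zero_le
  have m2 : Majorizes p q (c₁ * (c₂ + 1)) (fun i => x i)
      (fun j => if j ∈ S then 0 else (y j : ℝ≥0∞)) := by
    have mid : Majorizes p q 1 (fun i => (x i : ℝ≥0∞)) (fun i => x i) :=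
      ⟨_, isBdd_identity p, isBdd_identity q, fun j => by rw [app_weightedComp, one_mul]; rfl⟩
    rcases eq_or_ne q ∞ with hqt | hqt
    · obtain ⟨B, h1, h2, h3⟩ := mid
      refine Majorizes.mono (C := 1) ⟨B, h1, h2, fun j => ?_⟩ ?_
      · have hj : j ∈ S := (h j).resolve_right fun h => h.1 hqt
        dsimp only
        rw [if_pos hj]
        exact zero_le
      · exact one_le_mul (one_le_mul (one_le_quasiConst p) (one_le_quasiConst q)) le_add_self
    have hq1 : 1 ≤ q.toReal := by simpa using ENNReal.toReal_mono hqt hq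
    have hqp : 0 < q.toReal := by linarith
    have hxs := summable_rpow_of_seqNorm_ne_top hqp hxq
    have hys := summable_rpow_of_seqNorm_ne_top hqp hyq
    obtain ⟨B, h1, -, h3, h4⟩ := exists_matrix_of_tail_sums hx (q := q) hq1 hxs hys (ρ := id)
      (L := 1) (D := {j | j ∉ S ∧ x j ≤ y j})
      (fun j hj => tsum_shift_le_of_seqNorm_le hqp hxs hys ((h j).resolve_left hj.1).2)
      (fun j hj => by
        rw [Nat.cast_one, one_mul]
        exact NNReal.rpow_le_rpow hj.2 hqp.le)
    have m3 : Majorizes p q c₂ (fun i => x i)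
        (fun j => if j ∉ S ∧ x j ≤ y j then (y j : ℝ≥0∞) else 0) := by
      refine ⟨B, h3 (fun j hj => hj.2) p hp (ENNReal.toReal_mono hqt hpq.le),
        h1.mono hc₂1, fun j => ?_⟩
      dsimp only
      split_ifs with hj
      · exact h4 j hj
      · exact zero_le
    refine m3.add mid fun j => ?_
    by_cases hj : j ∈ S
    · simp [hj]
    · rw [if_neg hj]
      by_cases hxy : x j ≤ y j
      · rw [if_pos ⟨hj, hxy⟩]; exact le_self_add
      · exact le_trans (by exact_mod_cast (not_le.1 hxy).le) le_add_self
  refine m1.add m2 fun j => ?_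
  split_ifs <;> simp

/-- The inequality between the `K`-functionals that is encoded by `kOrbNorm`. -/
theorem K_le_kOrbNorm_mul {p q : ℝ≥0∞} {x y : ℕ → ℝ} (hM : kOrbNorm p q x y < ∞) {t : ℝ≥0}
    (ht : 0 < t) (hx : K p q t x ≠ ∞) : K p q t y ≤ kOrbNorm p q x y * K p q t x := by
  rw [← ENNReal.div_le_iff_le_mul (Or.inr hM.ne) (Or.inl hx)]
  exact le_iSup₂ (f := fun (t : ℝ≥0) (_ : 0 < t) => K p q t y / K p q t x) t ht

theorem K_ne_top {p q : ℝ≥0∞} {x : ℕ → ℝ} (hx : x ∈ ell q) (t : ℝ≥0) : K p q t x ≠ ∞ := by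
  have h : K p q t x ≤ ellNorm p 0 + t * ellNorm q x :=
    iInf₂_le_of_le 0 (zero_mem _) (iInf₂_le_of_le x hx (iInf_le _ (zero_add x).symm))
  refine ne_top_of_le_ne_top ?_ h
  rw [ellNorm_eq, ellNorm_eq]
  simp only [Pi.zero_apply, enorm_zero, seqNorm_zero, zero_add]
  exact ENNReal.mul_ne_top ENNReal.coe_ne_top (mem_ell_iff.1 hx)

theorem exists_isRearr_of_mem_ell {q : ℝ≥0∞} (hq : q ≠ 0) {x : ℕ → ℝ} (hx : x ∈ ell q) :
    ∃ (s : ℕ → ℝ≥0) (σ : ℕ → ℕ), IsRearr (fun k => ‖x k‖ₑ) (fun i => s i) σ ∧ Antitone s ∧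
      seqNorm q (fun i => s i) ≠ ∞ := by
  have hfin := mem_ell_iff.1 hx
  obtain ⟨s, σ, h⟩ := exists_isRearr (x := fun k => ‖x k‖ₑ)
    (ne_top_of_le_ne_top hfin (iSup_le fun k => le_seqNorm hq (fun k => ‖x k‖ₑ) k))
  have hs : seqNorm q s ≠ ∞ := ne_top_of_le_ne_top (ENNReal.mul_ne_top (by simp) hfin)
    (h.seqNorm_le q)
  have hst : ∀ i, s i ≠ ∞ := fun i => ne_top_of_le_ne_top hs (le_seqNorm hq s i)
  lift s to ℕ → ℝ≥0 using hst
  exact ⟨s, σ, h, fun i j hij => by exact_mod_cast h.anti hij, hs⟩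

/-- Majorization is transitive, so the passages from x to s, from s to u and from u to y compose;
only the middle one depends on the K-functionals. -/
theorem isUniformCalderonMityagin_of_majorizes {p q : ℝ≥0∞} (hpq : p < q) {C : ℝ≥0∞} (hC : C ≠ ∞)
    (h : ∀ (x y : ℕ → ℝ) (s u : ℕ → ℝ≥0) (σ τ : ℕ → ℕ), x ∈ ell q → y ∈ ell q →
      kOrbNorm p q x y < ∞ → Antitone s → Antitone u →
      IsRearr (fun k => ‖x k‖ₑ) (fun i => s i) σ → IsRearr (fun k => ‖y k‖ₑ) (fun i => u i) τ →
      seqNorm q (fun i => s i) ≠ ∞ → seqNorm q (fun i => u i) ≠ ∞ →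
      Majorizes p q (C * (if p = 0 then max 1 (kOrbNorm p q x y) else kOrbNorm p q x y))
        (fun i => s i) (fun i => u i)) :
    IsUniformCalderonMityagin p q := by
  have hq0 : q ≠ 0 := (bot_le.trans_lt hpq).ne'
  set c := quasiConst p * quasiConst q * (1 + 1) with hc
  have hct : c ≠ ∞ := ENNReal.mul_ne_top
    (ENNReal.mul_ne_top (quasiConst_ne_top p) (quasiConst_ne_top q)) (by simp)
  have hDt : c * (C * 2) ≠ ∞ := ENNReal.mul_ne_top hct (ENNReal.mul_ne_top hC (by simp))
  refine ⟨(c * (C * 2)).toNNReal, fun x y _ hM => ?_⟩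
  have hx := (mem_sumSpace_iff hpq).1 x.2
  have hy := (mem_sumSpace_iff hpq).1 y.2
  obtain ⟨s, σ, hs, hsa, hsq⟩ := exists_isRearr_of_mem_ell hq0 hx
  obtain ⟨u, τ, hu, hua, huq⟩ := exists_isRearr_of_mem_ell hq0 hy
  rw [ENNReal.coe_toNNReal hDt]
  set M := (if p = 0 then max 1 (kOrbNorm p q x y) else kOrbNorm p q x y) with hMdef
  have hMt : M ≠ ∞ := by
    rw [hMdef]
    split_ifs
    · exact (max_lt (by simp) hM).ne
    · exact hM.ne
  refine Majorizes.exists_linearMap hpq (ENNReal.mul_ne_top hDt hMt) ?_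
  refine (((hs.majorizes p q).trans (h x y s u σ τ hx hy hM hsa hua hs hu hsq huq)).trans
    (hu.majorizes_symm p q)).mono (le_of_eq ?_)
  ring

theorem isUniformCalderonMityagin_of_pos {p q : ℝ≥0∞} (hp0 : p ≠ 0) (hpq : p < q) (hq : 1 ≤ q) :
    IsUniformCalderonMityagin p q := by
  have hp : 0 < p.toReal := ENNReal.toReal_pos hp0 (hpq.trans_le le_top).ne
  have hq0 : q ≠ 0 := (bot_le.trans_lt hpq).ne'
  obtain ⟨C, hC, hmaj⟩ := majorizes_of_head_or_tail hp hpq hq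
  set c₁ := quasiConst p * 2 with hc₁
  set c₂ := quasiConst q * 4 * c₁ with hc₂
  set c₃ := quasiConst q * 2 with hc₃
  have hc₁1 : 1 ≤ c₁ := one_le_mul (one_le_quasiConst p) (by norm_num)
  have hc₁₂ : c₁ ≤ c₂ := le_mul_of_one_le_left'
    (one_le_mul (one_le_quasiConst q) (by norm_num))
  have hc₃1 : 1 ≤ c₃ := one_le_mul (one_le_quasiConst q) (by norm_num)
  have hqp := quasiConst_ne_top p
  have hqq := quasiConst_ne_top q
  have hc₁t : c₁ ≠ ∞ := by finiteness
  have hc₂t : c₂ ≠ ∞ := by finiteness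
  have hc₃t : c₃ ≠ ∞ := by finiteness
  -- The constants c₂, c₃ and 2 come from the comparison of K with heads and tails, and 2^(1/p) is
  -- the gap required for the greedy assignment.
  set D : ℝ≥0∞ := 2 ^ (1 / p.toReal) * (c₂ * c₃ * 2) with hD
  have h2p : (1 : ℝ≥0∞) ≤ 2 ^ (1 / p.toReal) := ENNReal.one_le_rpow (by norm_num) (by positivity)
  have h2pt : (2 : ℝ≥0∞) ^ (1 / p.toReal) ≠ ∞ :=
    ENNReal.rpow_ne_top_of_nonneg (by positivity) (by simp)
  have hDt : D ≠ ∞ := by finiteness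
  have hD0 : D ≠ 0 := by
    have : 1 ≤ D := one_le_mul h2p (one_le_mul (one_le_mul (hc₁1.trans hc₁₂) hc₃1) (by norm_num))
    exact (zero_lt_one.trans_le this).ne'
  refine isUniformCalderonMityagin_of_majorizes hpq (C := D * C) (ENNReal.mul_ne_top hDt hC) ?_
  intro x y s u σ τ hx hy hM hsa hua hs hu hsq huq
  rw [if_neg hp0]
  set M := kOrbNorm p q x y with hMdef
  set e := 1 / p.toReal - 1 / q.toReal with he
  have he0 : 0 ≤ e := by
    rcases eq_or_ne q ∞ with rfl | hqt
    · simp [he]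
    · exact sub_nonneg.2 (one_div_le_one_div_of_le hp (ENNReal.toReal_mono hqt hpq.le))
  set H : ℕ → ℝ≥0∞ := fun j => seqNorm p (fun i => if i < j + 1 then (s i : ℝ≥0∞) else 0) with hH
  set G : ℕ → ℝ≥0∞ := fun j => seqNorm p (fun i => if i < j + 1 then (u i : ℝ≥0∞) else 0) with hG
  set t : ℕ → ℝ≥0∞ := fun j => ((j + 1 : ℕ) : ℝ≥0∞) ^ e with ht
  have ht0 : ∀ j, t j ≠ 0 := fun j => by simp [ht]
  have htt : ∀ j, t j ≠ ∞ := fun j => ENNReal.rpow_ne_top_of_nonneg he0 (by simp)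
  have hcoe : ∀ j, (((t j).toNNReal : ℝ≥0) : ℝ≥0∞) = t j := fun j => ENNReal.coe_toNNReal (htt j)
  have hpos : ∀ j, 0 < (t j).toNNReal := fun j => ENNReal.toNNReal_pos (ht0 j) (htt j)
  have hK : ∀ j, K p q (t j).toNNReal y
      ≤ M * (c₃ * (H j + t j * seqNorm q (fun i => s (i + j)))) := fun j => by
    refine (K_le_kOrbNorm_mul hM (hpos j) (K_ne_top hx _)).trans (mul_le_mul_right ?_ _)
    refine (hs.K_le hx (t j).toNNReal (j + 1)).trans ?_
    rw [hcoe, mul_add]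
    refine add_le_add (le_mul_of_one_le_left' hc₃1) ?_
    rw [← mul_assoc (quasiConst q), mul_left_comm]
    -- The decomposition cuts at j + 1, whereas the tail kept in the comparison starts at j; by
    -- monotonicity the latter is larger.
    refine mul_le_mul_right (mul_le_mul_right (seqNorm_mono q fun i => ?_) _) _
    exact_mod_cast hsa (by omega : i + j ≤ i + (j + 1))
  have hGK : ∀ j, G j ≤ c₁ * K p q (t j).toNNReal y := fun j =>
    le_mul_K (zero_lt_one.trans_le hc₁1).ne' hc₁t fun y₀ y₁ h01 => by
      rw [hcoe]
      exact hu.head_le hp hpq (j + 1) h01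
  have hQK : q ≠ ∞ → ∀ j, t j * seqNorm q (fun i => u (i + j)) ≤ c₂ * K p q (t j).toNNReal y :=
    fun hqt j => le_mul_K (zero_lt_one.trans_le (hc₁1.trans hc₁₂)).ne' hc₂t fun y₀ y₁ h01 => by
      rw [hcoe]
      exact hu.tail_le hp hpq hqt j h01
  -- Scaling by Λ needs M ≠ 0; if M = 0 then u = 0 and the zero matrix serves.
  rcases eq_or_ne M 0 with hM0 | hM0
  · have hu0 : ∀ i, u i = 0 := fun i => by
      have h1 := (natCast_rpow_mul_le_seqNorm_truncate hp hu.anti i).trans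
        ((hGK i).trans (mul_le_mul_right (hK i) _))
      rw [hM0, zero_mul, mul_zero, nonpos_iff_eq_zero, mul_eq_zero] at h1
      have h2 := h1.resolve_left (by simp)
      exact_mod_cast h2
    have happ : ∀ v, app (fun _ _ => 0) v = fun _ => 0 := fun v => funext fun j => by simp [app]
    refine ⟨fun _ _ => 0, fun v => ?_, fun v => ?_, fun j => ?_⟩
    · rw [happ, seqNorm_zero]; exact zero_le
    · rw [happ, seqNorm_zero]; exact zero_le
    · simp [hu0]
  have hΛ0 : D * M ≠ 0 := mul_ne_zero hD0 hM0
  have hΛt : D * M ≠ ∞ := ENNReal.mul_ne_top hDt hM.ne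
  set Λ := (D * M).toNNReal with hΛ
  have hΛc : (Λ : ℝ≥0∞) = D * M := ENNReal.coe_toNNReal hΛt
  have hΛn : Λ ≠ 0 := fun h => hΛ0 (by rw [← hΛc, h]; rfl)
  have hw : ∀ i, ((u i / Λ : ℝ≥0) : ℝ≥0∞) = (D * M)⁻¹ * u i := fun i => by
    rw [ENNReal.coe_div hΛn, hΛc, div_eq_mul_inv, mul_comm]
  have key := hmaj s (fun i => u i / Λ) hsa
    (fun i j hij => div_le_div_of_nonneg_right (hua hij) zero_le) hsq (by
      simp only [hw]
      rw [seqNorm_const_mul hq0]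
      exact ENNReal.mul_ne_top (ENNReal.inv_ne_top.2 hΛ0) huq) fun j => by
    have htail : ∀ z : ℝ≥0∞, z ≤ D * M * seqNorm q (fun i => s (i + j)) →
        (D * M)⁻¹ * z ≤ seqNorm q (fun i => s (i + j)) := fun z hz => by
      rw [mul_comm, ← div_eq_mul_inv]
      exact ENNReal.div_le_of_le_mul' hz
    have hhead : ∀ z : ℝ≥0∞, z ≤ c₂ * c₃ * 2 * M * H j →
        2 ^ (1 / p.toReal) * ((D * M)⁻¹ * z) ≤ H j := fun z hz => by
      rw [mul_left_comm, mul_comm, ← div_eq_mul_inv]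
      refine ENNReal.div_le_of_le_mul' ?_
      rw [hD, mul_assoc, mul_assoc]
      gcongr
      rwa [← mul_assoc]
    -- Whichever of the two terms dominates for s decides which alternative holds for u / Λ.
    by_cases hle : t j * seqNorm q (fun i => s (i + j)) ≤ H j
    · left
      have e1 : (fun i => if i < j + 1 then ((u i / Λ : ℝ≥0) : ℝ≥0∞) else 0)
          = fun i => (D * M)⁻¹ * (if i < j + 1 then (u i : ℝ≥0∞) else 0) := funext fun i => by
        split_ifs
        · exact hw i
        · rw [mul_zero]
      rw [e1, seqNorm_const_mul hp0]
      refine hhead _ ?_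
      calc G j ≤ c₁ * (M * (c₃ * (H j + H j))) := (hGK j).trans (by
            gcongr
            exact (hK j).trans (by gcongr))
        _ = c₁ * c₃ * 2 * M * H j := by ring
        _ ≤ c₂ * c₃ * 2 * M * H j := by gcongr
    · right
      -- For q = ∞ the tail from j is at most s_j and t_j s_j is at most the head, so the head
      -- always dominates.
      have hqt : q ≠ ∞ := by
        rintro rfl
        have h1 : seqNorm ∞ (fun i => (s (i + j) : ℝ≥0∞)) ≤ s j := by
          rw [seqNorm_exp_top]
          exact iSup_le fun i => by exact_mod_cast hsa (by omega : j ≤ i + j)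
        have h2 := natCast_rpow_mul_le_seqNorm_truncate hp hs.anti j
        have h3 : t j = ((j + 1 : ℕ) : ℝ≥0∞) ^ (1 / p.toReal) := by simp [ht, he]
        rw [← h3] at h2
        exact hle ((mul_le_mul_right h1 _).trans h2)
      refine ⟨hqt, ?_⟩
      simp only [hw]
      rw [seqNorm_const_mul hq0]
      refine htail _ ?_
      have h1 : t j * seqNorm q (fun i => u (i + j))
          ≤ t j * (c₂ * c₃ * 2 * M * seqNorm q (fun i => s (i + j))) := by
        calc t j * seqNorm q (fun i => u (i + j))
            ≤ c₂ * (M * (c₃ * (t j * seqNorm q (fun i => s (i + j))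
              + t j * seqNorm q (fun i => s (i + j))))) := (hQK hqt j).trans (by
              gcongr
              refine (hK j).trans ?_
              gcongr
              exact (not_le.1 hle).le)
          _ = _ := by ring
      rw [ENNReal.mul_le_mul_iff_right (ht0 j) (htt j)] at h1
      refine h1.trans ?_
      gcongr
      exact le_mul_of_one_le_left' h2p
  have key2 := key.const_mul (c := D * M) (Or.inl hp0) hq0
  have e2 : (fun i => D * M * ((u i / Λ : ℝ≥0) : ℝ≥0∞)) = fun i => (u i : ℝ≥0∞) :=
    funext fun i => by rw [hw, ← mul_assoc, ENNReal.mul_inv_cancel hΛ0 hΛt, one_mul]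
  rw [e2] at key2
  refine key2.mono (le_of_eq ?_)
  ring

/-! ### Sufficiency for p = 0 -/

theorem IsBdd.const_mul_exp_zero {C : ℝ≥0∞} {A : ℕ → ℕ → ℝ≥0∞} (hA : IsBdd 0 C A) (c : ℝ≥0∞) :
    IsBdd 0 C (fun j k => c * A j k) := fun u => by
  rw [funext (app_const_mul c A u)]
  exact (seqNorm_exp_zero_const_mul c _).trans (hA u)

theorem tsum_ite_div_eq {L : ℕ} (hL : 0 < L) (k : ℕ) (c : ℝ≥0∞) :
    ∑' j, (if j / L = k then c else 0) = L * c := by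
  have h : ∀ j, j / L = k ↔ j ∈ Finset.Ico (k * L) ((k + 1) * L) := fun j => by
    rw [Nat.div_eq_iff hL, Finset.mem_Ico, add_mul, one_mul]
    omega
  rw [tsum_eq_sum (s := Finset.Ico (k * L) ((k + 1) * L)) fun j hj => if_neg fun h' =>
    hj ((h j).1 h'), Finset.sum_congr rfl fun j hj => if_pos ((h j).2 hj), Finset.sum_const,
    Nat.card_Ico, nsmul_eq_mul, add_mul, one_mul, Nat.add_sub_cancel_left]

theorem isBdd_zero_weightedComp_div {L : ℕ} (hL : 0 < L) (d : ℝ≥0∞) :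
    IsBdd 0 L (weightedComp (fun _ => d) (fun j => j / L)) := by
  refine isBdd_weightedComp_zero fun k => ?_
  rw [tsum_ite_div_eq hL]
  exact mul_le_of_le_one_right' (by split_ifs <;> simp)

namespace IsRearr

/-- Among the first i + m + 1 indices at least i + 1 avoid the support of y₀. If g i is the i-th
such index, then g i ≤ i + m, and y = y₁ at σ (g i). -/
theorem tail_le_of_support {y : ℕ → ℝ} {s : ℕ → ℝ≥0∞} {σ : ℕ → ℕ}
    (h : IsRearr (fun k => ‖y k‖ₑ) s σ) (q : ℝ≥0∞) {m : ℕ} {y₀ y₁ : ℕ → ℝ} (hy : y = y₀ + y₁)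
    (hm : seqNorm 0 (fun k => ‖y₀ k‖ₑ) ≤ m) :
    seqNorm q (fun i => s (i + m)) ≤ 2 * seqNorm q (fun k => ‖y₁ k‖ₑ) := by
  classical
  rw [seqNorm_exp_zero, tsum_enorm_support] at hm
  have hm' : ({i | y₀ i ≠ 0} : Set ℕ).encard ≤ m := by exact_mod_cast hm
  set P : ℕ → Prop := fun i => y₀ (σ i) = 0 with hP
  have hcard : ∀ J : Finset ℕ, (∀ i ∈ J, ¬ P i) → J.card ≤ m := fun J hJ => by
    have h1 : ((J.map ⟨σ, h.inj⟩ : Finset ℕ) : Set ℕ) ⊆ {i | y₀ i ≠ 0} := fun k hk => by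
      obtain ⟨i, hi, rfl⟩ := Finset.mem_map.1 (Finset.mem_coe.1 hk)
      exact hJ i hi
    have h2 := (Set.encard_le_encard h1).trans hm'
    rw [Set.encard_coe_eq_coe_finsetCard, Finset.card_map] at h2
    exact_mod_cast h2
  have hcount : ∀ i, i < Nat.count P (i + m + 1) := fun i => by
    have h1 : Nat.count P (i + m + 1) + ((Finset.range (i + m + 1)).filter fun i => ¬ P i).card
        = i + m + 1 := by
      rw [Nat.count_eq_card_filter_range, Finset.card_filter_add_card_filter_not,
        Finset.card_range]
    have h2 := hcard ((Finset.range (i + m + 1)).filter fun i => ¬ P i) fun i hi =>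
      (Finset.mem_filter.1 hi).2
    omega
  have hinf : {i | P i}.Infinite := by
    intro hfin
    have h1 := hcount hfin.toFinset.card
    rw [Nat.count_eq_card_filter_range] at h1
    refine absurd (Finset.card_le_card fun i hi => ?_) (not_le.2 h1)
    exact hfin.mem_toFinset.2 (Finset.mem_filter.1 hi).2
  set g : ℕ → ℕ := Nat.nth P with hg
  have hginj : Function.Injective g := Nat.nth_injective hinf
  have hb : IsBdd q 2 (weightedComp (fun _ => 2) fun i => σ (g i)) :=
    isBdd_weightedComp_of_injOn q (h.inj.comp hginj).injOn (fun _ => le_rfl) (by norm_num)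
  refine le_trans (seqNorm_mono q fun i => ?_) (hb fun k => ‖y₁ k‖ₑ)
  rw [app_weightedComp]
  have h1 : g i ≤ i + m := Nat.lt_succ_iff.1 (Nat.nth_lt_of_lt_count (hcount i))
  refine (h.anti h1).trans ((h.le_two_mul _).trans ?_)
  have h2 : y₀ (σ (g i)) = 0 := Nat.nth_mem_of_infinite hinf i
  simp [hy, h2]

/-- Comparison of the tails of the rearrangements for the couple `(ℓ^0, ℓ^q)`. -/
theorem tail_le_tail {x y : ℕ → ℝ} {s u : ℕ → ℝ≥0∞} {σ τ : ℕ → ℕ}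
    (hs : IsRearr (fun k => ‖x k‖ₑ) s σ) (hu : IsRearr (fun k => ‖y k‖ₑ) u τ) {q : ℝ≥0∞}
    (hx : x ∈ ell q) {M : ℝ≥0} (hM : 1 ≤ M)
    (hK : ∀ t : ℝ≥0, 0 < t → K 0 q t y ≤ M * K 0 q t x) {L : ℕ} (hL : 2 * M ≤ L)
    (hL' : (L : ℝ≥0) ≤ 3 * M) (n : ℕ) :
    seqNorm q (fun i => u (i + L * n))
      ≤ 6 * M * (quasiConst q * (2 * seqNorm q (fun i => s (i + n)))) := by
  set Q := quasiConst q * (2 * seqNorm q (fun i => s (i + n))) with hQ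
  have hM0 : M ≠ 0 := (zero_lt_one.trans_le hM).ne'
  have h6M : (6 * M : ℝ≥0∞) ≠ 0 := mul_ne_zero (by simp) (by exact_mod_cast hM0)
  have h6Mt : (6 * M : ℝ≥0∞) ≠ ∞ := ENNReal.mul_ne_top (by simp) ENNReal.coe_ne_top
  rw [← ENNReal.div_le_iff' h6M h6Mt]
  -- Q may vanish, so it is replaced by a larger Q' > 0, by which one can divide.
  refine le_of_forall_gt_imp_ge_of_dense fun Q' hQ' => ?_
  rw [ENNReal.div_le_iff' h6M h6Mt]
  rcases eq_or_ne Q' ∞ with rfl | hQt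
  · rw [ENNReal.mul_top h6M]; exact le_top
  lift Q' to ℝ≥0 using hQt
  have hQ'0 : 0 < Q' := ENNReal.coe_pos.1 (zero_le.trans_lt hQ')
  -- The term 1/(2M) keeps t positive for n = 0, and it is so small that M (n + a) = 2Mn + 1/2 stays
  -- below Ln + 1.
  set a : ℝ≥0 := n + 1 / (2 * M) with ha
  have ha0 : 0 < a := by positivity
  set t : ℝ≥0 := a / Q' with ht
  have ht0 : 0 < t := by positivity
  have htQ : (t : ℝ≥0∞) * Q' = a := by
    rw [← ENNReal.coe_mul, ht, div_mul_cancel₀ _ hQ'0.ne']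
  have hKx : K 0 q t x ≤ n + a := by
    refine (hs.K_le hx t n).trans (add_le_add ?_ ?_)
    · rw [seqNorm_exp_zero, tsum_eq_sum (s := Finset.range n)]
      · calc ∑ i ∈ Finset.range n, (if (if i < n then s i else 0) = 0 then (0 : ℝ≥0∞) else 1)
            ≤ ∑ _i ∈ Finset.range n, 1 := Finset.sum_le_sum fun i _ => by split_ifs <;> simp
          _ = n := by simp
      · intro i hi
        rw [if_neg fun h => hi (Finset.mem_range.2 h), if_pos rfl]
    · rw [← htQ]
      gcongr
  have hMa : M * (n + a) < L * n + 1 := by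
    have h1 : M * (n + a) = 2 * M * n + 1 / 2 := by
      rw [ha]
      field_simp
      ring
    rw [h1]
    have h2 : 2 * M * n ≤ L * n := by gcongr
    exact add_lt_add_of_le_of_lt h2 (by
      rw [div_lt_iff₀ (by norm_num)]
      norm_num)
  have hKy : K 0 q t y < ((L * n + 1 : ℝ≥0) : ℝ≥0∞) := by
    refine ((hK t ht0).trans (mul_le_mul_right hKx _)).trans_lt ?_
    exact_mod_cast hMa
  simp only [K, iInf_lt_iff] at hKy
  obtain ⟨y₀, hy₀, y₁, hy₁, hy, hlt⟩ := hKy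
  rw [ellNorm_eq, ellNorm_eq] at hlt
  -- A cardinality below Ln + 1 is at most Ln.
  have hcard : seqNorm 0 (fun k => ‖y₀ k‖ₑ) ≤ (L * n : ℕ) := by
    have h1 := le_self_add.trans_lt hlt
    rw [seqNorm_exp_zero, tsum_enorm_support] at h1 ⊢
    have h2 : ({i | y₀ i ≠ 0} : Set ℕ).encard < ((L * n + 1 : ℕ) : ℕ∞) := by
      have h3 : ((({i | y₀ i ≠ 0} : Set ℕ).encard : ℕ∞) : ℝ≥0∞)
          < (((L * n + 1 : ℕ) : ℕ∞) : ℝ≥0∞) := by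
        simpa using h1
      exact ENat.toENNReal_lt.1 h3
    have h4 : ({i | y₀ i ≠ 0} : Set ℕ).encard ≤ ((L * n : ℕ) : ℕ∞) := by
      rw [Nat.cast_add, Nat.cast_one] at h2
      exact Order.le_of_lt_add_one h2
    exact_mod_cast h4
  have h1 := hu.tail_le_of_support q hy hcard
  have h2 : (t : ℝ≥0∞) * seqNorm q (fun k => ‖y₁ k‖ₑ) ≤ ((3 * M * a : ℝ≥0) : ℝ≥0∞) := by
    refine (le_add_self.trans hlt.le).trans ?_
    have h3 : (L * n + 1 : ℝ≥0) ≤ 3 * M * a := by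
      have e : 3 * M * a = 3 * M * n + 3 / 2 := by
        rw [ha]
        field_simp
      rw [e]
      refine add_le_add (by gcongr) ?_
      rw [le_div_iff₀ (by norm_num)]
      norm_num
    exact_mod_cast h3
  have h3 : seqNorm q (fun k => ‖y₁ k‖ₑ) ≤ 3 * M * Q' := by
    rw [← ENNReal.mul_le_mul_iff_right (a := (t : ℝ≥0∞)) (by exact_mod_cast ht0.ne')
      ENNReal.coe_ne_top]
    refine h2.trans (le_of_eq ?_)
    rw [mul_left_comm, htQ]
    push_cast
    ring
  calc seqNorm q (fun i => u (i + L * n)) ≤ 2 * (3 * M * Q') := h1.trans (mul_le_mul_right h3 _)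
    _ = 6 * M * Q' := by ring

end IsRearr

/-- Sufficiency of the comparison of tails for the couple `(ℓ^0, ℓ^q)`. -/
theorem exists_matrix_zero {q : ℝ≥0∞} (hq : 1 ≤ q) {x y : ℕ → ℝ≥0} (hx : Antitone x)
    (hxq : seqNorm q (fun i => x i) ≠ ∞) (hyq : seqNorm q (fun i => y i) ≠ ∞) {L : ℕ} (hL : 0 < L)
    (h : ∀ j, seqNorm q (fun i => y (i + j)) ≤ seqNorm q (fun i => x (i + j / L))) :
    ∃ A, IsBdd 0 (quasiConst 0 * (2 * L + 2)) A ∧ IsBdd q (quasiConst q * 2) A ∧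
      ∀ j, (y j : ℝ≥0∞) ≤ app A (fun i => x i) j := by
  classical
  have hq0 : q ≠ 0 := (zero_lt_one.trans_le hq).ne'
  rcases eq_or_ne q ∞ with rfl | hqt
  · refine ⟨weightedComp (fun _ => 1) fun j => j / L,
      (isBdd_zero_weightedComp_div hL 1).mono ?_,
      (isBdd_weightedComp_top fun _ => le_rfl).mono
        (one_le_mul (one_le_quasiConst _) (by norm_num)), fun j => ?_⟩
    · refine le_trans ?_ (le_mul_of_one_le_left' (one_le_quasiConst 0))
      rw [two_mul, add_assoc]
      exact le_self_add
    · rw [app_weightedComp, one_mul]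
      have h1 := (le_seqNorm hq0 (fun i => (y (i + j) : ℝ≥0∞)) 0).trans (h j)
      rw [zero_add] at h1
      refine h1.trans ?_
      rw [seqNorm_exp_top]
      exact iSup_le fun i => by exact_mod_cast hx (by omega : j / L ≤ i + j / L)
  have hq1 : 1 ≤ q.toReal := by simpa using ENNReal.toReal_mono hqt hq
  have hqp : 0 < q.toReal := by linarith
  have hxs := summable_rpow_of_seqNorm_ne_top hqp hxq
  have hys := summable_rpow_of_seqNorm_ne_top hqp hyq
  -- Outside D one has y_j < L^(-1/q) x_(j/L). Repeating every entry L times with weight L^(-1/q) is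
  -- bounded by 1 on ℓ^q and by L on ℓ^0.
  set D : Set ℕ := {j | x (j / L) ^ q.toReal ≤ L * y j ^ q.toReal} with hD
  obtain ⟨A, h1, h2, -, h4⟩ := exists_matrix_of_tail_sums hx (q := q) hq1 hxs hys
    (ρ := fun j => j / L) (L := L) (D := D)
    (fun j _ => tsum_shift_le_of_seqNorm_le hqp hxs hys (h j)) (fun j hj => hj)
  set d : ℝ≥0∞ := (L : ℝ≥0∞)⁻¹ ^ (1 / q.toReal) with hd
  have hdq : d ^ q.toReal = (L : ℝ≥0∞)⁻¹ := by
    rw [hd, ← ENNReal.rpow_mul, one_div_mul_cancel hqp.ne', ENNReal.rpow_one]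
  have hLc : (L : ℝ≥0∞) ≠ 0 := by exact_mod_cast hL.ne'
  have hB : IsBdd q 1 (weightedComp (fun _ => d) fun j => j / L) := by
    refine isBdd_weightedComp_of_pos hqp fun k => ?_
    rw [tsum_ite_div_eq hL, hdq, ENNReal.mul_inv_cancel hLc (by simp), ENNReal.one_rpow]
  refine ⟨_, (h2.add (isBdd_zero_weightedComp_div hL d)).mono (le_of_eq (by ring)),
    (h1.add hB).mono (le_of_eq (by norm_num)), fun j => ?_⟩
  rw [app_add, app_weightedComp]
  by_cases hj : j ∈ D
  · exact (h4 j hj).trans le_self_add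
  · refine le_trans ?_ le_add_self
    rw [← ENNReal.rpow_le_rpow_iff hqp, ENNReal.mul_rpow_of_nonneg _ _ hqp.le, hdq, mul_comm,
      ← div_eq_mul_inv, ENNReal.le_div_iff_mul_le (Or.inl hLc) (Or.inl (by simp)), mul_comm,
      ← ENNReal.coe_rpow_of_nonneg _ hqp.le, ← ENNReal.coe_rpow_of_nonneg _ hqp.le]
    exact_mod_cast (not_le.1 hj).le

/-- The number M enters twice: on ℓ^0 through the block length L ≤ 3M, and on ℓ^q through the scale
Λ. Rescaling the matrix by Λ costs nothing on ℓ^0, so both bounds remain linear in M. -/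
theorem isUniformCalderonMityagin_zero {q : ℝ≥0∞} (hq : 1 ≤ q) :
    IsUniformCalderonMityagin 0 q := by
  have hq0 : q ≠ 0 := (zero_lt_one.trans_le hq).ne'
  have hqq := quasiConst_ne_top q
  have hq00 := quasiConst_ne_top 0
  set C : ℝ≥0∞ := quasiConst 0 * 8 + 6 * (quasiConst q * 2) * (quasiConst q * 2) with hC
  refine isUniformCalderonMityagin_of_majorizes (pos_iff_ne_zero.2 hq0) (C := C) (by finiteness) ?_
  intro x y s u σ τ hx hy hM hsa hua hs hu hsq huq
  rw [if_pos rfl]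
  have hMt : max 1 (kOrbNorm 0 q x y) ≠ ∞ := (max_lt (by simp) hM).ne
  obtain ⟨M, hMM⟩ : ∃ M : ℝ≥0, (M : ℝ≥0∞) = max 1 (kOrbNorm 0 q x y) :=
    ⟨_, ENNReal.coe_toNNReal hMt⟩
  rw [← hMM]
  have hM1 : 1 ≤ M := by exact_mod_cast (hMM ▸ le_max_left _ _ : (1 : ℝ≥0∞) ≤ M)
  have hK : ∀ t : ℝ≥0, 0 < t → K 0 q t y ≤ M * K 0 q t x := fun t ht => by
    refine (K_le_kOrbNorm_mul hM ht (K_ne_top hx _)).trans ?_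
    rw [hMM]
    gcongr
    exact le_max_right _ _
  set L : ℕ := ⌈2 * M⌉₊ with hL
  have hL1 : 2 * M ≤ L := Nat.le_ceil _
  have hL2 : (L : ℝ≥0) ≤ 3 * M := by
    have h1 : (L : ℝ≥0) < 2 * M + 1 := Nat.ceil_lt_add_one zero_le
    refine h1.le.trans ?_
    calc 2 * M + 1 ≤ 2 * M + M := by gcongr
      _ = 3 * M := by ring
  have hL0 : 0 < L := Nat.ceil_pos.2 (by positivity)
  have htail := hs.tail_le_tail hu hx hM1 hK hL1 hL2
  set Λ : ℝ≥0∞ := 6 * M * (quasiConst q * 2) with hΛ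
  have hqc0 : quasiConst q ≠ 0 := (zero_lt_one.trans_le (one_le_quasiConst q)).ne'
  have hM0 : (M : ℝ≥0∞) ≠ 0 := by exact_mod_cast (zero_lt_one.trans_le hM1).ne'
  have hΛ0 : Λ ≠ 0 := mul_ne_zero (mul_ne_zero (by simp) hM0) (mul_ne_zero hqc0 (by simp))
  have hΛt : Λ ≠ ∞ := by finiteness
  have hΛn : Λ.toNNReal ≠ 0 := fun h => hΛ0 (by rw [← ENNReal.coe_toNNReal hΛt, h]; rfl)
  have hw : ∀ i, ((u i / Λ.toNNReal : ℝ≥0) : ℝ≥0∞) = Λ⁻¹ * u i := fun i => by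
    rw [ENNReal.coe_div hΛn, ENNReal.coe_toNNReal hΛt, div_eq_mul_inv, mul_comm]
  obtain ⟨A, h0, h1, h2⟩ := exists_matrix_zero hq hsa (y := fun i => u i / Λ.toNNReal) hsq (by
      simp only [hw]
      rw [seqNorm_const_mul hq0]
      exact ENNReal.mul_ne_top (ENNReal.inv_ne_top.2 hΛ0) huq) hL0 fun j => by
    simp only [hw]
    rw [seqNorm_const_mul hq0, mul_comm, ← div_eq_mul_inv]
    refine ENNReal.div_le_of_le_mul' ?_
    calc seqNorm q (fun i => u (i + j)) ≤ seqNorm q (fun i => u (i + L * (j / L))) :=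
          seqNorm_mono q fun i => by
            exact_mod_cast hua (Nat.add_le_add_left (Nat.mul_div_le j L) i)
      _ ≤ 6 * M * (quasiConst q * (2 * seqNorm q (fun i => s (i + j / L)))) := htail (j / L)
      _ = Λ * seqNorm q (fun i => s (i + j / L)) := by rw [hΛ]; ring
  refine ⟨fun j k => Λ * A j k, (h0.const_mul_exp_zero Λ).mono ?_,
    (h1.const_mul (Or.inl hq0)).mono ?_, fun j => ?_⟩
  · have h3 : (2 * L + 2 : ℝ≥0) ≤ 8 * M := by
      calc (2 * L + 2 : ℝ≥0) ≤ 2 * (3 * M) + 2 * M := by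
            gcongr
            exact le_mul_of_one_le_right zero_le hM1
        _ = 8 * M := by ring
    have h4 : (2 * L + 2 : ℝ≥0∞) ≤ 8 * M := by exact_mod_cast h3
    calc quasiConst 0 * (2 * L + 2) ≤ quasiConst 0 * (8 * M) := by gcongr
      _ = quasiConst 0 * 8 * M := by ring
      _ ≤ C * M := by gcongr; exact le_self_add
  · calc Λ * (quasiConst q * 2) = 6 * (quasiConst q * 2) * (quasiConst q * 2) * M := by
          rw [hΛ]; ring
      _ ≤ C * M := by gcongr; exact le_add_self
  · rw [app_const_mul]
    calc (u j : ℝ≥0∞) = Λ * ((u j / Λ.toNNReal : ℝ≥0) : ℝ≥0∞) := by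
          rw [hw, ← mul_assoc, ENNReal.mul_inv_cancel hΛ0 hΛt, one_mul]
      _ ≤ _ := mul_le_mul_right (h2 j) _

theorem isUniformCalderonMityagin_of_one_le {p q : ℝ≥0∞} (hpq : p < q) (hq : 1 ≤ q) :
    IsUniformCalderonMityagin p q := by
  rcases eq_or_ne p 0 with rfl | hp
  · exact isUniformCalderonMityagin_zero hq
  · exact isUniformCalderonMityagin_of_pos hp hpq hq

theorem IsUniformCalderonMityagin.isCalderonMityagin {p q : ℝ≥0∞}
    (h : IsUniformCalderonMityagin p q) : IsCalderonMityagin p q := by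
  obtain ⟨C, h⟩ := h
  intro x y hx hM
  obtain ⟨T, hT, hTx⟩ := h x y hx hM
  refine ⟨T, hT.trans_lt (ENNReal.mul_lt_top ENNReal.coe_lt_top ?_), hTx⟩
  split_ifs
  · exact max_lt (by simp) hM
  · exact hM

/-! ### Block norms and the K-functional -/

theorem tsum_eq_tsum_tsum_pair (f : ℕ → ℝ≥0∞) : ∑' k, f k = ∑' i, ∑' m, f (Nat.pair i m) := by
  rw [← Nat.pairEquiv.tsum_eq f, ENNReal.tsum_prod']
  rfl

/-- The `ℓ^q` norms of the blocks of a sequence. -/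
noncomputable def blockNorm (q : ℝ≥0∞) (u : ℕ → ℝ≥0∞) (j : ℕ) : ℝ≥0∞ :=
  seqNorm q fun m => u (Nat.pair j m)

/-- Within a block the ℓ^q norm is at most the ℓ^r norm, for r > 0; for r = 0 every block of nonzero
norm contains a nonzero entry. -/
theorem seqNorm_blockNorm_le {q r : ℝ≥0∞} (hq : 0 < q.toReal) (hrq : r ≤ q) (u : ℕ → ℝ≥0∞) :
    seqNorm r (blockNorm q u) ≤ seqNorm r u := by
  have hqt := (ENNReal.toReal_pos_iff.1 hq).2
  rcases exponent_cases r with rfl | rfl | hr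
  · rw [seqNorm_exp_zero, seqNorm_exp_zero,
      tsum_eq_tsum_tsum_pair fun k => if u k = 0 then 0 else 1]
    refine ENNReal.tsum_le_tsum fun j => ?_
    by_cases h : ∃ m, u (Nat.pair j m) ≠ 0
    · obtain ⟨m, hm⟩ := h
      refine le_trans ?_ (ENNReal.le_tsum m)
      rw [if_neg hm]
      split_ifs <;> simp
    · push Not at h
      have : blockNorm q u j = 0 := by simp [blockNorm, h, seqNorm_zero]
      simp [this]
  · exact absurd hrq (not_le.2 hqt)
  · have hle : r.toReal ≤ q.toReal := ENNReal.toReal_mono hqt.ne hrq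
    rw [seqNorm_le_iff hr, seqNorm_rpow hr,
      tsum_eq_tsum_tsum_pair fun k => u k ^ r.toReal]
    refine ENNReal.tsum_le_tsum fun j => ?_
    rw [← seqNorm_rpow hr fun m => u (Nat.pair j m)]
    exact ENNReal.rpow_le_rpow (seqNorm_anti (ENNReal.toReal_pos_iff.1 hr).1.ne' hrq _) hr.le

theorem seqNorm_const_mul_le (r : ℝ≥0∞) {c : ℝ≥0∞} (hc : 1 ≤ c) (u : ℕ → ℝ≥0∞) :
    seqNorm r (fun k => c * u k) ≤ c * seqNorm r u := by
  rcases eq_or_ne r 0 with rfl | hr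
  · exact (seqNorm_exp_zero_const_mul c u).trans (le_mul_of_one_le_left' hc)
  · exact (seqNorm_const_mul hr c u).le

/-- A decomposition x = x₀ + x₁ induces one of y: each y_j goes entirely to the part whose j-th
block norm is larger, and taking block norms is bounded on both spaces. -/
theorem K_le_of_le_blockNorm {p q : ℝ≥0∞} (hq : 0 < q.toReal) (hpq : p < q) {x y : ℕ → ℝ}
    (hxy : ∀ j, ‖y j‖ₑ ≤ blockNorm q (fun k => ‖x k‖ₑ) j) (t : ℝ≥0) :
    K p q t y ≤ quasiConst q * 2 * K p q t x := by
  classical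
  set c := quasiConst q * 2 with hc
  have hc1 : 1 ≤ c := one_le_mul (one_le_quasiConst q) (by norm_num)
  have hct : c ≠ ∞ := ENNReal.mul_ne_top (quasiConst_ne_top q) (by simp)
  rw [← ENNReal.div_le_iff' (zero_lt_one.trans_le hc1).ne' hct]
  refine le_iInf₂ fun x₀ h₀ => le_iInf₂ fun x₁ h₁ => le_iInf fun hx => ?_
  rw [ENNReal.div_le_iff' (zero_lt_one.trans_le hc1).ne' hct]
  set b₀ := blockNorm q (fun k => ‖x₀ k‖ₑ) with hb₀
  set b₁ := blockNorm q (fun k => ‖x₁ k‖ₑ) with hb₁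
  have hb : ∀ j, ‖y j‖ₑ ≤ quasiConst q * (b₀ j + b₁ j) := fun j => by
    refine (hxy j).trans (le_trans (seqNorm_mono q fun m => ?_) (seqNorm_add_le q _ _))
    rw [hx]
    exact enorm_add_le _ _
  set y₀ : ℕ → ℝ := fun j => if b₁ j ≤ b₀ j then y j else 0 with hy₀
  set y₁ : ℕ → ℝ := fun j => if b₁ j ≤ b₀ j then 0 else y j with hy₁
  have hn : ∀ (r : ℝ≥0∞) (z w : ℕ → ℝ), r ≤ q →
      (∀ j, ‖z j‖ₑ ≤ c * blockNorm q (fun k => ‖w k‖ₑ) j) → ellNorm r z ≤ c * ellNorm r w :=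
    fun r z w hr h => by
      rw [ellNorm_eq, ellNorm_eq]
      refine (seqNorm_mono r h).trans ((seqNorm_const_mul_le r hc1 _).trans ?_)
      gcongr
      exact seqNorm_blockNorm_le hq hr _
  have e₀ := hn p y₀ x₀ hpq.le fun j => by
    by_cases h : b₁ j ≤ b₀ j
    · simp only [hy₀, if_pos h]
      refine (hb j).trans ?_
      rw [hc, mul_assoc, two_mul]
      gcongr
    · simp only [hy₀, if_neg h, enorm_zero]; exact zero_le
  have e₁ := hn q y₁ x₁ le_rfl fun j => by
    by_cases h : b₁ j ≤ b₀ j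
    · simp only [hy₁, if_pos h, enorm_zero]; exact zero_le
    · simp only [hy₁, if_neg h]
      refine (hb j).trans ?_
      rw [hc, mul_assoc, two_mul]
      gcongr
      exact (not_le.1 h).le
  have hmem : ∀ (r : ℝ≥0∞) (z w : ℕ → ℝ), w ∈ ell r → ellNorm r z ≤ c * ellNorm r w → z ∈ ell r :=
    fun r z w hw h => by
      rw [ellNorm_eq, ellNorm_eq] at h
      exact mem_ell_iff.2 (ne_top_of_le_ne_top (ENNReal.mul_ne_top hct (mem_ell_iff.1 hw)) h)
  refine (iInf₂_le_of_le y₀ (hmem p y₀ x₀ h₀ e₀)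
    (iInf₂_le_of_le y₁ (hmem q y₁ x₁ h₁ e₁) (iInf_le _ ?_))).trans ?_
  · funext j
    simp only [hy₀, hy₁, Pi.add_apply]
    split_ifs <;> simp
  · rw [mul_add, mul_left_comm]
    gcongr

theorem kOrbNorm_lt_top_of_le_blockNorm {p q : ℝ≥0∞} (hq : 0 < q.toReal) (hpq : p < q)
    {x y : ℕ → ℝ} (hxy : ∀ j, ‖y j‖ₑ ≤ blockNorm q (fun k => ‖x k‖ₑ) j) :
    kOrbNorm p q x y < ∞ := by
  have h : kOrbNorm p q x y ≤ quasiConst q * 2 := iSup₂_le fun t _ =>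
    ENNReal.div_le_of_le_mul (K_le_of_le_blockNorm hq hpq hxy t)
  exact h.trans_lt (ENNReal.mul_lt_top (quasiConst_ne_top q).lt_top (by simp))

/-! ### Matrices and columns of operators on the couple -/

theorem ellNorm_apply_le {p q r : ℝ≥0∞} (T : sumSpace p q →ₗ[ℝ] sumSpace p q) {C : ℝ≥0∞}
    (hT : opNorm r T ≤ C) (hC : C ≠ ∞) (z : sumSpace p q) (hz : (z : ℕ → ℝ) ∈ ell r) :
    seqNorm r (fun k => ‖(T z : ℕ → ℝ) k‖ₑ) ≤ C * seqNorm r (fun k => ‖(z : ℕ → ℝ) k‖ₑ) := by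
  rw [← ellNorm_eq, ← ellNorm_eq]
  rcases eq_or_ne z 0 with rfl | hz0
  · rw [map_zero, ellNorm_eq]
    simp [seqNorm_zero]
  · rw [← ENNReal.div_le_iff_le_mul (Or.inr hC)
      (Or.inl (by rw [ellNorm_eq]; exact mem_ell_iff.1 hz))]
    refine le_trans ?_ hT
    exact le_iSup_of_le z (le_iSup_of_le hz (le_iSup_of_le hz0 le_rfl))

theorem single_mem_ell (r : ℝ≥0∞) (k : ℕ) (c : ℝ) : Pi.single k c ∈ ell r := by
  have h0 : Memℓp (Pi.single k c : ℕ → ℝ) 0 := memℓp_zero ?_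
  · exact h0.of_exponent_ge zero_le
  refine (Set.finite_singleton k).subset fun i hi => ?_
  by_contra h
  exact hi (Pi.single_eq_of_ne (M := fun _ => ℝ) h c)

theorem seqNorm_enorm_single {r : ℝ≥0∞} (hr : r ≠ 0) (k : ℕ) :
    seqNorm r (fun i => ‖(Pi.single k (1 : ℝ) : ℕ → ℝ) i‖ₑ) = 1 := by
  rw [← seqNorm_single hr k]
  congr 1
  funext i
  by_cases h : i = k
  · subst h; simp
  · simp [h]

/-- An operator that is bounded on `ℓ^q` is dominated by the matrix of the absolute values of its
entries. -/
theorem enorm_apply_le_app {p q : ℝ≥0∞} (hpq : p < q) (hq : 0 < q.toReal)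
    (T : sumSpace p q →ₗ[ℝ] sumSpace p q) {C : ℝ≥0∞} (hT : opNorm q T ≤ C) (hC : C ≠ ∞)
    (z : sumSpace p q) (j : ℕ) :
    ‖(T z : ℕ → ℝ) j‖ₑ ≤ app (fun j k => ‖(T ⟨Pi.single k 1, (mem_sumSpace_iff hpq).2
      (single_mem_ell q k 1)⟩ : ℕ → ℝ) j‖ₑ) (fun k => ‖(z : ℕ → ℝ) k‖ₑ) j := by
  have hq0 : q ≠ 0 := (ENNReal.toReal_pos_iff.1 hq).1.ne'
  set E : ℕ → sumSpace p q := fun k =>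
    ⟨Pi.single k 1, (mem_sumSpace_iff hpq).2 (single_mem_ell q k 1)⟩ with hE
  have hzq := (mem_sumSpace_iff hpq).1 z.2
  have hfin : ∑' k, ‖(z : ℕ → ℝ) k‖ₑ ^ q.toReal ≠ ∞ := by
    rw [← seqNorm_rpow hq]
    exact ENNReal.rpow_ne_top_of_nonneg hq.le (mem_ell_iff.1 hzq)
  -- R n is z without its first n coordinates; it tends to 0 in ℓ^q because q < ∞.
  set R : ℕ → sumSpace p q := fun n => z - ∑ k ∈ Finset.range n, (z : ℕ → ℝ) k • E k with hR
  have hRv : ∀ n i, (R n : ℕ → ℝ) i = if i < n then 0 else (z : ℕ → ℝ) i := fun n i => by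
    simp only [hR, hE, Submodule.coe_sub, Submodule.coe_sum, Submodule.coe_smul, Pi.sub_apply,
      Finset.sum_apply, Pi.smul_apply, smul_eq_mul, Pi.single_apply, mul_ite, mul_one, mul_zero,
      Finset.sum_ite_eq, Finset.mem_range]
    split_ifs <;> simp
  have hRn : ∀ n, seqNorm q (fun i => ‖(R n : ℕ → ℝ) i‖ₑ)
      = (∑' i, ‖(z : ℕ → ℝ) (i + n)‖ₑ ^ q.toReal) ^ (1 / q.toReal) := fun n => by
    rw [seqNorm_of_pos hq, ← ENNReal.summable.sum_add_tsum_nat_add' (k := n),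
      Finset.sum_eq_zero, zero_add]
    · congr 1
      refine tsum_congr fun i => ?_
      rw [hRv, if_neg (by omega)]
    · intro i hi
      rw [hRv, if_pos (Finset.mem_range.1 hi), enorm_zero, ENNReal.zero_rpow_of_pos hq]
  have hlim : Filter.Tendsto (fun n => app (fun j k => ‖(T (E k) : ℕ → ℝ) j‖ₑ)
      (fun k => ‖(z : ℕ → ℝ) k‖ₑ) j + C * seqNorm q (fun i => ‖(R n : ℕ → ℝ) i‖ₑ)) Filter.atTop
      (nhds (app (fun j k => ‖(T (E k) : ℕ → ℝ) j‖ₑ) (fun k => ‖(z : ℕ → ℝ) k‖ₑ) j + C * 0)) := by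
    refine tendsto_const_nhds.add (ENNReal.Tendsto.const_mul ?_ (Or.inr hC))
    simp_rw [hRn]
    have h1 := (ENNReal.tendsto_sum_nat_add _ hfin).ennrpow_const (1 / q.toReal)
    rwa [ENNReal.zero_rpow_of_pos (by positivity)] at h1
  rw [mul_zero, add_zero] at hlim
  refine ge_of_tendsto' hlim fun n => ?_
  have hdec : T z = ∑ k ∈ Finset.range n, (z : ℕ → ℝ) k • T (E k) + T (R n) := by
    rw [hR, map_sub, map_sum]
    simp
  rw [hdec]
  simp only [Submodule.coe_add, Submodule.coe_sum, Submodule.coe_smul, Pi.add_apply,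
    Finset.sum_apply, Pi.smul_apply, smul_eq_mul]
  refine (enorm_add_le _ _).trans (add_le_add ?_ ?_)
  · refine (enorm_sum_le _ _).trans (le_trans (le_of_eq ?_) (ENNReal.sum_le_tsum (Finset.range n)))
    refine Finset.sum_congr rfl fun k _ => ?_
    rw [enorm_mul, mul_comm]
  · exact (le_seqNorm hq0 (fun i => ‖(T (R n) : ℕ → ℝ) i‖ₑ) j).trans
      (ellNorm_apply_le T hT hC (R n) ((mem_sumSpace_iff hpq).1 (R n).2))

/-- The columns of an operator on the couple are bounded in some `ℓ^r` with `0 < r < q`. -/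
theorem exists_column_bound {p q : ℝ≥0∞} (hpq : p < q) (hqt : q ≠ ∞) :
    ∃ r : ℝ≥0∞, r ≠ 0 ∧ r < q ∧ ∀ T : sumSpace p q →ₗ[ℝ] sumSpace p q, coupleNorm T < ∞ →
      ∃ C : ℝ≥0, ∀ k, seqNorm r (fun j => ‖(T ⟨Pi.single k 1, (mem_sumSpace_iff hpq).2
        (single_mem_ell q k 1)⟩ : ℕ → ℝ) j‖ₑ) ≤ C := by
  have hq0 : q ≠ 0 := (bot_le.trans_lt hpq).ne'
  rcases eq_or_ne p 0 with rfl | hp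
  · refine ⟨q / 2, by simp [hq0], ENNReal.half_lt_self hq0 hqt, fun T hT => ?_⟩
    have hr : 0 < (q / 2).toReal := ENNReal.toReal_pos (by simp [hq0])
      (ENNReal.div_ne_top hqt (by simp))
    lift coupleNorm T to ℝ≥0 using hT.ne with D hD
    have hD' : coupleNorm T ≤ D := hD.ge
    refine ⟨((D * D ^ (q / 2).toReal) ^ (1 / (q / 2).toReal) : ℝ≥0), fun k => ?_⟩
    set v : ℕ → ℝ := (T ⟨Pi.single k 1, (mem_sumSpace_iff hpq).2 (single_mem_ell q k 1)⟩).1 with hv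
    have h0 : seqNorm 0 (fun j => ‖v j‖ₑ) ≤ D := by
      have h1 := ellNorm_apply_le T ((le_max_left _ _).trans hD') ENNReal.coe_ne_top
        ⟨Pi.single k 1, (mem_sumSpace_iff hpq).2 (single_mem_ell q k 1)⟩ (single_mem_ell 0 k 1)
      refine h1.trans (mul_le_of_le_one_right' ?_)
      rw [seqNorm_exp_zero, tsum_eq_single k]
      · split_ifs <;> simp
      · intro i hi
        simp [hi]
    have h1 : ∀ j, ‖v j‖ₑ ≤ D := fun j => by
      have h1 := ellNorm_apply_le T ((le_max_right _ _).trans hD') ENNReal.coe_ne_top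
        ⟨Pi.single k 1, (mem_sumSpace_iff hpq).2 (single_mem_ell q k 1)⟩ (single_mem_ell q k 1)
      refine (le_seqNorm hq0 (fun j => ‖v j‖ₑ) j).trans (h1.trans ?_)
      rw [seqNorm_enorm_single hq0, mul_one]
    rw [seqNorm_le_iff hr, ENNReal.coe_rpow_of_nonneg _ (by positivity), ← ENNReal.rpow_mul,
      one_div_mul_cancel hr.ne', ENNReal.rpow_one]
    calc ∑' j, ‖v j‖ₑ ^ (q / 2).toReal
        ≤ ∑' j, (if ‖v j‖ₑ = 0 then 0 else 1) * (D : ℝ≥0∞) ^ (q / 2).toReal := by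
          refine ENNReal.tsum_le_tsum fun j => ?_
          split_ifs with h
          · rw [h, ENNReal.zero_rpow_of_pos hr]; exact zero_le
          · rw [one_mul]; exact ENNReal.rpow_le_rpow (h1 j) hr.le
      _ ≤ D * (D : ℝ≥0∞) ^ (q / 2).toReal := by
          rw [ENNReal.tsum_mul_right, ← seqNorm_exp_zero]
          gcongr
      _ = _ := by rw [ENNReal.coe_mul, ENNReal.coe_rpow_of_nonneg _ hr.le]
  · refine ⟨p, hp, hpq, fun T hT => ⟨(coupleNorm T).toNNReal, fun k => ?_⟩⟩
    rw [ENNReal.coe_toNNReal hT.ne]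
    have h1 := ellNorm_apply_le T (le_max_left (opNorm p T) (opNorm q T)) hT.ne
      ⟨Pi.single k 1, (mem_sumSpace_iff hpq).2 (single_mem_ell q k 1)⟩ (single_mem_ell p k 1)
    rwa [seqNorm_enorm_single hp, mul_one] at h1

/-! ### Failure for q < 1: the block sequences -/

/-- For a = (h/n)^(1/e) and c = (h/n²)^(1/e), as n grows, n a^ρ is a multiple of n^(1-ρ/e) and tends
to ∞, while n² c and the ratio of n² c to n a tend to 0, the latter two because e < 1. A large n
therefore meets all requirements. -/
theorem exists_block_size {e ρ : ℝ} (hρ : 0 < ρ) (hρe : ρ < e) (he : e < 1) {h : ℝ} (hh : 0 < h)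
    (K B : ℝ) {μ : ℝ} (hμ : 0 < μ) :
    ∃ n : ℕ, 0 < n ∧ B ≤ n * ((h / n) ^ (1 / e)) ^ ρ ∧
      K * (n ^ 2 * (h / n ^ 2) ^ (1 / e)) ≤ n * (h / n) ^ (1 / e) ∧
      (n : ℝ) ^ 2 * (h / n ^ 2) ^ (1 / e) ≤ μ := by
  have he0 : 0 < e := hρ.trans hρe
  have hdec : 0 < 1 / e - 1 := by
    rw [sub_pos, lt_one_div zero_lt_one he0]
    simpa using he
  have hinc : 0 < 1 - ρ / e := by
    rw [sub_pos, div_lt_one he0]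
    exact hρe
  have hnat := tendsto_natCast_atTop_atTop (R := ℝ)
  have t1 := ((tendsto_rpow_atTop hinc).comp hnat).const_mul_atTop
    (Real.rpow_pos_of_pos hh (ρ / e))
  have t2 := ((tendsto_rpow_neg_atTop hdec).comp hnat).const_mul K
  have t3 := ((tendsto_rpow_neg_atTop (by linarith : 0 < 2 * (1 / e - 1))).comp hnat).const_mul
    (h ^ (1 / e))
  rw [mul_zero] at t2 t3
  obtain ⟨n, h1, h2, h3, hn⟩ := ((t1.eventually_ge_atTop B).and ((t2.eventually_le_const
    zero_lt_one).and ((t3.eventually_le_const hμ).and (Filter.eventually_gt_atTop 0)))).exists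
  have hn' : (0 : ℝ) < n := by exact_mod_cast hn
  simp only [Function.comp_apply] at h1 h2 h3
  have ea : (h / n) ^ (1 / e) = h ^ (1 / e) * (n : ℝ) ^ (-(1 / e)) := by
    rw [Real.div_rpow hh.le hn'.le, Real.rpow_neg hn'.le, div_eq_mul_inv]
  have ec : (n : ℝ) ^ 2 * (h / n ^ 2) ^ (1 / e) = h ^ (1 / e) * (n : ℝ) ^ (-(2 * (1 / e - 1))) := by
    rw [Real.div_rpow hh.le (by positivity), ← Real.rpow_natCast, ← Real.rpow_mul hn'.le,
      div_eq_mul_inv, ← Real.rpow_neg hn'.le, mul_left_comm, ← Real.rpow_add hn']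
    congr 2
    push_cast
    ring
  refine ⟨n, hn, h1.trans (le_of_eq ?_), ?_, ec ▸ h3⟩
  · rw [ea, Real.mul_rpow (by positivity) (by positivity), ← Real.rpow_mul hh.le,
      ← Real.rpow_mul hn'.le, mul_left_comm, one_div_mul_eq_div]
    congr 1
    nth_rewrite 2 [← Real.rpow_one (n : ℝ)]
    rw [← Real.rpow_add hn']
    congr 1
    ring
  · rw [ec, ea]
    have e1 : (n : ℝ) ^ (-(2 * (1 / e - 1)))
        = (n : ℝ) ^ (-(1 / e - 1)) * (n * (n : ℝ) ^ (-(1 / e))) := by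
      nth_rewrite 3 [← Real.rpow_one (n : ℝ)]
      rw [← Real.rpow_add hn', ← Real.rpow_add hn']
      congr 1
      ring
    rw [e1]
    calc K * (h ^ (1 / e) * ((n : ℝ) ^ (-(1 / e - 1)) * (n * (n : ℝ) ^ (-(1 / e)))))
        = (K * (n : ℝ) ^ (-(1 / e - 1))) * (n * (h ^ (1 / e) * (n : ℝ) ^ (-(1 / e)))) := by ring
      _ ≤ 1 * (n * (h ^ (1 / e) * (n : ℝ) ^ (-(1 / e)))) := by gcongr
      _ = _ := one_mul _

/-- Parameters of the block sequences for which `K`-divisibility by operators fails if `q < 1`. -/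
theorem exists_block_parameters {e ρ : ℝ} (hρ : 0 < ρ) (hρe : ρ < e) (he : e < 1) :
    ∃ (n : ℕ → ℕ) (a c : ℕ → ℝ≥0), (∀ k, 0 < n k) ∧ (∀ k, 0 < a k) ∧
      (∀ k, n k * a k ^ e = (1 / 2) ^ k) ∧ (∀ k, n k * c k ^ e = a k ^ e) ∧
      (∀ k : ℕ, (k + 1) * ∑ i ∈ Finset.range k, (n i : ℝ≥0) ^ 2 * c i ^ ρ ≤ n k * a k ^ ρ) ∧
      ∀ k i : ℕ, (k + 1) * ((n (i + k) : ℝ≥0) ^ 2 * c (i + k)) ≤ (1 / 2) ^ i * (n k * a k) := by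
  have he0 : 0 < e := hρ.trans hρe
  have hstep : ∀ (k : ℕ) (s : ℝ × {μ : ℝ // 0 < μ}), ∃ n : ℕ, 0 < n ∧
      (k + 1) * s.1 ≤ n * (((1 / 2) ^ k / n : ℝ) ^ (1 / e)) ^ ρ ∧
      ((k : ℝ) + 1) * (n ^ 2 * ((1 / 2) ^ k / n ^ 2 : ℝ) ^ (1 / e))
        ≤ n * ((1 / 2) ^ k / n : ℝ) ^ (1 / e) ∧
      (n : ℝ) ^ 2 * ((1 / 2) ^ k / n ^ 2 : ℝ) ^ (1 / e) ≤ (1 / 2) ^ k * s.2 := fun k s =>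
    exists_block_size hρ hρe he (by positivity) _ _ (mul_pos (by positivity) s.2.2)
  choose N hN0 hN1 hN2 hN3 using hstep
  set A : ℕ → ℕ → ℝ := fun k n => ((1 / 2) ^ k / n : ℝ) ^ (1 / e) with hA
  set D : ℕ → ℕ → ℝ := fun k n => ((1 / 2) ^ k / n ^ 2 : ℝ) ^ (1 / e) with hD
  have hA0 : ∀ k n, 0 < n → 0 < A k n := fun k n hn => by
    have : (0 : ℝ) < n := by exact_mod_cast hn
    positivity
  have hD0 : ∀ k n, 0 ≤ D k n := fun k n => by positivity
  -- The state before step k holds the accumulated sum of n_i² c_i^ρ, which n_k a_k^ρ must beat, and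
  -- the minimum of 1 and the earlier n_i a_i / (i + 1), below which n_k² c_k must stay.
  let S : ℕ → ℝ × {μ : ℝ // 0 < μ} := fun k => Nat.rec (0, ⟨1, zero_lt_one⟩)
    (fun k s => (s.1 + (N k s : ℝ) ^ 2 * D k (N k s) ^ ρ,
      ⟨min s.2 (N k s * A k (N k s) / (k + 1)), lt_min s.2.2 (div_pos (mul_pos
        (by exact_mod_cast hN0 k s) (hA0 k _ (hN0 k s))) (by positivity))⟩)) k
  set n : ℕ → ℕ := fun k => N k (S k) with hn
  have hS1 : ∀ k, (S (k + 1)).1 = (S k).1 + (n k : ℝ) ^ 2 * D k (n k) ^ ρ := fun k => rfl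
  have hS2 : ∀ k, ((S (k + 1)).2 : ℝ) = min ((S k).2 : ℝ) (n k * A k (n k) / (k + 1)) :=
    fun k => rfl
  have hB : ∀ k, (S k).1 = ∑ i ∈ Finset.range k, (n i : ℝ) ^ 2 * D i (n i) ^ ρ := fun k => by
    induction k with
    | zero => rfl
    | succ k ih => rw [hS1, ih, Finset.sum_range_succ]
  have hμ : ∀ k i, ((S (k + 1 + i)).2 : ℝ) ≤ n k * A k (n k) / (k + 1) := fun k i => by
    induction i with
    | zero => rw [add_zero, hS2]; exact min_le_right _ _
    | succ i ih => rw [← add_assoc, hS2]; exact (min_le_left _ _).trans ih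
  have hn0 : ∀ k, (0 : ℝ) < n k := fun k => by exact_mod_cast hN0 k (S k)
  refine ⟨n, fun k => ⟨A k (n k), (hA0 k _ (hN0 k _)).le⟩, fun k => ⟨D k (n k), hD0 k _⟩,
    fun k => hN0 k _, fun k => hA0 k _ (hN0 k _), fun k => ?_, fun k => ?_, fun k => ?_,
    fun k i => ?_⟩
  · apply NNReal.coe_injective
    push_cast
    simp only [hA]
    change (n k : ℝ) * (((1 / 2) ^ k / n k : ℝ) ^ (1 / e)) ^ e = (1 / 2) ^ k
    rw [← Real.rpow_mul (by positivity), one_div_mul_cancel he0.ne', Real.rpow_one,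
      mul_div_cancel₀ _ (hn0 k).ne']
  · apply NNReal.coe_injective
    push_cast
    change (n k : ℝ) * (((1 / 2) ^ k / n k ^ 2 : ℝ) ^ (1 / e)) ^ e
      = (((1 / 2) ^ k / n k : ℝ) ^ (1 / e)) ^ e
    rw [← Real.rpow_mul (by positivity), ← Real.rpow_mul (by positivity),
      one_div_mul_cancel he0.ne', Real.rpow_one, Real.rpow_one]
    have := (hn0 k).ne'
    field_simp
  · rw [← NNReal.coe_le_coe]
    push_cast
    have h1 := hN1 k (S k)
    rw [hB] at h1
    exact h1
  · rw [← NNReal.coe_le_coe]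
    push_cast
    change ((k : ℝ) + 1) * ((n (i + k) : ℝ) ^ 2 * D (i + k) (n (i + k)))
      ≤ (1 / 2) ^ i * (n k * A k (n k))
    -- The block k itself is handled by the ratio of n² c to n a, later blocks by the running
    -- minimum.
    rcases i with _ | i
    · rw [zero_add, pow_zero, one_mul]
      exact hN2 k (S k)
    · have h3 := hN3 (i + 1 + k) (S (i + 1 + k))
      have h4 := hμ k i
      rw [show k + 1 + i = i + 1 + k by ring, le_div_iff₀ (by positivity)] at h4
      calc ((k : ℝ) + 1) * ((n (i + 1 + k) : ℝ) ^ 2 * D (i + 1 + k) (n (i + 1 + k)))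
          ≤ (k + 1) * ((1 / 2) ^ (i + 1 + k) * (S (i + 1 + k)).2) := by gcongr
        _ = (1 / 2) ^ (i + 1 + k) * ((S (i + 1 + k)).2 * (k + 1)) := by ring
        _ ≤ (1 / 2) ^ (i + 1) * (n k * A k (n k)) := by
          have h5 : (1 / 2 : ℝ) ^ (i + 1 + k) ≤ (1 / 2) ^ (i + 1) :=
            pow_le_pow_of_le_one (by norm_num) (by norm_num) (by omega)
          refine mul_le_mul h5 h4 ?_ (by positivity)
          exact mul_nonneg (S (i + 1 + k)).2.2.le (by positivity)

/-- For exponents at most 1 the r-th power of the quasi-norm is subadditive, so bounds on the images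
of unit vectors suffice. -/
theorem isBdd_of_columns {r : ℝ≥0∞} (hr : 0 < r.toReal) (hr1 : r.toReal ≤ 1) {C : ℝ≥0∞}
    {A : ℕ → ℕ → ℝ≥0∞} (hA : ∀ k, seqNorm r (fun j => A j k) ≤ C) : IsBdd r C A := fun u => by
  rw [seqNorm_le_iff hr, ENNReal.mul_rpow_of_nonneg _ _ hr.le, seqNorm_rpow hr]
  calc ∑' j, app A u j ^ r.toReal ≤ ∑' j, ∑' k, A j k ^ r.toReal * u k ^ r.toReal := by
        refine ENNReal.tsum_le_tsum fun j => (rpow_tsum_le_tsum_rpow _ hr hr1).trans (le_of_eq ?_)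
        exact tsum_congr fun k => ENNReal.mul_rpow_of_nonneg _ _ hr.le
    _ = ∑' k, (∑' j, A j k ^ r.toReal) * u k ^ r.toReal := by
        rw [ENNReal.tsum_comm]
        simp only [ENNReal.tsum_mul_right]
    _ ≤ ∑' k, C ^ r.toReal * u k ^ r.toReal := by
        refine ENNReal.tsum_le_tsum fun k => ?_
        gcongr
        exact (seqNorm_le_iff hr).1 (hA k)
    _ = _ := ENNReal.tsum_mul_left

theorem app_add_right (A : ℕ → ℕ → ℝ≥0∞) (u v : ℕ → ℝ≥0∞) (j : ℕ) :
    app A (fun k => u k + v k) j = app A u j + app A v j := by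
  simp only [app, mul_add, ENNReal.tsum_add]

theorem sum_rpow_le {ι : Type*} (s : Finset ι) (f : ι → ℝ≥0∞) {ρ : ℝ} (hρ : 0 < ρ) (hρ1 : ρ ≤ 1) :
    ∑ i ∈ s, f i ^ ρ ≤ (s.card : ℝ≥0∞) ^ (1 - ρ) * (∑ i ∈ s, f i) ^ ρ := by
  have h := ENNReal.inner_le_weight_mul_Lp_of_nonneg s ((one_le_inv₀ hρ).2 hρ1) (fun _ => 1)
    (fun i => f i ^ ρ)
  simpa [← ENNReal.rpow_mul, mul_inv_cancel₀ hρ.ne'] using h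

theorem tsum_ite_lt (n : ℕ) (c : ℝ≥0∞) : ∑' i, (if i < n then c else 0) = n * c := by
  rw [tsum_eq_sum (s := Finset.range n) fun i hi => if_neg fun h => hi (Finset.mem_range.2 h),
    Finset.sum_congr rfl fun i hi => if_pos (Finset.mem_range.1 hi)]
  simp

/-- The sequence that takes the value `f k` exactly `n k` times for each `k`. -/
noncomputable def repeatSeq (n : ℕ → ℕ) (f : ℕ → ℝ≥0) (j : ℕ) : ℝ≥0 :=
  if j.unpair.2 < n j.unpair.1 then f j.unpair.1 else 0

/-- The function g may depend on the block, so that sums over selected blocks are covered; g k 0 = 0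
discards the padding. -/
theorem tsum_repeatSeq (n : ℕ → ℕ) (f : ℕ → ℝ≥0) (g : ℕ → ℝ≥0 → ℝ≥0∞) (hg : ∀ k, g k 0 = 0) :
    ∑' j, g (Nat.unpair j).1 (repeatSeq n f j) = ∑' k, n k * g k (f k) := by
  rw [tsum_eq_tsum_tsum_pair]
  refine tsum_congr fun k => ?_
  rw [← tsum_ite_lt]
  refine tsum_congr fun i => ?_
  simp only [repeatSeq, Nat.unpair_pair]
  split_ifs
  exacts [rfl, hg k]

/-- Y has n_k entries a_k in block k, and X splits each of these into n_k entries c_k with the same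
ℓ^q norm. An operator taking X to Y would be bounded on ℓ^r and ℓ^1, and the growth of the
parameters excludes this. -/
theorem not_isCalderonMityagin_of_lt_one {p q : ℝ≥0∞} (hpq : p < q) (hq1 : q < 1) :
    ¬ IsCalderonMityagin p q := by
  intro hCM
  have hq0 : q ≠ 0 := (bot_le.trans_lt hpq).ne'
  have hqt : q ≠ ∞ := (hq1.trans ENNReal.one_lt_top).ne
  have hq : 0 < q.toReal := ENNReal.toReal_pos hq0 hqt
  have hq1' : q.toReal < 1 := by simpa using ENNReal.toReal_strict_mono ENNReal.one_ne_top hq1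
  obtain ⟨r, hr0, hrq, hcol⟩ := exists_column_bound hpq hqt
  have hr : 0 < r.toReal := ENNReal.toReal_pos hr0 (hrq.trans_le le_top).ne
  have hrq' : r.toReal < q.toReal := ENNReal.toReal_strict_mono hqt hrq
  obtain ⟨n, a, c, hn, ha, hna, hnc, hB, hb⟩ := exists_block_parameters hr hrq' hq1'
  set e := q.toReal with he
  set ρ := r.toReal with hρ
  set N : ℕ → ℕ := fun j => n j.unpair.1 with hN
  set Y : ℕ → ℝ≥0 := repeatSeq n a with hY
  set X : ℕ → ℝ≥0 := repeatSeq N (repeatSeq n c) with hX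
  have henorm : ∀ (v : ℝ≥0), ‖(v : ℝ)‖ₑ = v := fun v => by
    rw [Real.enorm_of_nonneg (NNReal.coe_nonneg v), ENNReal.ofReal_coe_nnreal]
  have hXsum : ∀ g : ℕ → ℝ≥0 → ℝ≥0∞, (∀ k, g k 0 = 0) →
      ∑' l, g l.unpair.1.unpair.1 (X l) = ∑' k, (n k : ℝ≥0∞) * (n k * g k (c k)) := fun g hg => by
    rw [hX, tsum_repeatSeq N (repeatSeq n c) (fun j => g j.unpair.1) fun j => hg _]
    exact tsum_repeatSeq n c (fun k v => n k * g k v) fun k => by simp [hg k]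
  have hYe : ∑' j, (Y j : ℝ≥0∞) ^ e = ∑' k, ((1 / 2 : ℝ≥0) : ℝ≥0∞) ^ k := by
    rw [hY, tsum_repeatSeq n a (fun _ v => (v : ℝ≥0∞) ^ e) fun _ => by simp [hq]]
    refine tsum_congr fun k => ?_
    rw [← ENNReal.coe_rpow_of_nonneg _ hq.le]
    exact_mod_cast hna k
  have hgeom : ∑' k, ((1 / 2 : ℝ≥0) : ℝ≥0∞) ^ k = 2 := by
    rw [ENNReal.coe_div (by norm_num)]
    simp
  have hblock : ∀ j, (Y j : ℝ≥0∞) ≤ blockNorm q (fun l => X l) j := fun j => by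
    rw [← ENNReal.rpow_le_rpow_iff hq, blockNorm, seqNorm_rpow hq]
    have h1 : ∀ m, (X (Nat.pair j m) : ℝ≥0∞) ^ e
        = if m < N j then (repeatSeq n c j : ℝ≥0∞) ^ e else 0 := fun m => by
      have h2 : X (Nat.pair j m) = if m < N j then repeatSeq n c j else 0 := by
        rw [hX, repeatSeq, Nat.unpair_pair]
      rw [h2]
      split_ifs
      · rfl
      · simp [hq]
    simp_rw [← he, h1]
    rw [tsum_ite_lt]
    simp only [hY, repeatSeq, hN]
    split_ifs
    · rw [← ENNReal.coe_rpow_of_nonneg _ hq.le, ← ENNReal.coe_rpow_of_nonneg _ hq.le, ← hnc]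
      push_cast
      exact le_rfl
    · simp [hq]
  have hyq : (fun j => (Y j : ℝ)) ∈ ell q := by
    rw [mem_ell_iff, seqNorm_of_pos hq]
    simp only [henorm]
    rw [hYe, hgeom]
    exact ENNReal.rpow_ne_top_of_nonneg (by positivity) (by simp)
  have hxq : (fun j => (X j : ℝ)) ∈ ell q := by
    rw [mem_ell_iff, seqNorm_of_pos hq]
    simp only [henorm]
    have h1 : ∑' l, (X l : ℝ≥0∞) ^ e = ∑' k, ((1 / 2 : ℝ≥0) : ℝ≥0∞) ^ k := by
      rw [hXsum (fun _ v => (v : ℝ≥0∞) ^ e) fun _ => by simp [hq]]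
      refine tsum_congr fun k => ?_
      rw [← ENNReal.coe_rpow_of_nonneg _ hq.le]
      have h2 : (n k : ℝ≥0) * (n k * c k ^ e) = (1 / 2) ^ k := by rw [hnc, hna]
      exact_mod_cast h2
    rw [h1, hgeom]
    exact ENNReal.rpow_ne_top_of_nonneg (by positivity) (by simp)
  set x : sumSpace p q := ⟨fun j => (X j : ℝ), (mem_sumSpace_iff hpq).2 hxq⟩ with hx
  set y : sumSpace p q := ⟨fun j => (Y j : ℝ), (mem_sumSpace_iff hpq).2 hyq⟩ with hy
  have hY0 : (Y (Nat.pair 0 0)) ≠ 0 := by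
    simp only [hY, repeatSeq, Nat.unpair_pair, if_pos (hn 0)]
    exact (ha 0).ne'
  have hx0 : x ≠ 0 := by
    intro h0
    have hX0 : ∀ l, X l = 0 := fun l => by
      have h1 : (X l : ℝ) = 0 := congrFun (congrArg Subtype.val h0) l
      exact_mod_cast h1
    have h1 := hblock (Nat.pair 0 0)
    simp only [blockNorm, hX0, ENNReal.coe_zero, seqNorm_zero] at h1
    exact hY0 (by exact_mod_cast le_antisymm h1 zero_le)
  obtain ⟨T, hT, hTx⟩ := hCM x y hx0 (kOrbNorm_lt_top_of_le_blockNorm hq hpq fun j => by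
    simp only [hx, hy, henorm]
    exact hblock j)
  obtain ⟨C, hC⟩ := hcol T hT
  have hdom := fun j =>
    enorm_apply_le_app hpq hq T (le_max_right (opNorm p T) (opNorm q T)) hT.ne x j
  rw [hTx] at hdom
  simp only [hx, hy, henorm] at hdom
  set A : ℕ → ℕ → ℝ≥0∞ := fun j k => ‖(T ⟨Pi.single k 1, (mem_sumSpace_iff hpq).2
    (single_mem_ell q k 1)⟩ : ℕ → ℝ) j‖ₑ with hA
  have hAr : IsBdd r C A := isBdd_of_columns hr (hrq'.trans hq1').le hC
  have hA1 : IsBdd 1 C A := isBdd_of_columns (by simp) (by simp) fun k =>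
    (seqNorm_anti hr0 (hrq.trans hq1).le _).trans (hC k)
  -- On block k of Y the contribution of the blocks i < k of X is estimated in ℓ^r and that of the
  -- blocks i ≥ k in ℓ^1; both are compared with V = n_k a_k^ρ.
  have key : ∀ k : ℕ, (1 : ℝ≥0∞) ≤ (C : ℝ≥0∞) ^ ρ * ((k + 1 : ℕ) : ℝ≥0∞)⁻¹
      + (2 * C * ((k + 1 : ℕ) : ℝ≥0∞)⁻¹) ^ ρ := fun k => by
    set κ : ℝ≥0∞ := ((k + 1 : ℕ) : ℝ≥0∞) with hκ
    have hκ0 : κ ≠ 0 := by simp [hκ]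
    have hκt : κ ≠ ∞ := by simp [hκ]
    set u : ℕ → ℝ≥0∞ := fun l => if l.unpair.1.unpair.1 < k then (X l : ℝ≥0∞) else 0 with hu
    set v : ℕ → ℝ≥0∞ := fun l => if l.unpair.1.unpair.1 < k then 0 else (X l : ℝ≥0∞) with hv
    have huv : ∀ j, (Y j : ℝ≥0∞) ≤ app A u j + app A v j := fun j => by
      rw [← app_add_right]
      refine (hdom j).trans (app_mono (fun l => ?_) j)
      simp only [hu, hv]
      split_ifs <;> simp
    set V : ℝ≥0∞ := n k * (a k : ℝ≥0∞) ^ ρ with hV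
    have hV0 : V ≠ 0 := mul_ne_zero (by exact_mod_cast (hn k).ne')
      (by simp [hr, (ha k).ne'])
    have hVt : V ≠ ∞ := ENNReal.mul_ne_top (by simp)
      (ENNReal.rpow_ne_top_of_nonneg hr.le ENNReal.coe_ne_top)
    have hinj : Function.Injective (Nat.pair k) := fun i i' h => (Nat.pair_eq_pair.1 h).2
    have hsum : ∀ f : ℕ → ℝ≥0∞, ∑ i ∈ Finset.range (n k), f (Nat.pair k i) ≤ ∑' j, f j := fun f =>
      (ENNReal.sum_le_tsum _).trans (ENNReal.tsum_comp_le_tsum_of_injective hinj f)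
    have hu1 : ∑' l, u l ^ ρ ≤ κ⁻¹ * V := by
      have h1 : ∑' l, u l ^ ρ = ∑ i ∈ Finset.range k, (n i : ℝ≥0∞) * (n i * (c i : ℝ≥0∞) ^ ρ) := by
        have h2 := hXsum (fun i w => if i < k then (w : ℝ≥0∞) ^ ρ else 0) fun i => by simp [hr]
        have h3 : ∀ i ∉ Finset.range k,
            (n i : ℝ≥0∞) * (n i * if i < k then (c i : ℝ≥0∞) ^ ρ else 0) = 0 := fun i hi => by
          rw [if_neg fun h => hi (Finset.mem_range.2 h)]; simp
        rw [tsum_eq_sum h3] at h2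
        calc ∑' l, u l ^ ρ
            = ∑' l, if l.unpair.1.unpair.1 < k then (X l : ℝ≥0∞) ^ ρ else 0 :=
              tsum_congr fun l => by simp only [hu]; split_ifs <;> simp [hr]
          _ = _ := h2
          _ = _ := Finset.sum_congr rfl fun i hi => by rw [if_pos (Finset.mem_range.1 hi)]
      rw [h1, mul_comm, ← div_eq_mul_inv, ENNReal.le_div_iff_mul_le (Or.inl hκ0) (Or.inl hκt)]
      have h3 : ((k + 1 : ℕ) : ℝ≥0) * ∑ i ∈ Finset.range k, (n i : ℝ≥0) * (n i * c i ^ ρ)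
          ≤ n k * a k ^ ρ := by
        refine le_trans (le_of_eq ?_) (hB k)
        push_cast
        congr 1
        exact Finset.sum_congr rfl fun i _ => by ring
      rw [mul_comm]
      simp only [hκ, hV, ← ENNReal.coe_rpow_of_nonneg _ hr.le]
      exact_mod_cast h3
    have hv1 : ∑' l, v l ≤ κ⁻¹ * (2 * (n k * a k)) := by
      have h1 : ∑' l, v l = ∑' i, (n (i + k) : ℝ≥0∞) * (n (i + k) * (c (i + k) : ℝ≥0∞)) := by
        have h2 := hXsum (fun i w => if i < k then 0 else (w : ℝ≥0∞)) fun i => by simp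
        have h3 : ∀ i ∈ Finset.range k,
            (n i : ℝ≥0∞) * (n i * if i < k then 0 else (c i : ℝ≥0∞)) = 0 := fun i hi => by
          rw [if_pos (Finset.mem_range.1 hi)]; simp
        rw [← ENNReal.summable.sum_add_tsum_nat_add' (k := k)
          (f := fun i => (n i : ℝ≥0∞) * (n i * if i < k then 0 else (c i : ℝ≥0∞))),
          Finset.sum_eq_zero h3, zero_add] at h2
        rw [show (∑' l, v l) = _ from h2]
        refine tsum_congr fun i => ?_
        rw [if_neg (by omega)]
      rw [h1, mul_comm, ← div_eq_mul_inv, ENNReal.le_div_iff_mul_le (Or.inl hκ0) (Or.inl hκt),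
        mul_comm, ← ENNReal.tsum_mul_left, ← hgeom, ← ENNReal.tsum_mul_right]
      refine ENNReal.tsum_le_tsum fun i => ?_
      have h3 : ((k + 1 : ℕ) : ℝ≥0) * (n (i + k) * (n (i + k) * c (i + k)))
          ≤ (1 / 2) ^ i * (n k * a k) := by
        refine le_trans (le_of_eq ?_) (hb k i)
        push_cast
        ring
      simp only [hκ]
      exact_mod_cast h3
    have hVle : V ≤ ((C : ℝ≥0∞) ^ ρ * κ⁻¹ + (2 * C * κ⁻¹) ^ ρ) * V := by
      calc V = ∑ i ∈ Finset.range (n k), (Y (Nat.pair k i) : ℝ≥0∞) ^ ρ := by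
            rw [Finset.sum_congr rfl fun i hi => by
              rw [hY, repeatSeq, Nat.unpair_pair, if_pos (Finset.mem_range.1 hi)]]
            simp [hV]
        _ ≤ ∑ i ∈ Finset.range (n k), (app A u (Nat.pair k i) ^ ρ + app A v (Nat.pair k i) ^ ρ) :=
            Finset.sum_le_sum fun i _ => (ENNReal.rpow_le_rpow (huv _) hr.le).trans
              (ENNReal.rpow_add_le_add_rpow _ _ hr.le (hrq'.trans hq1').le)
        _ ≤ (C : ℝ≥0∞) ^ ρ * (κ⁻¹ * V)
            + (n k : ℝ≥0∞) ^ (1 - ρ) * (C * (κ⁻¹ * (2 * (n k * a k)))) ^ ρ := by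
            rw [Finset.sum_add_distrib]
            refine add_le_add ?_ ?_
            · refine (hsum fun j => app A u j ^ ρ).trans ?_
              rw [← seqNorm_rpow hr]
              refine (ENNReal.rpow_le_rpow (hAr u) hr.le).trans ?_
              rw [ENNReal.mul_rpow_of_nonneg _ _ hr.le, seqNorm_rpow hr]
              gcongr
            · refine (sum_rpow_le _ _ hr (hrq'.trans hq1').le).trans ?_
              rw [Finset.card_range]
              have h1 := hA1 v
              simp only [seqNorm_of_pos (r := 1) (by simp), ENNReal.toReal_one, ENNReal.rpow_one,
                div_one] at h1
              gcongr
              exact (hsum fun j => app A v j).trans (h1.trans (by gcongr))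
        _ = (C : ℝ≥0∞) ^ ρ * κ⁻¹ * V
            + (2 * C * κ⁻¹) ^ ρ
              * ((n k : ℝ≥0∞) ^ (1 - ρ) * (n k : ℝ≥0∞) ^ ρ * (a k : ℝ≥0∞) ^ ρ) := by
            rw [show C * (κ⁻¹ * (2 * ((n k : ℝ≥0∞) * a k))) = 2 * C * κ⁻¹ * (n k * a k) by ring,
              ENNReal.mul_rpow_of_nonneg (2 * C * κ⁻¹) _ hr.le,
              ENNReal.mul_rpow_of_nonneg (n k : ℝ≥0∞) _ hr.le]
            ring
        _ = _ := by
            rw [← ENNReal.rpow_add_of_nonneg _ _ (by linarith) hr.le, sub_add_cancel,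
              ENNReal.rpow_one, add_mul]
    rw [← ENNReal.mul_le_mul_iff_left hV0 hVt, one_mul]
    exact hVle
  have hinv : Filter.Tendsto (fun k : ℕ => ((k + 1 : ℕ) : ℝ≥0∞)⁻¹) Filter.atTop (nhds 0) :=
    ENNReal.tendsto_inv_nat_nhds_zero.comp (Filter.tendsto_add_atTop_nat 1)
  have h1 := ENNReal.Tendsto.const_mul (a := (C : ℝ≥0∞) ^ ρ) hinv
    (Or.inr (ENNReal.rpow_ne_top_of_nonneg hr.le ENNReal.coe_ne_top))
  have h2 := (ENNReal.Tendsto.const_mul (a := 2 * (C : ℝ≥0∞)) hinv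
    (Or.inr (ENNReal.mul_ne_top (by simp) ENNReal.coe_ne_top))).ennrpow_const ρ
  -- Letting k tend to ∞ gives 1 ≤ 0.
  have h3 := ge_of_tendsto' (h1.add h2) key
  rw [mul_zero, mul_zero, ENNReal.zero_rpow_of_pos hr, add_zero] at h3
  exact absurd h3 (by simp)

end SeqCouple

theorem mainTheorem2 (p q : ℝ≥0∞) (hpq : p < q) :
    List.TFAE [SeqCouple.IsCalderonMityagin p q,
      SeqCouple.IsUniformCalderonMityagin p q,
      1 ≤ q] := by
  tfae_have 2 → 1 := SeqCouple.IsUniformCalderonMityagin.isCalderonMityagin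
  tfae_have 3 → 2 := SeqCouple.isUniformCalderonMityagin_of_one_le hpq
  tfae_have 1 → 3 := fun h => by
    by_contra hq
    exact SeqCouple.not_isCalderonMityagin_of_lt_one hpq (not_le.1 hq) h
  tfae_finish
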